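/- Let $m\ge 3$ be an integer. A $3$-polytope is the convex hull of finitely many points of $\mathbb{R}^3$ that has nonempty interior. An $m$-prism is a $3$-polytope with the combinatorial type (face lattice) of the product of a convex $m$-gon with a line segment. An $m$-antiprism is a $3$-polytope with $2m$ distinct vertices $u_i, v_i$ ($i\in\mathbb{Z}/m$) whose facets are exactly the two $m$-gons $\mathrm{conv}\{u_i : i\in\mathbb{Z}/m\}$ and $\mathrm{conv}\{v_i : i\in\mathbb{Z}/m\}$ and the $2m$ triangles $u_iu_{i+1}v_i$ and $v_iv_{i+1}u_{i+1}$, $i\in\mathbb{Z}/m$. A triangulation of a $3$-polytope $P$ is a finite set of (nondegenerate) tetrahedra whose vertices are vertices of $P$, whose union is $P$, which have pairwise disjoint interiors, and any two of which intersect in a common (possibly empty) face; its size is the number of its tetrahedra. 1. For every $m$-prism $P$ (in any coordinatization), the minimum size of a triangulation of $P$ is exactly $2m-5+\lceil m/2\rceil$. 2. For every $m$-antiprism $P$ (in any coordinatization), the minimum size of a triangulation of $P$ is exactly $3m-5$. -/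

import Mathlib

namespace MinTri

/-- Euclidean `3`-space. -/
abbrev E3 : Type := EuclideanSpace ℝ (Fin 3)

/-- The Euclidean plane. -/
abbrev E2 : Type := EuclideanSpace ℝ (Fin 2)

/-- A `3`-polytope: the convex hull of finitely many points of `ℝ³`, of dimension three. -/
def IsPolytope3 (P : Set E3) : Prop :=
  (∃ S : Set E3, S.Finite ∧ P = convexHull ℝ S) ∧ (interior P).Nonempty

/-- The faces of a convex set `P`, ordered by inclusion. The empty set and `P` itself are
included, so for a polytope this is the usual face lattice. -/
abbrev FaceLattice {E : Type*} [AddCommGroup E] [Module ℝ E] [TopologicalSpace E]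
    (P : Set E) : Type _ :=
  {F : Set E // IsExposed ℝ P F}

/-- Two polytopes have the same combinatorial type if their face lattices are isomorphic. -/
def SameCombinatorialType {E E' : Type*}
    [AddCommGroup E] [Module ℝ E] [TopologicalSpace E]
    [AddCommGroup E'] [Module ℝ E'] [TopologicalSpace E']
    (P : Set E) (P' : Set E') : Prop :=
  Nonempty (FaceLattice P ≃o FaceLattice P')

/-- A convex `m`-gon in the plane (used for `3 ≤ m`): the convex hull of `m` distinct points, all
of which are vertices, listed in cyclic order, that is, such that consecutive points span edges. -/
def IsConvexPolygon (m : ℕ) (Q : Set E2) : Prop :=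
  ∃ p : ZMod m → E2, Function.Injective p ∧
    Q = convexHull ℝ (Set.range p) ∧
    Q.extremePoints ℝ = Set.range p ∧
    ∀ i : ZMod m, IsExposed ℝ Q (segment ℝ (p i) (p (i + 1)))

/-- An `m`-prism: a `3`-polytope with the combinatorial type of the product of a convex `m`-gon
with a line segment. -/
def IsPrism (m : ℕ) (P : Set E3) : Prop :=
  IsPolytope3 P ∧
    ∃ Q : Set E2, IsConvexPolygon m Q ∧
      SameCombinatorialType P (Q ×ˢ Set.Icc (0 : ℝ) 1)

/-- The facets of a `3`-polytope: its two-dimensional faces. -/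
def facets (P : Set E3) : Set (Set E3) :=
  {F | IsExposed ℝ P F ∧ Module.finrank ℝ (vectorSpan ℝ F) = 2}

/-- An `m`-antiprism: a `3`-polytope with `2 m` vertices `u i`, `v i` (indices modulo `m`) whose
facets are the two `m`-gons spanned by the `u i` and by the `v i`, and a band of `2 m` triangles:
the triangle `u i, u (i + 1), v i` on each edge of the first `m`-gon and, between any two
consecutive ones of these, the triangle `v i, v (i + 1), u (i + 1)` on an edge of the second. -/
def IsAntiprism (m : ℕ) (P : Set E3) : Prop :=
  IsPolytope3 P ∧
    ∃ u v : ZMod m → E3, Function.Injective (Sum.elim u v) ∧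
      P.extremePoints ℝ = Set.range u ∪ Set.range v ∧
      facets P =
        {convexHull ℝ (Set.range u), convexHull ℝ (Set.range v)} ∪
          (Set.range (fun i : ZMod m => convexHull ℝ {u i, u (i + 1), v i}) ∪
            Set.range (fun i : ZMod m => convexHull ℝ {v i, v (i + 1), u (i + 1)}))

/-- `T`, a finite set of tetrahedra given by their vertex sets, is a dissection of the point
configuration `A`. -/
structure IsDissection (A : Set E3) (T : Finset (Finset E3)) : Prop where
  card_eq : ∀ t ∈ T, t.card = 4
  affineIndependent : ∀ t ∈ T, AffineIndependent ℝ (fun x : t => (x : E3))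
  vertices_subset : ∀ t ∈ T, (t : Set E3) ⊆ A
  disjoint_interior : ∀ s ∈ T, ∀ t ∈ T, s ≠ t →
    Disjoint (interior (convexHull ℝ (s : Set E3))) (interior (convexHull ℝ (t : Set E3)))
  iUnion_eq : ⋃ t ∈ T, convexHull ℝ (t : Set E3) = convexHull ℝ A

/-- A triangulation is a dissection in which any two tetrahedra meet in a common face (the face
spanned by their common vertices, possibly empty). -/
structure IsTriangulation (A : Set E3) (T : Finset (Finset E3)) : Prop
    extends IsDissection A T where
  inter_eq : ∀ s ∈ T, ∀ t ∈ T,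
    convexHull ℝ (s : Set E3) ∩ convexHull ℝ (t : Set E3) =
      convexHull ℝ ((s : Set E3) ∩ (t : Set E3))

/-- The numbers of tetrahedra of the triangulations of `P` whose vertices are vertices of `P`. -/
def triangulationSizes (P : Set E3) : Set ℕ :=
  {n | ∃ T : Finset (Finset E3), IsTriangulation (P.extremePoints ℝ) T ∧ T.card = n}

end MinTri

/-! Lower bounds. The vertices of a prism or antiprism lie on two disjoint base `m`-gons `U` and
`V`, so every tetrahedron of a triangulation has 3+1, 2+2 or 1+3 vertices on them. The base `U` with
its vertices removed is convex, hence connected. Therefore the traces on `U` of the tetrahedra with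
at least two vertices in `U` are linked by common pairs of vertices. When this family is built up
along such links, only a 3+1 tetrahedron can bring a new vertex, and at most one; so there are at
least `|U| - 2` of them (`card_left_le`), and symmetrically for `V`. Seen just beneath the base, the
same tetrahedra are linked through common vertices in `V`. Only a 2+2 tetrahedron can bring a new
such apex, and at most one, so `k` apexes force at least `k - 1` of them (`card_apexes_le`).
Altogether a triangulation has at least `|U| + |V| + k - 5` tetrahedra. A lateral facet on an edge
of `U` must contain an apex (`exists_mem_apexes`). In an antiprism this makes every vertex of `V` an
apex, so `k = m`; in a prism the apexes form a vertex cover of the `m`-cycle bounding `V`, so `k ≥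
⌈m/2⌉`.

Upper bounds. Coning the triangulated facets that miss a vertex from that vertex triangulates the
polytope (`isTriangulation_cone`). For an antiprism this already gives `3m - 5`. For a prism it
gives `3m - 6`, usually too many. The diagonals of the side faces are chosen so that the top
vertices `u i` with `i` even and `2 ≤ i ≤ m - 2` lie on none of them. Each such vertex is then in
exactly four tetrahedra, and two flips replace these by three, one of them the corner spanned by the
vertex and its three neighbours (`exists_double_flip`). This saves one tetrahedron for each of
`⌊m/2⌋ - 1` vertices. The flips exist in every coordinatization, because the segment from a simple
vertex to a vertex off two of its facets crosses the triangle of its neighbours (`exists_crossing`).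

The definition of a prism only gives an isomorphism of face lattices. Vertices are recovered as
minimal nonempty faces and facets as maximal proper ones, which turns the isomorphism into a
labelling of the vertices with a known list of facets (`IsPrism.exists_prismData`). -/

namespace MinTri

open Set Filter Topology

/-! ### Exposed faces of polytopes -/

section General
variable {E : Type*} [NormedAddCommGroup E] [NormedSpace ℝ E]

/-- The face of a convex hull cut out by a supporting hyperplane. -/
theorem convexHull_inter_hyperplane {S : Set E} (f : StrongDual ℝ E) {c : ℝ}
    (hS : ∀ s ∈ S, f s ≤ c) :
    convexHull ℝ S ∩ {x | f x = c} = convexHull ℝ (S ∩ {x | f x = c}) := by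
  apply Subset.antisymm
  · have hC : Convex ℝ {x | f x ≤ c ∧ (f x = c → x ∈ convexHull ℝ (S ∩ {x | f x = c}))} := by
      rw [convex_iff_forall_pos]
      rintro x ⟨hx, hx'⟩ y ⟨hy, hy'⟩ a b ha hb hab
      have h1 : f (a • x + b • y) = a * f x + b * f y := by simp
      have hca : c = a * c + b * c := by rw [← add_mul, hab, one_mul]
      refine ⟨by rw [h1]; nlinarith, fun h => ?_⟩
      rw [h1] at h
      have h2 : f x = c := by nlinarith
      have h3 : f y = c := by nlinarith
      exact convex_convexHull ℝ _ (hx' h2) (hy' h3) ha.le hb.le hab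
    rintro x ⟨hx, hxc⟩
    refine (convexHull_min (fun s hs => ?_) hC hx).2 hxc
    exact ⟨hS s hs, fun h => subset_convexHull ℝ _ ⟨hs, h⟩⟩
  · refine subset_inter (convexHull_mono inter_subset_left) ?_
    exact convexHull_min inter_subset_right (convex_hyperplane f.isLinear c)

theorem le_of_mem_convexHull {S : Set E} (f : StrongDual ℝ E) {c : ℝ}
    (hS : ∀ s ∈ S, f s ≤ c) {x : E} (hx : x ∈ convexHull ℝ S) : f x ≤ c :=
  convexHull_min (t := {x | f x ≤ c}) hS (convex_halfSpace_le f.isLinear c) hx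

theorem isExposed_setOf {P : Set E} (f : StrongDual ℝ E) {c : ℝ} (h : ∀ x ∈ P, f x ≤ c) :
    IsExposed ℝ P {x ∈ P | f x = c} := by
  rintro ⟨z, hz, hzc⟩
  refine ⟨f, ?_⟩
  ext x
  constructor
  · rintro ⟨hx, hxc⟩
    exact ⟨hx, fun y hy => (h y hy).trans hxc.ge⟩
  · rintro ⟨hx, hxm⟩
    exact ⟨hx, le_antisymm (h x hx) (hzc ▸ hxm z hz)⟩

theorem isExposed_iff {P F : Set E} : IsExposed ℝ P F ↔
    ∃ (f : StrongDual ℝ E) (c : ℝ), (∀ x ∈ P, f x ≤ c) ∧ F = {x ∈ P | f x = c} := by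
  constructor
  · intro h
    rcases F.eq_empty_or_nonempty with rfl | ⟨z, hz⟩
    · exact ⟨0, 1, by simp, by simp⟩
    · obtain ⟨f, rfl⟩ := h ⟨z, hz⟩
      refine ⟨f, f z, fun x hx => hz.2 x hx, ?_⟩
      ext x
      constructor
      · rintro ⟨hx, hxm⟩
        exact ⟨hx, le_antisymm (hz.2 x hx) (hxm z hz.1)⟩
      · rintro ⟨hx, hxm⟩
        exact ⟨hx, fun y hy => hxm ▸ hz.2 y hy⟩
  · rintro ⟨f, c, h, rfl⟩
    exact isExposed_setOf f h

/-- Inside `P` the face is cut out by a supporting hyperplane. This is what identifies the trace of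
a tetrahedron on a boundary face with the span of its vertices there. -/
theorem _root_.IsExposed.inter_convexHull {P F t : Set E} (hF : IsExposed ℝ P F) (ht : t ⊆ P)
    (hP : Convex ℝ P) : convexHull ℝ t ∩ F = convexHull ℝ (t ∩ F) := by
  obtain ⟨f, c, h, rfl⟩ := isExposed_iff.1 hF
  have h1 : convexHull ℝ t ⊆ P := convexHull_min ht hP
  have h2 : convexHull ℝ t ∩ {x ∈ P | f x = c} = convexHull ℝ t ∩ {x | f x = c} := by
    ext x; simp only [mem_inter_iff, mem_ofPred_eq]
    exact ⟨fun hx => ⟨hx.1, hx.2.2⟩, fun hx => ⟨hx.1, h1 hx.1, hx.2⟩⟩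
  have h3 : t ∩ {x ∈ P | f x = c} = t ∩ {x | f x = c} := by
    ext x; simp only [mem_inter_iff, mem_ofPred_eq]
    exact ⟨fun hx => ⟨hx.1, hx.2.2⟩, fun hx => ⟨hx.1, ht hx.1, hx.2⟩⟩
  rw [h2, h3]
  exact convexHull_inter_hyperplane f (fun s hs => h s (ht hs))

theorem _root_.IsExposed.eq_convexHull {A F : Set E} (hF : IsExposed ℝ (convexHull ℝ A) F) :
    F = convexHull ℝ (A ∩ F) := by
  rw [← IsExposed.inter_convexHull hF (subset_convexHull ℝ A) (convex_convexHull ℝ A)]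
  exact (inter_eq_right.2 hF.subset).symm

theorem _root_.IsExposed.subset_of_inter_subset {A F G : Set E} (hF : IsExposed ℝ (convexHull ℝ A) F)
    (hG : IsExposed ℝ (convexHull ℝ A) G) (h : A ∩ F ⊆ G) : F ⊆ G := by
  rw [IsExposed.eq_convexHull hF]
  exact convexHull_min h (hG.convex (convex_convexHull ℝ A))

/-- A face is determined by which of the finitely many generating points it contains. -/
theorem finite_isExposed {A : Set E} (hA : A.Finite) :
    {F | IsExposed ℝ (convexHull ℝ A) F}.Finite := by
  refine Set.Finite.of_finite_image (f := fun F => A ∩ F)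
    (hA.finite_subsets.subset ?_) ?_
  · rintro _ ⟨F, -, rfl⟩
    exact inter_subset_left
  · intro F hF G hG h
    rw [IsExposed.eq_convexHull hF, IsExposed.eq_convexHull hG]
    exact congrArg _ h

/-- For polytopes, a face of a face is a face. -/
theorem _root_.IsExposed.trans_of_finite {A F G : Set E} (hA : A.Finite)
    (hF : IsExposed ℝ (convexHull ℝ A) F) (hG : IsExposed ℝ F G) :
    IsExposed ℝ (convexHull ℝ A) G := by
  obtain ⟨f, c, hf, rfl⟩ := isExposed_iff.1 hF
  obtain ⟨g, d, hg, rfl⟩ := isExposed_iff.1 hG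
  -- For `N` large, `N • f + g` is maximal on `A` exactly at the points where both `f = c` and `g =
  -- d`; finiteness of `A` makes one `N` suffice.
  obtain ⟨N, hN⟩ : ∃ N : ℝ, ∀ s ∈ A, f s < c → g s - d < N * (c - f s) := by
    have : ∀ᶠ N : ℝ in atTop, ∀ s ∈ A, f s < c → g s - d < N * (c - f s) := by
      rw [eventually_all_finite hA]
      intro s _
      by_cases hs : f s < c
      · filter_upwards [eventually_gt_atTop ((g s - d) / (c - f s))] with N hN _
        rwa [div_lt_iff₀ (by linarith)] at hN
      · exact Eventually.of_forall fun N h => absurd h hs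
    exact this.exists
  have hle : ∀ s ∈ A, (N • f + g) s ≤ N * c + d ∧
      ((N • f + g) s = N * c + d → f s = c ∧ g s = d) := by
    intro s hs
    have h0 := hf s (subset_convexHull ℝ A hs)
    have h1 : (N • f + g) s = N * f s + g s := by simp
    rw [h1]
    rcases h0.lt_or_eq with h | h
    · have := hN s hs h
      exact ⟨by nlinarith, fun h' => by nlinarith⟩
    · have := hg s ⟨subset_convexHull ℝ A hs, h⟩
      rw [h]
      exact ⟨by linarith, fun h' => ⟨rfl, by linarith⟩⟩
  refine isExposed_iff.2 ⟨N • f + g, N * c + d,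
    fun x hx => le_of_mem_convexHull _ (fun s hs => (hle s hs).1) hx, ?_⟩
  have key := convexHull_inter_hyperplane (N • f + g) (fun s hs => (hle s hs).1)
  ext x
  constructor
  · rintro ⟨⟨hx, hfx⟩, hgx⟩
    exact ⟨hx, by simp [hfx, hgx]⟩
  · rintro ⟨hx, hx'⟩
    have h1 : x ∈ convexHull ℝ (A ∩ {x | (N • f + g) x = N * c + d}) := key ▸ ⟨hx, hx'⟩
    have h2 : convexHull ℝ (A ∩ {x | (N • f + g) x = N * c + d}) ⊆ {x | f x = c} :=
      convexHull_min (fun s hs => ((hle s hs.1).2 hs.2).1) (convex_hyperplane f.isLinear c)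
    have h3 : convexHull ℝ (A ∩ {x | (N • f + g) x = N * c + d}) ⊆ {x | g x = d} :=
      convexHull_min (fun s hs => ((hle s hs.1).2 hs.2).2) (convex_hyperplane g.isLinear d)
    exact ⟨⟨hx, h2 h1⟩, h3 h1⟩

theorem mem_of_mem_extremePoints_of_mem_convexHull {P t : Set E} {x : E}
    (hx : x ∈ P.extremePoints ℝ) (ht : t ⊆ P) (hP : Convex ℝ P) (hxt : x ∈ convexHull ℝ t) :
    x ∈ t :=
  extremePoints_convexHull_subset
    (inter_extremePoints_subset_extremePoints_of_subset (convexHull_min ht hP) ⟨hxt, hx⟩)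

theorem finite_extremePoints {S : Set E} (hS : S.Finite) :
    ((convexHull ℝ S).extremePoints ℝ).Finite :=
  hS.subset extremePoints_convexHull_subset

theorem convexHull_extremePoints {S : Set E} (hS : S.Finite) :
    convexHull ℝ ((convexHull ℝ S).extremePoints ℝ) = convexHull ℝ S := by
  have := closure_convexHull_extremePoints (hS.isCompact_convexHull ℝ) (convex_convexHull ℝ S)
  rwa [((finite_extremePoints hS).isCompact_convexHull ℝ).isClosed.closure_eq] at this

/-- A vertex is not in the hull of the other points, and a functional strictly separating it from
that compact hull exposes it. -/
theorem isExposed_singleton_of_mem_extremePoints {A : Set E} (hA : A.Finite) {x : E}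
    (hx : x ∈ (convexHull ℝ A).extremePoints ℝ) : IsExposed ℝ (convexHull ℝ A) {x} := by
  have hxA : x ∈ A := extremePoints_convexHull_subset hx
  have hn : x ∉ convexHull ℝ (A \ {x}) := fun h => by
    have := mem_of_mem_extremePoints_of_mem_convexHull hx
      (sdiff_subset.trans (subset_convexHull ℝ A)) (convex_convexHull ℝ A) h
    exact this.2 rfl
  obtain ⟨f, r, h1, h2⟩ := geometric_hahn_banach_closed_point (convex_convexHull ℝ (A \ {x}))
    ((hA.subset sdiff_subset).isCompact_convexHull ℝ).isClosed hn
  have h3 : ∀ s ∈ A, f s ≤ f x := by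
    intro s hs
    by_cases h : s = x
    · rw [h]
    · exact ((h1 s (subset_convexHull ℝ _ ⟨hs, h⟩)).trans h2).le
  refine isExposed_iff.2 ⟨f, f x, fun y hy => le_of_mem_convexHull f h3 hy, ?_⟩
  have h4 : A ∩ {y | f y = f x} = {x} := by
    ext s
    constructor
    · rintro ⟨hs, hs'⟩
      by_contra h
      exact ((h1 s (subset_convexHull ℝ _ ⟨hs, h⟩)).trans h2).ne hs'
    · rintro rfl
      exact ⟨hxA, rfl⟩
  have h5 := convexHull_inter_hyperplane f h3
  rw [h4, convexHull_singleton] at h5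
  exact h5.symm

/-- The vertices of a face are the vertices contained in it. -/
theorem _root_.IsExposed.exists_extremePoint {A F : Set E} (hA : A.Finite)
    (hF : IsExposed ℝ (convexHull ℝ A) F) (hne : F.Nonempty) :
    ∃ x ∈ F, x ∈ (convexHull ℝ A).extremePoints ℝ := by
  have hc := hF.isCompact (hA.isCompact_convexHull ℝ)
  obtain ⟨x, hx⟩ := hc.extremePoints_nonempty hne
  exact ⟨x, hx.1, hF.isExtreme.extremePoints_subset_extremePoints hx⟩

end General

/-! ### Rays and facets -/

/-- In a polytope, the last point on a ray from `w` lies on a face that misses `w`. -/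
theorem exists_isExposed_of_ray {A : Set E3} (hA : A.Finite) {w x : E3}
    (hx : x ∈ convexHull ℝ A) (hne : x ≠ w) :
    ∃ G, IsExposed ℝ (convexHull ℝ A) G ∧ w ∉ G ∧ ∃ y ∈ G, x ∈ segment ℝ w y := by
  set K := convexHull ℝ A
  have hKc : IsCompact K := hA.isCompact_convexHull ℝ
  have hd : 0 < ‖x - w‖ := norm_pos_iff.2 (sub_ne_zero.2 hne)
  obtain ⟨t0, ht0, hmax⟩ : ∃ t0, IsGreatest {t : ℝ | w + t • (x - w) ∈ K} t0 := by
    refine IsCompact.exists_isGreatest ?_ ⟨1, by simpa using hx⟩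
    refine Metric.isCompact_of_isClosed_isBounded
      (hKc.isClosed.preimage (by fun_prop : Continuous fun t : ℝ => w + t • (x - w))) ?_
    obtain ⟨R, hR⟩ := hKc.isBounded.exists_norm_le
    rw [isBounded_iff_forall_norm_le]
    refine ⟨(R + ‖w‖) / ‖x - w‖, fun t ht => ?_⟩
    rw [le_div_iff₀ hd, ← norm_smul]
    calc ‖t • (x - w)‖ = ‖(w + t • (x - w)) - w‖ := by rw [add_sub_cancel_left]
      _ ≤ ‖w + t • (x - w)‖ + ‖w‖ := norm_sub_le _ _
      _ ≤ R + ‖w‖ := by gcongr; exact hR _ ht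
  have h1 : 1 ≤ t0 := hmax (by simpa using hx : (1 : ℝ) ∈ {t : ℝ | w + t • (x - w) ∈ K})
  set y := w + t0 • (x - w) with hy
  have hyK : y ∈ K := ht0
  -- The finitely many faces avoiding `y` are closed, so a small ball around `y` meets only faces
  -- through `y`.
  obtain ⟨r, hr, hball⟩ : ∃ r > 0, ∀ p, dist p y < r →
      ∀ F, IsExposed ℝ K F → p ∈ F → y ∈ F := by
    have hfin : {F | IsExposed ℝ K F ∧ y ∉ F}.Finite :=
      (finite_isExposed hA).subset fun F hF => hF.1
    have hcl : IsClosed (⋃ F ∈ {F | IsExposed ℝ K F ∧ y ∉ F}, F) :=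
      hfin.isClosed_biUnion fun F hF => hF.1.isClosed hKc.isClosed
    have hyc : y ∈ (⋃ F ∈ {F | IsExposed ℝ K F ∧ y ∉ F}, F)ᶜ := by
      simp only [mem_compl_iff, mem_iUnion, not_exists]
      exact fun F hF h => hF.2 h
    obtain ⟨r, hr, hb⟩ := Metric.isOpen_iff.1 hcl.isOpen_compl y hyc
    refine ⟨r, hr, fun p hp F hF hpF => ?_⟩
    by_contra hyF
    exact hb (Metric.mem_ball.2 hp) (mem_biUnion (show F ∈ {F | IsExposed ℝ K F ∧ y ∉ F} from
      ⟨hF, hyF⟩) hpF)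
  set δ := r / (4 * ‖x - w‖) with hδ
  have hδ0 : 0 < δ := by positivity
  set z := y + δ • (x - w) with hz
  have hzK : z ∉ K := by
    intro h
    have : t0 + δ ∈ {t : ℝ | w + t • (x - w) ∈ K} := by
      show w + (t0 + δ) • (x - w) ∈ K
      rwa [add_smul, ← add_assoc]
    have := hmax this
    linarith
  have hzy : ‖z - y‖ = r / 4 := by
    rw [hz, add_sub_cancel_left, norm_smul, Real.norm_of_nonneg hδ0.le, hδ]
    field_simp
  -- `z` lies `r / 4` beyond `y`, outside the polytope, so its nearest point `q` is within `r / 2`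
  -- of `y`. The face exposed at `q` by the direction `z - q` must then contain `y`.
  obtain ⟨q, hqK, hq⟩ := exists_norm_eq_iInf_of_complete_convex ⟨y, hyK⟩
    hKc.isClosed.isComplete (convex_convexHull ℝ A) z
  have hinner := (norm_eq_iInf_iff_real_inner_le_zero (convex_convexHull ℝ A) hqK).1 hq
  have hqy : ‖z - q‖ ≤ ‖z - y‖ := by
    rw [hq]
    exact ciInf_le ⟨0, by rintro _ ⟨i, rfl⟩; exact norm_nonneg _⟩ (⟨y, hyK⟩ : K)
  have hdist : dist q y < r := by
    calc dist q y ≤ dist z q + dist z y := dist_triangle_left _ _ _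
      _ = ‖z - q‖ + ‖z - y‖ := by rw [dist_eq_norm, dist_eq_norm]
      _ < r := by linarith
  set g := innerSL ℝ (z - q) with hg
  have hle : ∀ k ∈ K, g k ≤ g q := by
    intro k hk
    have := hinner k hk
    rw [inner_sub_right] at this
    simp only [hg, innerSL_apply_apply]
    linarith
  have hF := isExposed_setOf g hle
  have hyF := (hball q hdist _ hF ⟨hqK, rfl⟩).2
  have hzq : 0 < g z - g q := by
    rw [← map_sub]
    simp only [hg, innerSL_apply_apply]
    rw [real_inner_self_eq_norm_sq]
    have : z - q ≠ 0 := sub_ne_zero.2 fun h => hzK (h ▸ hqK)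
    positivity
  have hgz : g z = g y + δ * g (x - w) := by rw [hz]; simp
  have hgy : g y = g w + t0 * g (x - w) := by rw [hy]; simp
  -- Since `g` is larger at `z` than at `y`, it increases along the ray, so its value at `w` is
  -- below the maximum.
  have hpos : 0 < g (x - w) := by
    by_contra h
    push Not at h
    nlinarith [mul_nonneg hδ0.le (neg_nonneg.2 h)]
  refine ⟨_, hF, ?_, y, ⟨hyK, hyF⟩, ?_⟩
  · rintro ⟨-, h⟩
    nlinarith
  · rw [segment_eq_image']
    refine ⟨t0⁻¹, ⟨by positivity, inv_le_one_of_one_le₀ h1⟩, ?_⟩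
    show w + t0⁻¹ • (y - w) = x
    rw [hy, add_sub_cancel_left, smul_smul, inv_mul_cancel₀ (by positivity), one_smul,
      add_sub_cancel]

/-- A nonzero functional is an open map, so it cannot be constant on a set with interior. -/
theorem exists_apply_ne_of_interior {A : Set E3} (hint : (interior (convexHull ℝ A)).Nonempty)
    {h : StrongDual ℝ E3} (h0 : h ≠ 0) (c : ℝ) : ∃ a ∈ A, h a ≠ c := by
  by_contra! hc
  have h1 : convexHull ℝ A ⊆ {x | h x = c} := convexHull_min hc (convex_hyperplane h.isLinear c)
  have h2 : IsOpen (h '' interior (convexHull ℝ A)) :=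
    h.isOpenMap_of_ne_zero h0 _ isOpen_interior
  have h3 : h '' interior (convexHull ℝ A) = {c} := by
    refine Subset.antisymm ?_ ?_
    · rintro _ ⟨x, hx, rfl⟩
      exact h1 (interior_subset hx)
    · rintro _ rfl
      obtain ⟨x, hx⟩ := hint
      exact ⟨x, hx, h1 (interior_subset hx)⟩
  rw [h3] at h2
  exact not_isOpen_singleton c h2

theorem vectorSpan_le_ker {F : Set E3} {f : StrongDual ℝ E3} {c : ℝ} (h : ∀ x ∈ F, f x = c) :
    vectorSpan ℝ F ≤ f.ker := by
  rw [vectorSpan_def, Submodule.span_le]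
  rintro _ ⟨x, hx, y, hy, rfl⟩
  simp [h x hx, h y hy]

theorem exists_functional_of_finrank_lt {D : Submodule ℝ E3} (h : Module.finrank ℝ D < 3) :
    ∃ g : StrongDual ℝ E3, g ≠ 0 ∧ ∀ x ∈ D, g x = 0 := by
  have hD : D < ⊤ := by
    refine lt_top_iff_ne_top.2 ?_
    rintro rfl
    rw [finrank_top, finrank_euclideanSpace_fin] at h
    exact lt_irrefl _ h
  obtain ⟨g, hg, hle⟩ := Submodule.exists_le_ker_of_lt_top D hD
  refine ⟨LinearMap.toContinuousLinearMap g, fun h => hg ?_, fun x hx => hle hx⟩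
  ext x
  simpa using congrArg (fun k : StrongDual ℝ E3 => k x) h

theorem finrank_ker_lt {f : StrongDual ℝ E3} (h : f ≠ 0) : Module.finrank ℝ f.ker < 3 := by
  have : f.ker < ⊤ := by
    refine lt_top_iff_ne_top.2 fun h' => h ?_
    ext x
    exact (h' ▸ Submodule.mem_top : x ∈ f.ker)
  have h2 := Submodule.finrank_lt this.ne
  rwa [finrank_euclideanSpace_fin] at h2

/-- A face that misses a point of the polytope lies in a facet that misses this point. -/
theorem exists_facet_of_isExposed {A : Set E3} (hA : A.Finite)
    (hint : (interior (convexHull ℝ A)).Nonempty) {G : Set E3}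
    (hG : IsExposed ℝ (convexHull ℝ A) G) (hGne : G.Nonempty) {w : E3}
    (hw : w ∈ convexHull ℝ A) (hwG : w ∉ G) :
    ∃ F ∈ facets (convexHull ℝ A), G ⊆ F ∧ w ∉ F := by
  have hfin : {F | IsExposed ℝ (convexHull ℝ A) F ∧ G ⊆ F ∧ w ∉ F}.Finite :=
    (finite_isExposed hA).subset fun F hF => hF.1
  -- Take a largest face containing `G` and missing `w`. If its dimension were not two, its
  -- hyperplane could be tilted about it to give a larger such face.
  obtain ⟨F, ⟨⟨hF, hGF, hwF⟩, hFmax⟩⟩ := hfin.exists_maximal ⟨G, hG, Subset.rfl, hwG⟩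
  refine ⟨F, ⟨hF, ?_⟩, hGF, hwF⟩
  obtain ⟨f, c, hf, hFeq⟩ := isExposed_iff.1 hF
  obtain ⟨y, hy⟩ := hGne
  have hyF := hGF hy
  have hfy : f y = c := (hFeq ▸ hyF : y ∈ {x ∈ convexHull ℝ A | f x = c}).2
  have hfw : f w < c := (hf w hw).lt_of_ne fun h => hwF (hFeq ▸ ⟨hw, h⟩)
  have hf0 : f ≠ 0 := by
    rintro rfl
    simp at hfy hfw
    linarith
  have hDf : vectorSpan ℝ F ≤ f.ker := vectorSpan_le_ker (c := c) fun x hx => (hFeq ▸ hx :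
    x ∈ {x ∈ convexHull ℝ A | f x = c}).2
  have hD3 := (Submodule.finrank_mono hDf).trans_lt (finrank_ker_lt hf0)
  by_contra hne
  -- A proper face of dimension other than two has dimension at most one, which leaves room for a
  -- functional constant on `F` and `w` together.
  have hN : Module.finrank ℝ ↥(vectorSpan ℝ F ⊔ Submodule.span ℝ {w - y}) < 3 := by
    have h1 := Submodule.finrank_add_le_finrank_add_finrank (vectorSpan ℝ F)
      (Submodule.span ℝ {w - y})
    have h2 := finrank_span_le_card (R := ℝ) ({w - y} : Set E3)
    simp at h2
    omega
  obtain ⟨h, h0, hker⟩ : ∃ h : StrongDual ℝ E3, h ≠ 0 ∧ (∀ x ∈ F, h x = h y) ∧ h w = h y := by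
    obtain ⟨h, h0, hk⟩ := exists_functional_of_finrank_lt hN
    refine ⟨h, h0, fun x hx => ?_, ?_⟩
    · have := hk (x - y) (Submodule.mem_sup_left (vsub_mem_vectorSpan ℝ hx hyF))
      rwa [map_sub, sub_eq_zero] at this
    · have := hk (w - y) (Submodule.mem_sup_right (Submodule.mem_span_singleton_self _))
      rwa [map_sub, sub_eq_zero] at this
  obtain ⟨h, ⟨hhF, hhw⟩, a, haA, hha⟩ : ∃ h : StrongDual ℝ E3,
      ((∀ x ∈ F, h x = h y) ∧ h w = h y) ∧ ∃ a ∈ A, h y < h a := by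
    obtain ⟨a, ha, hne⟩ := exists_apply_ne_of_interior hint h0 (h y)
    rcases hne.lt_or_gt with hlt | hgt
    · exact ⟨-h, by simpa using hker, a, ha, by simpa using hlt⟩
    · exact ⟨h, hker, a, ha, hgt⟩
  -- The least ratio is the first tilt `t` at which the hyperplane of `f + t • h` meets a generator
  -- `s` with `h y < h s`. The tilted face contains `F` and `s`, but not `w` because `h w = h y`.
  obtain ⟨s, ⟨hsA, hs⟩, hmin⟩ := Set.exists_min_image {s ∈ A | h y < h s}
    (fun s => (c - f s) / (h s - h y)) (hA.subset fun s hs => hs.1) ⟨a, haA, hha⟩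
  set t := (c - f s) / (h s - h y) with ht
  have hfA : ∀ s ∈ A, f s ≤ c := fun s hs => hf s (subset_convexHull ℝ A hs)
  have ht0 : 0 ≤ t := div_nonneg (by linarith [hfA s hsA]) (by linarith)
  have hle : ∀ s ∈ A, (f + t • h) s ≤ c + t * h y := by
    intro s' hs'
    simp only [add_apply, smul_apply, smul_eq_mul]
    rcases le_or_gt (h s') (h y) with h1 | h1
    · nlinarith [hfA s' hs', mul_le_mul_of_nonneg_left h1 ht0]
    · have := hmin s' ⟨hs', h1⟩
      rw [le_div_iff₀ (by linarith)] at this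
      linarith
  have hst : t * (h s - h y) = c - f s := div_mul_cancel₀ _ (by linarith)
  have hF' := isExposed_setOf (P := convexHull ℝ A) (f + t • h) (c := c + t * h y)
    fun x hx => le_of_mem_convexHull _ hle hx
  have hFF' : F ⊆ {x ∈ convexHull ℝ A | (f + t • h) x = c + t * h y} := by
    intro x hx
    refine ⟨hF.subset hx, ?_⟩
    have : f x = c := (hFeq ▸ hx : x ∈ {x ∈ convexHull ℝ A | f x = c}).2
    simp [this, hhF x hx]
  have hsF := hFmax ⟨hF', hGF.trans hFF', fun hw' => by
    have := hw'.2
    simp [hhw] at this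
    linarith⟩ hFF' ⟨subset_convexHull ℝ A hsA, by simp; linarith⟩
  exact hs.ne' (hhF s hsF)

theorem isExposed_ne_of_mem_facets {A : Set E3} (hint : (interior (convexHull ℝ A)).Nonempty)
    {F : Set E3} (hF : F ∈ facets (convexHull ℝ A)) : F ≠ convexHull ℝ A := by
  rintro rfl
  obtain ⟨h, h0, hk⟩ := exists_functional_of_finrank_lt (hF.2.trans_lt (by norm_num))
  obtain ⟨y, hy⟩ := hint
  obtain ⟨a, ha, hne⟩ := exists_apply_ne_of_interior ⟨y, hy⟩ h0 (h y)
  apply hne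
  have := hk (a - y) (vsub_mem_vectorSpan ℝ (subset_convexHull ℝ A ha) (interior_subset hy))
  rwa [map_sub, sub_eq_zero] at this

/-- Facets are maximal proper faces. -/
theorem eq_of_facet_subset {A : Set E3} (hint : (interior (convexHull ℝ A)).Nonempty)
    {F F' : Set E3} (hF : F ∈ facets (convexHull ℝ A)) (hF' : IsExposed ℝ (convexHull ℝ A) F')
    (hne : F' ≠ convexHull ℝ A) (hsub : F ⊆ F') : F' = F := by
  have hFne := isExposed_ne_of_mem_facets hint hF
  obtain ⟨hFe, hdim⟩ := hF
  obtain ⟨y, hy⟩ : F.Nonempty := by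
    rw [nonempty_iff_ne_empty]
    rintro rfl
    have h2 : Module.finrank ℝ (vectorSpan ℝ (∅ : Set E3)) = 2 := hdim
    rw [vectorSpan_empty, finrank_bot] at h2
    omega
  -- A proper face containing the facet spans the same plane, so it is the slice of the polytope by
  -- that plane, which depends only on `F`.
  have key : ∀ {G}, IsExposed ℝ (convexHull ℝ A) G → G ≠ convexHull ℝ A → F ⊆ G →
      G = {x ∈ convexHull ℝ A | x - y ∈ vectorSpan ℝ F} := by
    intro G hG hGne hFG
    obtain ⟨f, c, hf, rfl⟩ := isExposed_iff.1 hG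
    have hyc : f y = c := (hFG hy).2
    have hf0 : f ≠ 0 := by
      rintro rfl
      apply hGne
      have : c = 0 := by simpa using hyc.symm
      simp [this]
    have hD : vectorSpan ℝ F = f.ker := by
      apply Submodule.eq_of_le_of_finrank_le
        (vectorSpan_le_ker (c := c) fun x hx => (hFG hx).2)
      have := finrank_ker_lt hf0
      omega
    ext x
    rw [hD]
    simp [sub_eq_zero, hyc]
  rw [key hF' hne hsub, ← key hFe hFne Subset.rfl]

/-- Every point of a face lies on a segment from a given point of the face to another facet. -/
theorem exists_facet_segment {A : Set E3} (hA : A.Finite)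
    (hint : (interior (convexHull ℝ A)).Nonempty) {F : Set E3}
    (hF : IsExposed ℝ (convexHull ℝ A) F) {p q : E3} (hp : p ∈ F) (hq : q ∈ F) (hpq : q ≠ p)
    {x : E3} (hx : x ∈ F) :
    ∃ F' ∈ facets (convexHull ℝ A), p ∉ F' ∧ ∃ y ∈ F ∩ F', x ∈ segment ℝ p y := by
  -- For `x = p` there is no ray through `x`; the ray towards `q` serves instead, since `p` is an
  -- endpoint of the resulting segment.
  have hx' : ∃ x' ∈ F, x' ≠ p ∧ ∀ y, x' ∈ segment ℝ p y → x ∈ segment ℝ p y := by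
    by_cases h : x = p
    · exact ⟨q, hq, hpq, fun y _ => h ▸ left_mem_segment ℝ _ _⟩
    · exact ⟨x, hx, h, fun y => id⟩
  obtain ⟨x', hx'F, hne, hseg⟩ := hx'
  have hFc := hF.eq_convexHull
  obtain ⟨G, hG, hpG, y, hyG, hxy⟩ := exists_isExposed_of_ray (hA.subset inter_subset_left)
    (hFc ▸ hx'F) hne
  rw [← hFc] at hG
  obtain ⟨F', hF', hGF', hpF'⟩ := exists_facet_of_isExposed hA hint (hF.trans_of_finite hA hG)
    ⟨y, hyG⟩ (hF.subset hp) hpG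
  exact ⟨F', hF', hpF', y, ⟨hG.subset hyG, hGF' hyG⟩, hseg y hxy⟩

/-! ### Lower bound for polytopes with two layers of vertices -/

/-- A family of finite sets that is connected through intersections of size at least `k` has a
union of size at most `k` plus the excesses over `k`. -/
theorem card_biUnion_le_of_connected {ι α : Type*} [DecidableEq ι] [DecidableEq α] (s : Finset ι)
    (f : ι → Finset α) (k : ℕ)
    (hconn : ∀ a ⊆ s, a.Nonempty → a ≠ s → ∃ i ∈ a, ∃ j ∈ s, j ∉ a ∧ k ≤ (f i ∩ f j).card) :
    (s.biUnion f).card ≤ k + ∑ i ∈ s, ((f i).card - k) := by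
  rcases s.eq_empty_or_nonempty with rfl | ⟨i0, hi0⟩
  · simp
  -- A subfamily is grown one member at a time, the new member sharing at least `k` elements with an
  -- old one.
  have key : ∀ n, n + 1 ≤ s.card → ∃ a ⊆ s, a.card = n + 1 ∧
      (a.biUnion f).card ≤ k + ∑ i ∈ a, ((f i).card - k) := by
    intro n
    induction n with
    | zero =>
      intro _
      refine ⟨{i0}, by simpa using hi0, by simp, ?_⟩
      simp only [Finset.singleton_biUnion, Finset.sum_singleton]
      omega
    | succ n ih =>
      intro hn
      obtain ⟨a, ha, hcard, hle⟩ := ih (by omega)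
      obtain ⟨i, hi, j, hj, hja, hij⟩ := hconn a ha (Finset.card_pos.1 (by omega))
        (by rintro rfl; omega)
      refine ⟨insert j a, Finset.insert_subset hj ha, by rw [Finset.card_insert_of_notMem hja,
        hcard], ?_⟩
      rw [Finset.biUnion_insert, Finset.sum_insert hja]
      have h1 := Finset.card_union_add_card_inter (f j) (a.biUnion f)
      have h2 : (f i ∩ f j).card ≤ (f j ∩ a.biUnion f).card := by
        refine Finset.card_le_card fun x hx => ?_
        rw [Finset.mem_inter] at hx ⊢
        exact ⟨hx.2, Finset.mem_biUnion.2 ⟨i, hi, hx.1⟩⟩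
      omega
  have hs := Finset.card_pos.2 ⟨i0, hi0⟩
  obtain ⟨a, ha, hcard, hle⟩ := key (s.card - 1) (by omega)
  rwa [Finset.eq_of_subset_of_card_le ha (by omega)] at hle

/-- The vertices of the polytope `P` are split between two disjoint faces, with vertex sets
`U` and `V`. -/
structure IsTwoLayer (P : Set E3) (U V : Finset E3) : Prop where
  eq_convexHull : P = convexHull ℝ (U ∪ V : Set E3)
  extremePoints_eq : P.extremePoints ℝ = (U ∪ V : Set E3)
  disjoint : Disjoint U V
  isExposed_left : IsExposed ℝ P (convexHull ℝ (U : Set E3))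
  isExposed_right : IsExposed ℝ P (convexHull ℝ (V : Set E3))
  two_le_card_left : 2 ≤ U.card
  two_le_card_right : 2 ≤ V.card

theorem card_le_three_of_affineIndependent {f : StrongDual ℝ E3} (hf : f ≠ 0) {c : ℝ}
    {t : Finset E3} (ht : AffineIndependent ℝ (fun x : t => (x : E3))) (h : ∀ x ∈ t, f x = c) :
    t.card ≤ 3 := by
  rcases t.eq_empty_or_nonempty with rfl | hne
  · simp
  have : Nonempty t := hne.to_subtype
  have h1 := ht.finrank_vectorSpan_add_one
  have h2 : vectorSpan ℝ (range fun x : t => (x : E3)) ≤ f.ker :=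
    vectorSpan_le_ker (c := c) (by rintro _ ⟨x, rfl⟩; exact h x x.2)
  have h3 := (Submodule.finrank_mono h2).trans_lt (finrank_ker_lt hf)
  rw [Fintype.card_coe] at h1
  omega

/-- The deleted points are extreme in the hull. The use is that a base without its vertices is
connected, so tetrahedra adjacent there must share more than one vertex. -/
theorem convex_convexHull_sdiff {P : Set E3} (hP : Convex ℝ P) {U : Set E3}
    (hU : U ⊆ P.extremePoints ℝ) : Convex ℝ (convexHull ℝ U \ U) := by
  refine IsExtreme.convex_sdiff (convex_convexHull ℝ U) ⟨subset_convexHull ℝ U, ?_⟩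
  intro x hx y hy z hz hzxy
  have hsub : convexHull ℝ U ⊆ P := convexHull_min (hU.trans extremePoints_subset) hP
  have := (mem_extremePoints_iff_left.1 (hU hz)).2 x (hsub hx) y (hsub hy) hzxy
  exact this ▸ hz

theorem lineMap_half_notMem {P : Set E3} {U : Set E3} (hU : U ⊆ P.extremePoints ℝ) {p q : E3}
    (hp : p ∈ U) (hq : q ∈ U) (hpq : p ≠ q) {t : ℝ} (ht : t ∈ Ioo (0 : ℝ) 1) :
    AffineMap.lineMap p q t ∉ U := by
  intro h
  have h1 : AffineMap.lineMap p q t ∈ openSegment ℝ p q := by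
    rw [openSegment_eq_image_lineMap]
    exact ⟨t, ht, rfl⟩
  have h2 := (mem_extremePoints.1 (hU h)).2 p (hU hp).1 q (hU hq).1 h1
  exact hpq (h2.1.trans h2.2.symm)


theorem tendsto_lineMap_nhdsGT (p q : E3) :
    Tendsto (fun ε : ℝ => AffineMap.lineMap p q ε) (𝓝[>] 0) (𝓝 p) := by
  have : Continuous fun ε : ℝ => AffineMap.lineMap p q ε := by fun_prop
  simpa [ContinuousWithinAt] using this.continuousWithinAt (s := Ioi (0 : ℝ)) (x := 0)

namespace IsTwoLayer
variable {P : Set E3} {U V : Finset E3} {T : Finset (Finset E3)}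

theorem symm (h : IsTwoLayer P U V) : IsTwoLayer P V U where
  eq_convexHull := by rw [union_comm]; exact h.eq_convexHull
  extremePoints_eq := by rw [union_comm]; exact h.extremePoints_eq
  disjoint := h.disjoint.symm
  isExposed_left := h.isExposed_right
  isExposed_right := h.isExposed_left
  two_le_card_left := h.two_le_card_right
  two_le_card_right := h.two_le_card_left

theorem convex (h : IsTwoLayer P U V) : Convex ℝ P := by
  rw [h.eq_convexHull]; exact convex_convexHull ℝ _

theorem subset_left (h : IsTwoLayer P U V) : (U : Set E3) ⊆ P.extremePoints ℝ := by
  rw [h.extremePoints_eq]; exact subset_union_left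

theorem notMem_left (h : IsTwoLayer P U V) {v : E3} (hv : v ∈ V) :
    v ∉ convexHull ℝ (U : Set E3) := fun hvU =>
  Finset.disjoint_right.1 h.disjoint hv (mem_of_mem_extremePoints_of_mem_convexHull
    (h.symm.subset_left hv) (h.subset_left.trans extremePoints_subset) h.convex hvU)

theorem mem_or_mem (h : IsTwoLayer P U V) {x : E3} (hx : x ∈ P.extremePoints ℝ) :
    x ∈ U ∨ x ∈ V := by
  rw [h.extremePoints_eq] at hx
  exact hx

theorem exists_functional (h : IsTwoLayer P U V) : ∃ (f : StrongDual ℝ E3) (c : ℝ),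
    f ≠ 0 ∧ (∀ x ∈ P, f x ≤ c) ∧ convexHull ℝ (U : Set E3) = {x ∈ P | f x = c} := by
  obtain ⟨f, c, hf, hU⟩ := isExposed_iff.1 h.isExposed_left
  refine ⟨f, c, ?_, hf, hU⟩
  rintro rfl
  obtain ⟨v, hv⟩ := Finset.card_pos.1 (Nat.lt_of_lt_of_le Nat.zero_lt_two h.two_le_card_right)
  obtain ⟨u, hu⟩ := Finset.card_pos.1 (Nat.lt_of_lt_of_le Nat.zero_lt_two h.two_le_card_left)
  have hu' : u ∈ {x ∈ P | (0 : StrongDual ℝ E3) x = c} := hU ▸ subset_convexHull ℝ _ hu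
  exact h.notMem_left hv (hU ▸ ⟨(h.symm.subset_left hv).1, hu'.2⟩)

theorem exists_mem (h : IsTwoLayer P U V) (hT : IsTriangulation (P.extremePoints ℝ) T) {x : E3}
    (hx : x ∈ P) : ∃ t ∈ T, x ∈ convexHull ℝ (t : Set E3) := by
  have h1 := hT.iUnion_eq
  rw [h.extremePoints_eq, ← h.eq_convexHull] at h1
  rw [← h1] at hx
  simpa using hx

variable [DecidableEq E3]

theorem convexHull_inter_left (h : IsTwoLayer P U V) {t : Finset E3}
    (ht : (t : Set E3) ⊆ P.extremePoints ℝ) :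
    convexHull ℝ (t : Set E3) ∩ convexHull ℝ (U : Set E3) =
      convexHull ℝ ((t ∩ U : Finset E3) : Set E3) := by
  rw [h.isExposed_left.inter_convexHull (ht.trans extremePoints_subset) h.convex]
  congr 1
  ext x
  simp only [mem_inter_iff, Finset.coe_inter]
  refine and_congr_right fun hx => ⟨fun hxU => ?_, fun hxU => subset_convexHull ℝ _ hxU⟩
  exact mem_of_mem_extremePoints_of_mem_convexHull (ht hx)
    (h.subset_left.trans extremePoints_subset) h.convex hxU

theorem card_inter_add_card_inter (h : IsTwoLayer P U V)
    (hT : IsTriangulation (P.extremePoints ℝ) T) {t : Finset E3} (ht : t ∈ T) :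
    (t ∩ U).card + (t ∩ V).card = 4 := by
  rw [← hT.card_eq t ht, ← Finset.card_union_of_disjoint
    (h.disjoint.mono Finset.inter_subset_right Finset.inter_subset_right),
    ← Finset.inter_union_distrib_left, Finset.inter_eq_left.2]
  intro x hx
  exact Finset.mem_union.2 (h.mem_or_mem (hT.vertices_subset t ht hx))

theorem card_inter_left_le (h : IsTwoLayer P U V)
    (hT : IsTriangulation (P.extremePoints ℝ) T) {t : Finset E3} (ht : t ∈ T) :
    (t ∩ U).card ≤ 3 := by
  obtain ⟨f, c, hf0, hf, hU⟩ := h.exists_functional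
  refine card_le_three_of_affineIndependent hf0 (c := c) ?_ ?_
  · exact (hT.affineIndependent t ht).mono (s := ((t ∩ U : Finset E3) : Set E3))
      (t := (t : Set E3)) (by simp)
  · intro x hx
    have : x ∈ convexHull ℝ (U : Set E3) := subset_convexHull ℝ _ (Finset.mem_inter.1 hx).2
    rw [hU] at this
    exact this.2

theorem exists_mem_right (h : IsTwoLayer P U V)
    (hT : IsTriangulation (P.extremePoints ℝ) T) {t : Finset E3} (ht : t ∈ T) :
    ∃ v ∈ t, v ∈ V := by
  have h1 := h.card_inter_add_card_inter hT ht
  have h2 := h.card_inter_left_le hT ht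
  obtain ⟨v, hv⟩ := Finset.card_pos.1 (by omega : 0 < (t ∩ V).card)
  exact ⟨v, Finset.mem_inter.1 hv⟩

/-- The tetrahedra having at least two vertices in `U`. -/
def leftCells (T : Finset (Finset E3)) (U : Finset E3) : Finset (Finset E3) :=
  T.filter fun t => 2 ≤ (t ∩ U).card

/-- The trace of such a tetrahedron on the base is empty or a single vertex. -/
theorem mem_of_card_lt_two (h : IsTwoLayer P U V)
    (hT : IsTriangulation (P.extremePoints ℝ) T) {t : Finset E3} (ht : t ∈ T) {x : E3}
    (hx : x ∈ convexHull ℝ (t : Set E3)) (hxU : x ∈ convexHull ℝ (U : Set E3))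
    (hcard : (t ∩ U).card < 2) : x ∈ U := by
  have h1 : x ∈ convexHull ℝ ((t ∩ U : Finset E3) : Set E3) :=
    h.convexHull_inter_left (hT.vertices_subset t ht) ▸ ⟨hx, hxU⟩
  have h2 : ((t ∩ U : Finset E3) : Set E3).Subsingleton := by
    intro a ha b hb
    exact Finset.card_le_one.1 (by omega) a ha b hb
  rw [h2.convex.convexHull_eq] at h1
  exact (Finset.mem_inter.1 h1).2

theorem exists_leftCell (h : IsTwoLayer P U V)
    (hT : IsTriangulation (P.extremePoints ℝ) T) {x : E3}
    (hx : x ∈ convexHull ℝ (U : Set E3) \ U) :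
    ∃ t ∈ leftCells T U, x ∈ convexHull ℝ ((t ∩ U : Finset E3) : Set E3) := by
  obtain ⟨t, ht, hxt⟩ := h.exists_mem hT (h.isExposed_left.subset hx.1)
  refine ⟨t, Finset.mem_filter.2 ⟨ht, ?_⟩,
    h.convexHull_inter_left (hT.vertices_subset t ht) ▸ ⟨hxt, hx.1⟩⟩
  by_contra hc
  exact hx.2 (h.mem_of_card_lt_two hT ht hxt hx.1 (by omega))

/-- Any two complementary sets of cells at the face `U` touch in a point of this face that is not
a vertex. -/
theorem exists_common_point (h : IsTwoLayer P U V)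
    (hT : IsTriangulation (P.extremePoints ℝ) T) {a : Finset (Finset E3)}
    (ha : a ⊆ leftCells T U) (hne : a.Nonempty) (hne' : a ≠ leftCells T U) :
    ∃ s ∈ a, ∃ t ∈ leftCells T U, t ∉ a ∧ ∃ x, x ∉ U ∧
      x ∈ convexHull ℝ ((s ∩ U : Finset E3) : Set E3) ∧
      x ∈ convexHull ℝ ((t ∩ U : Finset E3) : Set E3) := by
  -- The punctured base is connected and covered by the two closed unions of traces, both of which
  -- it meets, so they have a common point in it.
  have hpre : IsPreconnected (convexHull ℝ (U : Set E3) \ U) :=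
    (convex_convexHull_sdiff h.convex h.subset_left).isPreconnected
  rw [isPreconnected_closed_iff] at hpre
  let C : Finset (Finset E3) → Set E3 := fun b =>
    ⋃ t ∈ b, convexHull ℝ ((t ∩ U : Finset E3) : Set E3)
  have hC : ∀ b, IsClosed (C b) := fun b => b.finite_toSet.isClosed_biUnion fun t _ =>
    ((t ∩ U).finite_toSet.isCompact_convexHull ℝ).isClosed
  have hnonempty : ∀ b ⊆ leftCells T U, b.Nonempty →
      ((convexHull ℝ (U : Set E3) \ U) ∩ C b).Nonempty := by
    rintro b hb ⟨t, ht⟩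
    obtain ⟨p, hp, q, hq, hpq⟩ := Finset.one_lt_card.1 (Finset.mem_filter.1 (hb ht)).2
    have hp' := Finset.mem_inter.1 hp
    have hq' := Finset.mem_inter.1 hq
    have h1 : AffineMap.lineMap p q (1 / 2 : ℝ) ∈
        convexHull ℝ ((t ∩ U : Finset E3) : Set E3) :=
      (convex_convexHull ℝ _).lineMap_mem (subset_convexHull ℝ _ hp) (subset_convexHull ℝ _ hq)
        (by norm_num)
    refine ⟨AffineMap.lineMap p q (1 / 2 : ℝ), ⟨convexHull_mono (by simp) h1,
      lineMap_half_notMem h.subset_left hp'.2 hq'.2 hpq (by norm_num)⟩, mem_biUnion ht h1⟩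
  obtain ⟨x, hx, hx1, hx2⟩ := hpre (C a) (C (leftCells T U \ a)) (hC _) (hC _) (by
    intro x hx
    obtain ⟨t, ht, hxt⟩ := h.exists_leftCell hT hx
    by_cases hta : t ∈ a
    · exact Or.inl (mem_biUnion hta hxt)
    · exact Or.inr (mem_biUnion (Finset.mem_sdiff.2 ⟨ht, hta⟩) hxt))
    (hnonempty a ha hne) (hnonempty _ Finset.sdiff_subset (by
      rw [Finset.sdiff_nonempty]
      exact fun hs => hne' (ha.antisymm hs)))
  obtain ⟨s, hs, hxs⟩ := mem_iUnion₂.1 hx1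
  obtain ⟨t, ht, hxt⟩ := mem_iUnion₂.1 hx2
  exact ⟨s, hs, t, (Finset.mem_sdiff.1 ht).1, (Finset.mem_sdiff.1 ht).2, x, hx.2, hxs, hxt⟩

/-- The point lies in the part of the common face on the base; if this had only one vertex, the
point would be that vertex. -/
theorem two_le_card_inter (h : IsTwoLayer P U V)
    (hT : IsTriangulation (P.extremePoints ℝ) T) {s t : Finset E3} (hs : s ∈ T) (ht : t ∈ T)
    {x : E3} (hx : x ∉ U) (hxs : x ∈ convexHull ℝ ((s ∩ U : Finset E3) : Set E3))
    (hxt : x ∈ convexHull ℝ ((t ∩ U : Finset E3) : Set E3)) :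
    2 ≤ ((s ∩ U) ∩ (t ∩ U)).card := by
  rw [← h.convexHull_inter_left (hT.vertices_subset _ ‹_›)] at hxs hxt
  have h1 : x ∈ convexHull ℝ ((s ∩ t : Finset E3) : Set E3) := by
    rw [Finset.coe_inter, ← hT.inter_eq s hs t ht]
    exact ⟨hxs.1, hxt.1⟩
  have hst : ((s ∩ t : Finset E3) : Set E3) ⊆ P.extremePoints ℝ :=
    (Finset.coe_subset.2 Finset.inter_subset_left).trans (hT.vertices_subset s hs)
  have h2 : x ∈ convexHull ℝ (((s ∩ t) ∩ U : Finset E3) : Set E3) :=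
    h.convexHull_inter_left hst ▸ ⟨h1, hxs.2⟩
  rw [← Finset.inter_inter_distrib_right]
  by_contra hc
  have h3 : (((s ∩ t) ∩ U : Finset E3) : Set E3).Subsingleton := by
    intro a ha b hb
    exact Finset.card_le_one.1 (by omega) a ha b hb
  rw [h3.convex.convexHull_eq] at h2
  exact hx (Finset.mem_inter.1 h2).2

theorem card_left_le (h : IsTwoLayer P U V) (hT : IsTriangulation (P.extremePoints ℝ) T) :
    U.card ≤ 2 + ∑ t ∈ leftCells T U, ((t ∩ U).card - 2) := by
  refine le_trans (Finset.card_le_card ?_) (card_biUnion_le_of_connected (leftCells T U)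
    (fun t => t ∩ U) 2 fun a ha hne hne' => ?_)
  · intro u hu
    obtain ⟨u', hu', hne⟩ := Finset.exists_mem_ne h.two_le_card_left u
    have hcl : IsClosed (⋃ t ∈ leftCells T U, convexHull ℝ ((t ∩ U : Finset E3) : Set E3)) :=
      (leftCells T U).finite_toSet.isClosed_biUnion fun t _ =>
        ((t ∩ U).finite_toSet.isCompact_convexHull ℝ).isClosed
    -- The vertices were removed from the base, so `u` is reached as a limit of non-vertices along
    -- the segment to `u'`.
    have hmem : u ∈ ⋃ t ∈ leftCells T U, convexHull ℝ ((t ∩ U : Finset E3) : Set E3) := by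
      refine hcl.mem_of_tendsto (tendsto_lineMap_nhdsGT u u') ?_
      filter_upwards [Ioo_mem_nhdsGT (zero_lt_one' ℝ)] with ε hε
      obtain ⟨t, ht, hx⟩ := h.exists_leftCell hT
        (x := AffineMap.lineMap u u' ε) ⟨(convex_convexHull ℝ _).lineMap_mem
          (subset_convexHull ℝ _ hu) (subset_convexHull ℝ _ hu') ⟨hε.1.le, hε.2.le⟩,
          lineMap_half_notMem h.subset_left hu hu' hne.symm hε⟩
      exact mem_biUnion ht hx
    obtain ⟨t, ht, hut⟩ := mem_iUnion₂.1 hmem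
    refine Finset.mem_biUnion.2 ⟨t, ht, ?_⟩
    refine mem_of_mem_extremePoints_of_mem_convexHull (h.subset_left hu) ?_ h.convex hut
    exact (Finset.coe_subset.2 Finset.inter_subset_right).trans
      (h.subset_left.trans extremePoints_subset)
  · obtain ⟨s, hs, t, ht, hta, x, hx, hxs, hxt⟩ := h.exists_common_point hT ha hne hne'
    exact ⟨s, hs, t, ht, hta, h.two_le_card_inter hT (Finset.mem_filter.1 (ha hs)).1
      (Finset.mem_filter.1 ht).1 hx hxs hxt⟩

end IsTwoLayer

/-- The finitely many compact hulls that miss `x` stay at positive distance from it. -/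
theorem exists_ball_disjoint (T : Finset (Finset E3)) (x : E3) :
    ∃ r > 0, ∀ t ∈ T, ∀ y ∈ Metric.ball x r, y ∈ convexHull ℝ (t : Set E3) →
      x ∈ convexHull ℝ (t : Set E3) := by
  have hcl : IsClosed (⋃ t ∈ {t : Finset E3 | t ∈ T ∧ x ∉ convexHull ℝ (t : Set E3)},
      convexHull ℝ (t : Set E3)) :=
    (T.finite_toSet.subset (t := {t : Finset E3 | t ∈ T ∧ x ∉ convexHull ℝ (t : Set E3)})
      fun t ht => ht.1).isClosed_biUnion fun t _ =>
      (t.finite_toSet.isCompact_convexHull ℝ).isClosed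
  obtain ⟨r, hr, hb⟩ := Metric.isOpen_iff.1 hcl.isOpen_compl x (by
    simp only [mem_compl_iff, mem_iUnion, not_exists]
    exact fun t ht hx => ht.2 hx)
  refine ⟨r, hr, fun t ht y hy hyt => ?_⟩
  by_contra hx
  exact hb hy (mem_biUnion (show t ∈ {t : Finset E3 | t ∈ T ∧ x ∉ convexHull ℝ (t : Set E3)} from ⟨ht, hx⟩) hyt)

namespace IsTwoLayer
variable {P : Set E3} {U V : Finset E3} {T : Finset (Finset E3)} [DecidableEq E3]

/-- The vertices in `V` of the tetrahedra having at least two vertices in `U`. -/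
def apexes (T : Finset (Finset E3)) (U V : Finset E3) : Finset E3 :=
  (leftCells T U).biUnion fun t => t ∩ V

/-- Start from a non-vertex point `x` of the base shared by the two groups. The points of `P` near
`x` and strictly off the base plane form a convex set, covered by tetrahedra through `x`, all of
which have at least two vertices in `U`. Connectedness gives a common point off the plane; the face
of `s` and `t` containing it must have a vertex in `V`. -/
theorem exists_common_apex (h : IsTwoLayer P U V)
    (hT : IsTriangulation (P.extremePoints ℝ) T) {a : Finset (Finset E3)}
    (ha : a ⊆ leftCells T U) (hne : a.Nonempty) (hne' : a ≠ leftCells T U) :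
    ∃ s ∈ a, ∃ t ∈ leftCells T U, t ∉ a ∧ 1 ≤ ((s ∩ V) ∩ (t ∩ V)).card := by
  obtain ⟨s0, hs0, t0, ht0, hta0, x, hx, hxs, hxt⟩ := h.exists_common_point hT ha hne hne'
  obtain ⟨f, c, hf0, hf, hU⟩ := h.exists_functional
  have hs0T := (Finset.mem_filter.1 (ha hs0)).1
  have ht0T := (Finset.mem_filter.1 ht0).1
  obtain ⟨v, hvs, hvV⟩ := h.exists_mem_right hT hs0T
  obtain ⟨v', hvt, hvV'⟩ := h.exists_mem_right hT ht0T
  obtain ⟨r, hr, hball⟩ := exists_ball_disjoint T x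
  have hxs' := (h.convexHull_inter_left (hT.vertices_subset _ hs0T)).symm ▸ hxs
  have hxt' := (h.convexHull_inter_left (hT.vertices_subset _ ht0T)).symm ▸ hxt
  have hfx : f x = c := (hU ▸ hxs'.2 : x ∈ {x ∈ P | f x = c}).2
  have hfV : ∀ w ∈ V, f w < c := fun w hw => (hf w (h.symm.subset_left hw).1).lt_of_ne
    fun hw' => h.notMem_left hw (hU ▸ ⟨(h.symm.subset_left hw).1, hw'⟩)
  have hflt : ∀ w ∈ V, ∀ ε : ℝ, 0 < ε → f (AffineMap.lineMap x w ε) < c := by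
    intro w hw ε hε
    have := hfV w hw
    rw [AffineMap.lineMap_apply_module']
    simp only [map_add, map_smul, map_sub, smul_eq_mul, hfx]
    nlinarith
  obtain ⟨ε, hε, hy, hy'⟩ : ∃ ε ∈ Ioo (0 : ℝ) 1, AffineMap.lineMap x v ε ∈ Metric.ball x r ∧
      AffineMap.lineMap x v' ε ∈ Metric.ball x r := by
    have h1 := (tendsto_lineMap_nhdsGT x v).eventually_mem (Metric.ball_mem_nhds x hr)
    have h2 := (tendsto_lineMap_nhdsGT x v').eventually_mem (Metric.ball_mem_nhds x hr)
    obtain ⟨ε, h⟩ := ((eventually_mem_set.2 (Ioo_mem_nhdsGT (zero_lt_one' ℝ))).and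
      (h1.and h2)).exists
    exact ⟨ε, h⟩
  let C : Set E3 := P ∩ (Metric.ball x r ∩ {y | f y < c})
  have hC : IsPreconnected C := (h.convex.inter ((convex_ball x r).inter
    (convex_halfSpace_lt f.isLinear c))).isPreconnected
  let K : Finset (Finset E3) → Set E3 := fun b => ⋃ t ∈ b, convexHull ℝ (t : Set E3)
  have hK : ∀ b, IsClosed (K b) := fun b => b.finite_toSet.isClosed_biUnion fun t _ =>
    (t.finite_toSet.isCompact_convexHull ℝ).isClosed
  have hsub : ∀ t ∈ T, convexHull ℝ (t : Set E3) ⊆ P := fun t ht =>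
    convexHull_min ((hT.vertices_subset t ht).trans extremePoints_subset) h.convex
  have hys : AffineMap.lineMap x v ε ∈ convexHull ℝ (s0 : Set E3) :=
    (convex_convexHull ℝ _).lineMap_mem hxs'.1 (subset_convexHull ℝ _ hvs) ⟨hε.1.le, hε.2.le⟩
  have hyt : AffineMap.lineMap x v' ε ∈ convexHull ℝ (t0 : Set E3) :=
    (convex_convexHull ℝ _).lineMap_mem hxt'.1 (subset_convexHull ℝ _ hvt) ⟨hε.1.le, hε.2.le⟩
  obtain ⟨z, hzC, hz1, hz2⟩ := isPreconnected_closed_iff.1 hC (K a) (K (leftCells T U \ a))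
    (hK _) (hK _) (by
      rintro y ⟨hyP, hyb, -⟩
      obtain ⟨t, ht, hyt⟩ := h.exists_mem hT hyP
      have hxt := hball t ht y hyb hyt
      have htl : t ∈ leftCells T U := by
        refine Finset.mem_filter.2 ⟨ht, ?_⟩
        by_contra hc
        exact hx (h.mem_of_card_lt_two hT ht hxt hxs'.2 (by omega))
      by_cases hta : t ∈ a
      · exact Or.inl (mem_biUnion hta hyt)
      · exact Or.inr (mem_biUnion (Finset.mem_sdiff.2 ⟨htl, hta⟩) hyt))
    ⟨_, ⟨hsub _ hs0T hys, hy, hflt v hvV ε hε.1⟩, mem_biUnion hs0 hys⟩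
    ⟨_, ⟨hsub _ ht0T hyt, hy', hflt v' hvV' ε hε.1⟩,
      mem_biUnion (Finset.mem_sdiff.2 ⟨ht0, hta0⟩) hyt⟩
  obtain ⟨s, hs, hzs⟩ := mem_iUnion₂.1 hz1
  obtain ⟨t, ht, hzt⟩ := mem_iUnion₂.1 hz2
  obtain ⟨ht, hta⟩ := Finset.mem_sdiff.1 ht
  refine ⟨s, hs, t, ht, hta, ?_⟩
  rw [Nat.one_le_iff_ne_zero, Finset.card_ne_zero, ← Finset.inter_inter_distrib_right]
  have hz : z ∈ convexHull ℝ ((s : Set E3) ∩ t) := by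
    rw [← hT.inter_eq s (Finset.mem_filter.1 (ha hs)).1 t (Finset.mem_filter.1 ht).1]
    exact ⟨hzs, hzt⟩
  by_contra hemp
  have h1 : (s : Set E3) ∩ t ⊆ {y | f y = c} := by
    rintro y ⟨hys, hyt⟩
    rcases h.mem_or_mem (hT.vertices_subset s (Finset.mem_filter.1 (ha hs)).1 hys) with hyU | hyV
    · exact (hU ▸ subset_convexHull ℝ _ hyU : y ∈ {x ∈ P | f x = c}).2
    · exact absurd ⟨y, Finset.mem_inter.2 ⟨Finset.mem_inter.2 ⟨hys, hyt⟩, hyV⟩⟩ hemp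
  exact hzC.2.2.ne (convexHull_min h1 (convex_hyperplane f.isLinear c) hz)

theorem card_apexes_le (h : IsTwoLayer P U V) (hT : IsTriangulation (P.extremePoints ℝ) T) :
    (apexes T U V).card ≤ 1 + ∑ t ∈ leftCells T U, ((t ∩ V).card - 1) :=
  card_biUnion_le_of_connected (leftCells T U) (fun t => t ∩ V) 1
    fun _ ha hne hne' => h.exists_common_apex hT ha hne hne'

/-- The lower bound for the size of a triangulation. -/
theorem card_add_card_add_card_apexes_le (h : IsTwoLayer P U V)
    (hT : IsTriangulation (P.extremePoints ℝ) T) :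
    U.card + V.card + (apexes T U V).card ≤ T.card + 5 := by
  have h1 := h.card_left_le hT
  have h2 := h.symm.card_left_le hT
  have h3 := h.card_apexes_le hT
  rw [leftCells, Finset.sum_filter] at h1 h2 h3
  -- Each tetrahedron contributes one unit to exactly one of the three sums: type 3+1 to the first,
  -- 1+3 to the second, 2+2 to the third.
  have h4 : ∑ t ∈ T, (if 2 ≤ (t ∩ U).card then (t ∩ U).card - 2 else 0) +
      ∑ t ∈ T, (if 2 ≤ (t ∩ V).card then (t ∩ V).card - 2 else 0) +
      ∑ t ∈ T, (if 2 ≤ (t ∩ U).card then (t ∩ V).card - 1 else 0) ≤ ∑ t ∈ T, 1 := by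
    rw [← Finset.sum_add_distrib, ← Finset.sum_add_distrib]
    refine Finset.sum_le_sum fun t ht => ?_
    have h5 := h.card_inter_add_card_inter hT ht
    have h6 := h.card_inter_left_le hT ht
    have h7 := h.symm.card_inter_left_le hT ht
    split_ifs <;> omega
  rw [Finset.sum_const, smul_eq_mul, mul_one] at h4
  omega

/-- A face that contains two points of `U` and a point of `V` contains an apex. -/
theorem exists_mem_apexes (h : IsTwoLayer P U V)
    (hT : IsTriangulation (P.extremePoints ℝ) T) {F : Set E3} (hF : IsExposed ℝ P F) {p q : E3}
    (hpq : p ≠ q) (hpU : p ∈ U) (hpF : p ∈ F) (hqU : q ∈ U) (hqF : q ∈ F) (hFV : ∃ v ∈ V, v ∈ F) :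
    ∃ v ∈ apexes T U V, v ∈ F := by
  obtain ⟨v, hv, hvF⟩ := hFV
  obtain ⟨f, c, hf0, hf, hU⟩ := h.exists_functional
  have hFconv := hF.convex h.convex
  -- From the midpoint `x` of `p` and `q`, move a little inside `F` towards `v`, to `y`. A
  -- tetrahedron containing `y` also contains `x`, hence has two vertices in `U`; its face in `F`
  -- contains `y`, which is off the base plane, so it has a vertex in `V`.
  set x := AffineMap.lineMap p q (1 / 2 : ℝ) with hxdef
  have hxU : x ∉ U := lineMap_half_notMem h.subset_left hpU hqU hpq (by norm_num)
  have hxF : x ∈ F := hFconv.lineMap_mem hpF hqF (by norm_num)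
  have hxU' : x ∈ convexHull ℝ (U : Set E3) := (convex_convexHull ℝ _).lineMap_mem
    (subset_convexHull ℝ _ hpU) (subset_convexHull ℝ _ hqU) (by norm_num)
  have hfx : f x = c := (hU ▸ hxU' : x ∈ {x ∈ P | f x = c}).2
  have hfv : f v < c := (hf v (h.symm.subset_left hv).1).lt_of_ne
    fun hw' => h.notMem_left hv (hU ▸ ⟨(h.symm.subset_left hv).1, hw'⟩)
  obtain ⟨r, hr, hball⟩ := exists_ball_disjoint T x
  obtain ⟨ε, hε, hy⟩ := ((eventually_mem_set.2 (Ioo_mem_nhdsGT (zero_lt_one' ℝ))).and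
    ((tendsto_lineMap_nhdsGT x v).eventually_mem (Metric.ball_mem_nhds x hr))).exists
  set y := AffineMap.lineMap x v ε with hydef
  have hyF : y ∈ F := hFconv.lineMap_mem hxF hvF ⟨hε.1.le, hε.2.le⟩
  have hfy : f y < c := by
    rw [hydef, AffineMap.lineMap_apply_module']
    simp only [map_add, map_smul, map_sub, smul_eq_mul, hfx]
    nlinarith [hε.1]
  obtain ⟨t, ht, hyt⟩ := h.exists_mem hT (hF.subset hyF)
  have htl : t ∈ leftCells T U := by
    refine Finset.mem_filter.2 ⟨ht, ?_⟩
    by_contra hc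
    exact hxU (h.mem_of_card_lt_two hT ht (hball t ht y hy hyt) hxU' (by omega))
  have hyt' : y ∈ convexHull ℝ ((t : Set E3) ∩ F) := by
    rw [← hF.inter_convexHull ((hT.vertices_subset t ht).trans extremePoints_subset) h.convex]
    exact ⟨hyt, hyF⟩
  by_contra! hcon
  have h1 : (t : Set E3) ∩ F ⊆ {y | f y = c} := by
    rintro z ⟨hzt, hzF⟩
    rcases h.mem_or_mem (hT.vertices_subset t ht hzt) with hzU | hzV
    · exact (hU ▸ subset_convexHull ℝ _ hzU : z ∈ {x ∈ P | f x = c}).2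
    · exact absurd hzF (hcon z (Finset.mem_biUnion.2 ⟨t, htl, Finset.mem_inter.2 ⟨hzt, hzV⟩⟩))
  exact hfy.ne (convexHull_min h1 (convex_hyperplane f.isLinear c) hyt')

end IsTwoLayer

/-! ### Triangulations by coning -/

theorem affineIndependent_insert {σ : Finset E3} [DecidableEq E3]
    (hσ : AffineIndependent ℝ (fun x : σ => (x : E3))) (f : StrongDual ℝ E3) {c : ℝ}
    (hf : ∀ x ∈ σ, f x = c) {w : E3} (hw : f w ≠ c) :
    AffineIndependent ℝ (fun x : (insert w σ : Finset E3) => (x : E3)) := by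
  let i : (insert w σ : Finset E3) := ⟨w, Finset.mem_insert_self w σ⟩
  refine AffineIndependent.affineIndependent_of_notMem_span (i := i) ?_ ?_
  · have hmem : ∀ y : {y : (insert w σ : Finset E3) // y ≠ i}, (y : E3) ∈ σ := fun y =>
      (Finset.mem_insert.1 y.1.2).resolve_left fun h => y.2 (Subtype.ext h)
    have hinj : Function.Injective fun y : {y : (insert w σ : Finset E3) // y ≠ i} =>
        (⟨y, hmem y⟩ : σ) := fun a b hab =>
      Subtype.ext (Subtype.ext (congrArg (Subtype.val : σ → E3) hab))
    have := AffineIndependent.comp_embedding ⟨_, hinj⟩ hσ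
    simpa [Function.comp_def] using this
  · intro hmem
    apply hw
    have hsub : ∀ x ∈ ((fun x : (insert w σ : Finset E3) => (x : E3)) '' {x | x ≠ i}),
        f x = c := by
      rintro _ ⟨y, hy, rfl⟩
      exact hf _ ((Finset.mem_insert.1 y.2).resolve_left fun h => hy (Subtype.ext h))
    refine affineSpan_induction (p := fun x => f x = c) hmem hsub ?_
    intro a u v w' hu hv hw'
    simp [hu, hv, hw']

theorem affineIndependent_pair {a b : E3} [DecidableEq E3] :
    AffineIndependent ℝ (fun x : ({a, b} : Finset E3) => (x : E3)) := by
  by_cases h : a = b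
  · subst h
    rw [Finset.pair_eq_singleton]
    exact affineIndependent_of_subsingleton ℝ _
  · have h1 := (affineIndependent_of_ne ℝ h).range
    have h2 : range ![a, b] = (({a, b} : Finset E3) : Set E3) := by
      rw [Matrix.range_cons, Matrix.range_cons, Matrix.range_empty]
      ext x
      simp [or_comm]
    rw [h2] at h1
    exact h1

theorem AffineIndependent.subset_finset {σ τ : Finset E3}
    (hσ : AffineIndependent ℝ (fun x : σ => (x : E3))) (h : τ ⊆ σ) :
    AffineIndependent ℝ (fun x : τ => (x : E3)) :=
  hσ.mono (s := (τ : Set E3)) (t := (σ : Set E3)) (by simpa using h)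

theorem interior_convexHull_eq_empty {σ : Finset E3} (h : σ.card ≤ 3) :
    interior (convexHull ℝ (σ : Set E3)) = ∅ := by
  by_contra hne
  replace hne := nonempty_iff_ne_empty.2 hne
  have hσ : σ.Nonempty := by
    rw [Finset.nonempty_iff_ne_empty]
    rintro rfl
    simp at hne
  have : Nonempty σ := hσ.to_subtype
  have h1 := finrank_vectorSpan_range_add_one_le ℝ (fun x : σ => (x : E3))
  rw [Fintype.card_coe, Subtype.range_coe_subtype] at h1
  obtain ⟨g, hg, hk⟩ := exists_functional_of_finrank_lt
    (D := vectorSpan ℝ {x : E3 | x ∈ σ}) (by omega)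
  obtain ⟨y, hy⟩ := hσ
  obtain ⟨a, ha, hne⟩ := exists_apply_ne_of_interior hne hg (g y)
  apply hne
  have := hk (a - y) (vsub_mem_vectorSpan ℝ ha hy)
  rwa [map_sub, sub_eq_zero] at this

/-- Face-to-face collections of tetrahedra covering the polytope are triangulations. -/
theorem IsTriangulation.of_inter_eq {A : Set E3} {T : Finset (Finset E3)}
    (h4 : ∀ t ∈ T, t.card = 4)
    (hind : ∀ t ∈ T, AffineIndependent ℝ (fun x : t => (x : E3)))
    (hA : ∀ t ∈ T, (t : Set E3) ⊆ A)
    (hcov : ∀ x ∈ convexHull ℝ A, ∃ t ∈ T, x ∈ convexHull ℝ (t : Set E3))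
    (hinter : ∀ s ∈ T, ∀ t ∈ T, convexHull ℝ (s : Set E3) ∩ convexHull ℝ (t : Set E3) ⊆
      convexHull ℝ ((s : Set E3) ∩ (t : Set E3))) : IsTriangulation A T where
  card_eq := h4
  affineIndependent := hind
  vertices_subset := hA
  disjoint_interior := by
    classical
    -- Disjoint interiors come for free: distinct tetrahedra have at most three common vertices, and
    -- their intersection lies in the hull of these.
    intro s hs t ht hst
    rw [disjoint_iff_inter_eq_empty, ← interior_inter]
    refine subset_empty_iff.1 ((interior_mono (hinter s hs t ht)).trans ?_)
    rw [← Finset.coe_inter, interior_convexHull_eq_empty]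
    by_contra hc
    have h1 : s ∩ t = s := Finset.eq_of_subset_of_card_le Finset.inter_subset_left
      (by rw [h4 s hs]; omega)
    have h2 : s ∩ t = t := Finset.eq_of_subset_of_card_le Finset.inter_subset_right
      (by rw [h4 t ht]; omega)
    exact hst (h1.symm.trans h2)
  iUnion_eq := by
    apply Subset.antisymm
    · exact iUnion₂_subset fun t ht => convexHull_mono (hA t ht)
    · intro x hx
      obtain ⟨t, ht, hxt⟩ := hcov x hx
      exact mem_biUnion ht hxt
  inter_eq := fun s hs t ht => (hinter s hs t ht).antisymm
    (subset_inter (convexHull_mono inter_subset_left) (convexHull_mono inter_subset_right))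

theorem mem_segment_iff_exists {w y x : E3} :
    x ∈ segment ℝ w y ↔ ∃ a ∈ Icc (0 : ℝ) 1, x = w + a • (y - w) := by
  rw [segment_eq_image']
  simp [eq_comm]

/-- A ray from `w` leaves `P` only once, so if a point other than `w` lies in both cones, the
segments through it end at the same point of the two bases. -/
theorem cone_inter_subset {P : Set E3} (hP : Convex ℝ P) {w : E3} (hw : w ∈ P) {σ τ F G : Set E3}
    (hF : IsExposed ℝ P F) (hG : IsExposed ℝ P G) (hσ : σ ⊆ F) (hτ : τ ⊆ G) (hwF : w ∉ F)
    (hwG : w ∉ G) (h : convexHull ℝ σ ∩ convexHull ℝ τ ⊆ convexHull ℝ (σ ∩ τ)) :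
    convexHull ℝ (insert w σ) ∩ convexHull ℝ (insert w τ) ⊆
      convexHull ℝ (insert w (σ ∩ τ)) := by
  rintro x ⟨hxσ, hxτ⟩
  have hwmem : w ∈ convexHull ℝ (insert w (σ ∩ τ)) :=
    subset_convexHull ℝ _ (mem_insert _ _)
  rcases σ.eq_empty_or_nonempty with rfl | hσne
  · rw [show (insert w ∅ : Set E3) = {w} by simp, convexHull_singleton] at hxσ
    rw [mem_singleton_iff.1 hxσ]
    exact hwmem
  rcases τ.eq_empty_or_nonempty with rfl | hτne
  · rw [show (insert w ∅ : Set E3) = {w} by simp, convexHull_singleton] at hxτ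
    rw [mem_singleton_iff.1 hxτ]
    exact hwmem
  rw [convexHull_insert hσne] at hxσ
  rw [convexHull_insert hτne] at hxτ
  simp only [convexJoin_singleton_left, mem_iUnion, exists_prop] at hxσ hxτ
  obtain ⟨y, hy, hxy⟩ := hxσ
  obtain ⟨z, hz, hxz⟩ := hxτ
  have hyF := convexHull_min hσ (hF.convex hP) hy
  have hzG := convexHull_min hτ (hG.convex hP) hz
  by_cases hxw : x = w
  · rw [hxw]; exact hwmem
  obtain ⟨a, ha, hxa⟩ := mem_segment_iff_exists.1 hxy
  obtain ⟨b, hb, hxb⟩ := mem_segment_iff_exists.1 hxz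
  have ha0 : 0 < a := ha.1.lt_of_ne (by rintro rfl; exact hxw (by simpa using hxa))
  have hb0 : 0 < b := hb.1.lt_of_ne (by rintro rfl; exact hxw (by simpa using hxb))
  -- The functional exposing `F` is maximal at `y`, so `z` cannot lie farther along the ray than
  -- `y`. Used in both directions.
  have key : ∀ {F : Set E3} {y z : E3} {a b : ℝ}, IsExposed ℝ P F → w ∉ F → y ∈ F → z ∈ P →
      0 < b → x = w + a • (y - w) → x = w + b • (z - w) → a ≤ b := by
    intro F y z a b hF hwF hyF hz hb0 hxa hxb
    obtain ⟨f, c, hf, rfl⟩ := isExposed_iff.1 hF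
    have h1 : f w < c := (hf w hw).lt_of_ne fun h => hwF ⟨hw, h⟩
    have h2 : f x = f w + a * (c - f w) := by rw [hxa, ← hyF.2]; simp
    have h3 : f x = f w + b * (f z - f w) := by rw [hxb]; simp
    have h4 := mul_le_mul_of_nonneg_left (sub_le_sub_right (hf z hz) (f w)) hb0.le
    have h5 : a * (c - f w) ≤ b * (c - f w) := by linarith
    exact le_of_mul_le_mul_right h5 (by linarith)
  have hab : a = b := le_antisymm (key hF hwF hyF (hG.subset hzG) hb0 hxa hxb)
    (key hG hwG hzG (hF.subset hyF) ha0 hxb hxa)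
  have hyz : y = z := by
    rw [hxa, ← hab] at hxb
    have := smul_right_injective E3 ha0.ne' (add_left_cancel hxb)
    exact sub_left_injective this
  have hmem := h ⟨hy, hyz ▸ hz⟩
  exact (convex_convexHull ℝ _).segment_subset hwmem (convexHull_mono (subset_insert _ _) hmem) hxy

theorem inter_subset_of_isExposed {P : Set E3} (hP : Convex ℝ P) {σ τ : Set E3}
    (hσ : σ ⊆ P.extremePoints ℝ) (hτ : IsExposed ℝ P (convexHull ℝ τ)) :
    convexHull ℝ σ ∩ convexHull ℝ τ ⊆ convexHull ℝ (σ ∩ τ) := by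
  rw [hτ.inter_convexHull (hσ.trans extremePoints_subset) hP]
  refine convexHull_mono fun x hx => ⟨hx.1, ?_⟩
  exact mem_of_mem_extremePoints_of_mem_convexHull (hσ hx.1)
    ((subset_convexHull ℝ τ).trans hτ.subset) hP hx.2

/-- The two hulls can only meet inside `F ∩ G`. The relevant vertices there belong to the affinely
independent set `B`, and faces of one simplex intersect properly. -/
theorem inter_subset_of_affineIndependent [DecidableEq E3] {P : Set E3} (hP : Convex ℝ P)
    {σ τ B : Finset E3} {F G : Set E3} (hF : IsExposed ℝ P F) (hG : IsExposed ℝ P G)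
    (hσ : (σ : Set E3) ⊆ F) (hτ : (τ : Set E3) ⊆ G)
    (hB : AffineIndependent ℝ (fun x : B => (x : E3)))
    (hσB : (σ : Set E3) ∩ G ⊆ B) (hτB : (τ : Set E3) ∩ F ⊆ B) :
    convexHull ℝ (σ : Set E3) ∩ convexHull ℝ (τ : Set E3) ⊆
      convexHull ℝ ((σ : Set E3) ∩ (τ : Set E3)) := by
  classical
  rintro x ⟨hxσ, hxτ⟩
  have hxF := convexHull_min hσ (hF.convex hP) hxσ
  have hxG := convexHull_min hτ (hG.convex hP) hxτ
  have h1 : x ∈ convexHull ℝ ((σ : Set E3) ∩ G) :=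
    hG.inter_convexHull (hσ.trans hF.subset) hP ▸ ⟨hxσ, hxG⟩
  have h2 : x ∈ convexHull ℝ ((τ : Set E3) ∩ F) :=
    hF.inter_convexHull (hτ.trans hG.subset) hP ▸ ⟨hxτ, hxF⟩
  have h3 := hB.convexHull_inter (t₁ := σ ∩ B) (t₂ := τ ∩ B) Finset.inter_subset_right
    Finset.inter_subset_right
  have h4 : x ∈ convexHull ℝ (((σ ∩ B : Finset E3) : Set E3) ∩ (τ ∩ B : Finset E3)) := by
    rw [h3]
    refine ⟨convexHull_mono ?_ h1, convexHull_mono ?_ h2⟩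
    · intro y hy
      exact Finset.mem_inter.2 ⟨hy.1, hσB hy⟩
    · intro y hy
      exact Finset.mem_inter.2 ⟨hy.1, hτB hy⟩
  refine convexHull_mono ?_ h4
  rintro y ⟨hy1, hy2⟩
  exact ⟨(Finset.mem_inter.1 hy1).1, (Finset.mem_inter.1 hy2).1⟩

/-- Coning a face-to-face collection of triangles in the faces that miss a vertex `w` gives a
triangulation. -/
theorem isTriangulation_cone [DecidableEq E3] {A : Set E3} {w : E3} (hw : w ∈ A)
    (B : Finset (Finset E3)) (h3 : ∀ σ ∈ B, σ.card = 3)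
    (hind : ∀ σ ∈ B, AffineIndependent ℝ (fun x : σ => (x : E3)))
    (hA : ∀ σ ∈ B, (σ : Set E3) ⊆ A)
    (hface : ∀ σ ∈ B, ∃ F, IsExposed ℝ (convexHull ℝ A) F ∧ (σ : Set E3) ⊆ F ∧ w ∉ F)
    (hinter : ∀ σ ∈ B, ∀ τ ∈ B, convexHull ℝ (σ : Set E3) ∩ convexHull ℝ (τ : Set E3) ⊆
      convexHull ℝ ((σ : Set E3) ∩ (τ : Set E3)))
    (hcov : ∀ x ∈ convexHull ℝ A, ∃ σ ∈ B, ∃ y ∈ convexHull ℝ (σ : Set E3),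
      x ∈ segment ℝ w y) : IsTriangulation A (B.image (insert w)) := by
  have hwσ : ∀ σ ∈ B, w ∉ σ := fun σ hσ hwσ => by
    obtain ⟨F, -, h1, h2⟩ := hface σ hσ
    exact h2 (h1 hwσ)
  have hwP := subset_convexHull ℝ A hw
  refine IsTriangulation.of_inter_eq (Finset.forall_mem_image.2 ?_)
    (Finset.forall_mem_image.2 ?_) (Finset.forall_mem_image.2 ?_) ?_
    (Finset.forall_mem_image.2 fun σ hσ => Finset.forall_mem_image.2 fun τ hτ => ?_)
  · intro σ hσ
    rw [Finset.card_insert_of_notMem (hwσ σ hσ), h3 σ hσ]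
  · intro σ hσ
    obtain ⟨F, hF, h1, h2⟩ := hface σ hσ
    obtain ⟨f, c, hf, rfl⟩ := isExposed_iff.1 hF
    exact affineIndependent_insert (hind σ hσ) f (fun x hx => (h1 hx).2) fun h => h2 ⟨hwP, h⟩
  · intro σ hσ
    rw [Finset.coe_insert]
    exact insert_subset hw (hA σ hσ)
  · intro x hx
    obtain ⟨σ, hσ, y, hy, hxy⟩ := hcov x hx
    refine ⟨insert w σ, Finset.mem_image_of_mem _ hσ, ?_⟩
    rw [Finset.coe_insert]
    exact (convex_convexHull ℝ _).segment_subset (subset_convexHull ℝ _ (mem_insert _ _))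
      (convexHull_mono (subset_insert _ _) hy) hxy
  · obtain ⟨F, hF, h1, h2⟩ := hface σ hσ
    obtain ⟨G, hG, h4, h5⟩ := hface τ hτ
    rw [Finset.coe_insert, Finset.coe_insert, ← insert_inter_distrib]
    exact cone_inter_subset (convex_convexHull ℝ A) hwP hF hG h1 h4 h2 h5 (hinter σ hσ τ hτ)

/-! ### Flips -/

theorem exists_weights_of_mem_convexHull {u b c d x : E3}
    (hx : x ∈ convexHull ℝ ({u, b, c, d} : Set E3)) :
    ∃ l p q r : ℝ, 0 ≤ l ∧ 0 ≤ p ∧ 0 ≤ q ∧ 0 ≤ r ∧ l + p + q + r = 1 ∧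
      x = l • u + p • b + q • c + r • d := by
  have hC : Convex ℝ {x : E3 | ∃ l p q r : ℝ, 0 ≤ l ∧ 0 ≤ p ∧ 0 ≤ q ∧ 0 ≤ r ∧
      l + p + q + r = 1 ∧ x = l • u + p • b + q • c + r • d} := by
    rintro x ⟨l, p, q, r, hl, hp, hq, hr, hs, rfl⟩ y ⟨l', p', q', r', hl', hp', hq', hr', hs', rfl⟩
      s t hs0 ht0 hst
    refine ⟨s * l + t * l', s * p + t * p', s * q + t * q', s * r + t * r', by positivity,
      by positivity, by positivity, by positivity, ?_, by module⟩
    linear_combination s * hs + t * hs' + hst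
  refine convexHull_min ?_ hC hx
  rintro x (rfl | rfl | rfl | rfl)
  · exact ⟨1, 0, 0, 0, by simp⟩
  · exact ⟨0, 1, 0, 0, by simp⟩
  · exact ⟨0, 0, 1, 0, by simp⟩
  · exact ⟨0, 0, 0, 1, by simp⟩

theorem combination_mem {S : Set E3} (hS : Convex ℝ S) {u b c d : E3} (hu : u ∈ S) (hb : b ∈ S)
    (hc : c ∈ S) (hd : d ∈ S) {l p q r : ℝ} (hl : 0 ≤ l) (hp : 0 ≤ p) (hq : 0 ≤ q) (hr : 0 ≤ r)
    (h : l + p + q + r = 1) : l • u + p • b + q • c + r • d ∈ S := by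
  have := hS.sum_mem (t := Finset.univ) (w := ![l, p, q, r]) (z := ![u, b, c, d])
    (by intro i _; fin_cases i <;> simpa) (by simp [Fin.sum_univ_four, h])
    (by intro i _; fin_cases i <;> simpa)
  simpa [Fin.sum_univ_four] using this

/-- Rewriting with `s • z` absorbs the coefficient of `b` entirely and leaves nonnegative
coefficients on `c` and `d`; `z` itself is a combination of `u` and `e`. -/
theorem mem_of_weights_le {u e b c d z : E3} {β γ δ : ℝ} (h1 : β + γ + δ = 1)
    (hz : z = β • b + γ • c + δ • d) (hzue : z ∈ segment ℝ u e) {l p q r s : ℝ} (hl : 0 ≤ l)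
    (hs : 0 ≤ s) (hp : s * β = p) (hq : s * γ ≤ q) (hr : s * δ ≤ r)
    (hsum : l + p + q + r = 1) :
    l • u + p • b + q • c + r • d ∈ convexHull ℝ ({u, e, c, d} : Set E3) := by
  have hS := convex_convexHull ℝ ({u, e, c, d} : Set E3)
  have hu : u ∈ convexHull ℝ ({u, e, c, d} : Set E3) := subset_convexHull ℝ _ (by simp)
  have he : e ∈ convexHull ℝ ({u, e, c, d} : Set E3) := subset_convexHull ℝ _ (by simp)
  have hc : c ∈ convexHull ℝ ({u, e, c, d} : Set E3) := subset_convexHull ℝ _ (by simp)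
  have hd : d ∈ convexHull ℝ ({u, e, c, d} : Set E3) := subset_convexHull ℝ _ (by simp)
  have hz' := hS.segment_subset hu he hzue
  have := combination_mem hS hu hz' hc hd hl hs (sub_nonneg.2 hq) (sub_nonneg.2 hr) (by
    rw [← hp] at hsum
    linear_combination hsum - s * h1)
  convert this using 1
  rw [hz, ← hp]
  module

/-- If a segment `u e` crosses a triangle `b c d`, then the tetrahedron `u b c d` is covered by the
tetrahedra around the segment. -/
theorem mem_or_mem_of_crossing {u e b c d z x : E3} {β γ δ : ℝ} (hβ : 0 < β) (hγ : 0 < γ)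
    (hδ : 0 ≤ δ) (h1 : β + γ + δ = 1) (hz : z = β • b + γ • c + δ • d)
    (hzue : z ∈ segment ℝ u e) (hx : x ∈ convexHull ℝ ({u, b, c, d} : Set E3)) :
    (0 < δ ∧ x ∈ convexHull ℝ ({u, e, b, c} : Set E3)) ∨
      x ∈ convexHull ℝ ({u, e, b, d} : Set E3) ∨ x ∈ convexHull ℝ ({u, e, c, d} : Set E3) := by
  obtain ⟨l, p, q, r, hl, hp, hq, hr, hsum, rfl⟩ := exists_weights_of_mem_convexHull hx
  have hB : ∀ s, 0 ≤ s → s * β = p → s * γ ≤ q → s * δ ≤ r →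
      l • u + p • b + q • c + r • d ∈ convexHull ℝ ({u, e, c, d} : Set E3) :=
    fun s hs h2 h3 h4 => mem_of_weights_le h1 hz hzue hl hs h2 h3 h4 hsum
  have hC : ∀ s, 0 ≤ s → s * γ = q → s * β ≤ p → s * δ ≤ r →
      l • u + p • b + q • c + r • d ∈ convexHull ℝ ({u, e, b, d} : Set E3) := by
    intro s hs h2 h3 h4
    have := mem_of_weights_le (u := u) (e := e) (b := c) (c := b) (d := d) (z := z)
      (by linarith : γ + β + δ = 1) (by rw [hz]; abel) hzue hl hs h2 h3 h4 (by linarith)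
    convert this using 1
    abel
  have hD : ∀ s, 0 ≤ s → s * δ = r → s * β ≤ p → s * γ ≤ q →
      l • u + p • b + q • c + r • d ∈ convexHull ℝ ({u, e, b, c} : Set E3) := by
    intro s hs h2 h3 h4
    have := mem_of_weights_le (u := u) (e := e) (b := d) (c := b) (d := c) (z := z)
      (by linarith : δ + β + γ = 1) (by rw [hz]; abel) hzue hl hs h2 h3 h4 (by linarith)
    convert this using 1
    abel
  have hpβ : p / β * β = p := div_mul_cancel₀ _ hβ.ne'
  have hqγ : q / γ * γ = q := div_mul_cancel₀ _ hγ.ne'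
  have hpβ0 : 0 ≤ p / β := by positivity
  have hqγ0 : 0 ≤ q / γ := by positivity
  -- The smallest of `p / β`, `q / γ` and, when `δ > 0`, `r / δ` tells which of `b`, `c`, `d` can be
  -- eliminated in favour of `z`.
  by_cases h : (0 < δ ∧ r / δ ≤ p / β) ∧ r / δ ≤ q / γ
  · obtain ⟨⟨hδ0, h2⟩, h3⟩ := h
    exact Or.inl ⟨hδ0, hD (r / δ) (by positivity) (div_mul_cancel₀ _ hδ0.ne')
      (by rwa [le_div_iff₀ hβ] at h2) (by rwa [le_div_iff₀ hγ] at h3)⟩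
  · right
    have hcase : ∀ s : ℝ, (0 < δ → s ≤ r / δ) → s * δ ≤ r := by
      intro s hs
      rcases hδ.lt_or_eq with h0 | h0
      · have := hs h0
        rwa [le_div_iff₀ h0] at this
      · rw [← h0, mul_zero]; exact hr
    rcases le_total (p / β) (q / γ) with h2 | h2
    · refine Or.inr (hB (p / β) hpβ0 hpβ (by rwa [le_div_iff₀ hγ] at h2) (hcase _ fun h0 => ?_))
      by_contra hc
      exact h ⟨⟨h0, by linarith⟩, by linarith⟩
    · refine Or.inl (hC (q / γ) hqγ0 hqγ (by rwa [le_div_iff₀ hβ] at h2) (hcase _ fun h0 => ?_))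
      by_contra hc
      exact h ⟨⟨h0, by linarith⟩, by linarith⟩

theorem mem_segment_or_mem_segment {u e z p : E3} (hz : z ∈ segment ℝ u e)
    (hp : p ∈ segment ℝ u e) : p ∈ segment ℝ u z ∨ p ∈ segment ℝ e z := by
  obtain ⟨t, ht, rfl⟩ := mem_segment_iff_exists.1 hz
  obtain ⟨s, hs, rfl⟩ := mem_segment_iff_exists.1 hp
  rcases le_total s t with h | h
  · left
    rcases ht.1.lt_or_eq with h0 | h0
    · refine mem_segment_iff_exists.2 ⟨s / t, ⟨div_nonneg hs.1 ht.1, (div_le_one h0).2 h⟩, ?_⟩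
      rw [add_sub_cancel_left, smul_smul, div_mul_cancel₀ _ h0.ne']
    · have : s = 0 := le_antisymm (h.trans h0.symm.le) hs.1
      rw [this, zero_smul, add_zero]
      exact left_mem_segment ℝ _ _
  · right
    rcases ht.2.lt_or_eq with h0 | h0
    · have h3 : 1 - t ≠ 0 := by linarith
      refine mem_segment_iff_exists.2 ⟨(1 - s) / (1 - t), ⟨div_nonneg (by linarith [hs.2])
        (by linarith), (div_le_one (by linarith)).2 (by linarith)⟩, ?_⟩
      have h2 : u + t • (e - u) - e = (1 - t) • (u - e) := by module
      rw [h2, smul_smul, div_mul_cancel₀ _ h3]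
      module
    · have : s = 1 := le_antisymm hs.2 (h0.symm.le.trans h)
      rw [this, one_smul, add_sub_cancel]
      exact left_mem_segment ℝ _ _

/-- The point lies on a segment from some `p` on `u e` to the hull of `S`, and `z` splits `u e` into
the two parts that can contain `p`. -/
theorem mem_or_mem_of_mem_insert_insert {u e z x : E3} {S : Set E3} (hS : S.Nonempty)
    (hz : z ∈ segment ℝ u e) (hzS : z ∈ convexHull ℝ S)
    (hx : x ∈ convexHull ℝ (insert u (insert e S))) :
    x ∈ convexHull ℝ (insert u S) ∨ x ∈ convexHull ℝ (insert e S) := by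
  have h1 : (insert u (insert e S) : Set E3) = {u, e} ∪ S := by
    rw [insert_union, singleton_union]
  rw [h1, convexHull_union (insert_nonempty _ _) hS, convexHull_pair, mem_convexJoin] at hx
  obtain ⟨p, hp, q, hq, hx⟩ := hx
  have key : ∀ a, p ∈ segment ℝ a z → x ∈ convexHull ℝ (insert a S) := by
    intro a hpa
    have hsub := convexHull_mono (𝕜 := ℝ) (subset_insert a S)
    have hc := convex_convexHull ℝ (insert a S)
    exact hc.segment_subset (hc.segment_subset (subset_convexHull ℝ _ (mem_insert _ _))
      (hsub hzS) hpa) (hsub hq) hx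
  exact (mem_segment_or_mem_segment hz hp).imp (key u) (key e)

/-- The part of a cell beyond the plane of the triangle `b c d` is not needed for covering the
intersection with a tetrahedron on the other side. -/
theorem inter_subset_of_separated {T : Finset (Finset E3)} [DecidableEq E3]
    (hT : ∀ s ∈ T, ∀ t ∈ T, convexHull ℝ (s : Set E3) ∩ convexHull ℝ (t : Set E3) =
      convexHull ℝ ((s : Set E3) ∩ (t : Set E3))) {u e b c d : E3} (g : StrongDual ℝ E3) {k : ℝ}
    (hu : g u < k) (he : k < g e) (hb : g b = k) (hc : g c = k) (hd : g d = k)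
    (hcov : ∀ x ∈ convexHull ℝ ({e, b, c, d} : Set E3), ∃ r ∈ T, (r : Set E3) ⊆ {u, e, b, c, d} ∧
      x ∈ convexHull ℝ (r : Set E3))
    {s : Finset E3} (hs : s ∈ T) (hus : ¬ (u ∈ s ∧ e ∈ s)) :
    convexHull ℝ (s : Set E3) ∩ convexHull ℝ ({e, b, c, d} : Set E3) ⊆
      convexHull ℝ ((s : Set E3) ∩ {e, b, c, d}) := by
  rintro x ⟨hxs, hx⟩
  obtain ⟨r, hr, hrsub, hxr⟩ := hcov x hx
  have h1 : x ∈ convexHull ℝ ((s : Set E3) ∩ (r : Set E3)) := hT s hs r hr ▸ ⟨hxs, hxr⟩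
  by_cases hu' : u ∈ s
  · have he' : e ∉ s := fun h => hus ⟨hu', h⟩
    -- `x` is on the side of `e`, while the common vertices of `s` and `r` are on the side of `u` or
    -- in the plane, since `e ∉ s`. Hence `x` is in the plane and `u` is not needed to span it.
    have h2 : k ≤ g x := by
      have := le_of_mem_convexHull (-g) (c := -k) (by
        rintro y (rfl | rfl | rfl | rfl) <;> simp <;> linarith) hx
      simpa using this
    have h3 : ∀ y ∈ (s : Set E3) ∩ (r : Set E3), g y ≤ k := by
      rintro y ⟨hys, hyr⟩
      rcases hrsub hyr with rfl | rfl | rfl | rfl | rfl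
      · exact hu.le
      · exact absurd hys he'
      · exact hb.le
      · exact hc.le
      · exact hd.le
    have h4 := le_of_mem_convexHull g h3 h1
    have h5 : x ∈ convexHull ℝ (((s : Set E3) ∩ (r : Set E3)) ∩ {y | g y = k}) := by
      rw [← convexHull_inter_hyperplane g h3]
      exact ⟨h1, le_antisymm h4 h2⟩
    refine convexHull_mono ?_ h5
    rintro y ⟨⟨hys, hyr⟩, hy⟩
    refine ⟨hys, ?_⟩
    rcases hrsub hyr with rfl | h
    · exact absurd hy hu.ne
    · exact h
  · refine convexHull_mono ?_ h1
    rintro y ⟨hys, hyr⟩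
    refine ⟨hys, ?_⟩
    rcases hrsub hyr with rfl | h
    · exact absurd hys hu'
    · exact h

/-- The functional is constant on `b`, `c`, `d`. Affine independence keeps `u` off its level plane;
`z` is in that plane and between `u` and `e`, so `z ≠ e` puts `e` strictly on the other side. -/
theorem exists_separating_functional [DecidableEq E3] {u e b c d z : E3} {β γ δ : ℝ}
    (h1 : β + γ + δ = 1) (hz : z = β • b + γ • c + δ • d)
    (hzue : z ∈ segment ℝ u e) (hze : z ≠ e)
    (hucard : ({u, b, c, d} : Finset E3).card = 4)
    (huind : AffineIndependent ℝ (fun x : ({u, b, c, d} : Finset E3) => (x : E3))) :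
    ∃ (g : StrongDual ℝ E3) (k : ℝ), g b = k ∧ g c = k ∧ g d = k ∧ g u < k ∧ k < g e := by
  have hdim : Module.finrank ℝ (Submodule.span ℝ (({b - d, c - d} : Finset E3) : Set E3)) < 3 :=
    (finrank_span_finset_le_card _).trans_lt (Finset.card_le_two.trans_lt (by norm_num))
  obtain ⟨g, hg, hk⟩ := exists_functional_of_finrank_lt hdim
  have hb : g b = g d := by
    have := hk (b - d) (Submodule.subset_span (by simp))
    rwa [map_sub, sub_eq_zero] at this
  have hc : g c = g d := by
    have := hk (c - d) (Submodule.subset_span (by simp))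
    rwa [map_sub, sub_eq_zero] at this
  have hu : g u ≠ g d := by
    intro h
    have := card_le_three_of_affineIndependent hg (c := g d) huind (by simp [h, hb, hc])
    omega
  obtain ⟨t, ht, hzt⟩ := mem_segment_iff_exists.1 hzue
  have hgz : g z = g d := by
    rw [hz]
    simp only [map_add, map_smul, smul_eq_mul, hb, hc]
    rw [← add_mul, ← add_mul, h1, one_mul]
  have hgt : (1 - t) * (g u - g d) = t * (g d - g e) := by
    have : g z = g u + t * (g e - g u) := by rw [hzt]; simp
    linear_combination this.symm.trans hgz
  have he : g e ≠ g d := by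
    intro h
    rw [h, sub_self, mul_zero, mul_eq_zero, sub_eq_zero] at hgt
    rcases hgt with h | h
    · exact hze (by rw [hzt, ← h, one_smul, add_sub_cancel])
    · exact hu (sub_eq_zero.1 h)
  rcases hu.lt_or_gt with h | h
  · refine ⟨g, g d, hb, hc, rfl, h, he.symm.lt_of_le ?_⟩
    by_contra! hlt
    have : t = 0 := by nlinarith [ht.1, ht.2]
    rw [this] at hgt
    linarith
  · refine ⟨-g, -g d, by simp [hb], by simp [hc], rfl, by simpa using h, ?_⟩
    have : g e ≤ g d := by
      by_contra! hlt
      have : t = 0 := by nlinarith [ht.1, ht.2]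
      rw [this] at hgt
      linarith
    simpa using this.lt_of_ne he

theorem inter_subset_of_opposite {u e b c d : E3} (g : StrongDual ℝ E3) {k : ℝ}
    (hu : g u < k) (he : k < g e) (hb : g b = k) (hc : g c = k) (hd : g d = k) :
    convexHull ℝ ({u, b, c, d} : Set E3) ∩ convexHull ℝ ({e, b, c, d} : Set E3) ⊆
      convexHull ℝ {b, c, d} := by
  rintro x ⟨hx, hx'⟩
  have h2 : k ≤ g x := by
    have := le_of_mem_convexHull (-g) (c := -k) (by
      rintro y (rfl | rfl | rfl | rfl) <;> simp <;> linarith) hx'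
    simpa using this
  have h3 : ∀ y ∈ ({u, b, c, d} : Set E3), g y ≤ k := by
    rintro y (rfl | rfl | rfl | rfl) <;> linarith
  have h5 : x ∈ convexHull ℝ (({u, b, c, d} : Set E3) ∩ {y | g y = k}) := by
    rw [← convexHull_inter_hyperplane g h3]
    exact ⟨hx, le_antisymm (le_of_mem_convexHull g h3 hx) h2⟩
  refine convexHull_mono ?_ h5
  rintro y ⟨rfl | h, hy⟩
  · exact absurd hy hu.ne
  · exact h

/-- The result of replacing the tetrahedra around the edge `u e` by the two tetrahedra
`u b c d` and `e b c d`. -/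
def flip [DecidableEq E3] (T : Finset (Finset E3)) (u e b c d : E3) : Finset (Finset E3) :=
  T.filter (fun t => ¬ (u ∈ t ∧ e ∈ t)) ∪ {{u, b, c, d}, {e, b, c, d}}

theorem card_flip_le [DecidableEq E3] (T : Finset (Finset E3)) (u e b c d : E3) :
    (flip T u e b c d).card + (T.filter (fun t => u ∈ t ∧ e ∈ t)).card ≤ T.card + 2 := by
  have h1 := Finset.card_union_le (T.filter (fun t => ¬ (u ∈ t ∧ e ∈ t)))
    {{u, b, c, d}, {e, b, c, d}}
  have h2 := T.card_filter_add_card_filter_not (fun t => u ∈ t ∧ e ∈ t)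
  have h3 := Finset.card_le_two (a := ({u, b, c, d} : Finset E3)) (b := {e, b, c, d})
  unfold flip
  omega

/-- One statement covers two situations: for `δ > 0` three tetrahedra surround the edge `u e`, while
for `δ = 0` the edge crosses the segment `b c` and only two are required. The crossing lemma shows
that old tetrahedra cover the new ones; splitting along `b c d` gives the converse. -/
theorem isTriangulation_flip [DecidableEq E3] {A : Set E3} {T : Finset (Finset E3)}
    (hT : IsTriangulation A T) {u e b c d z : E3} {β γ δ : ℝ} (hβ : 0 < β) (hγ : 0 < γ)
    (hδ : 0 ≤ δ) (h1 : β + γ + δ = 1) (hz : z = β • b + γ • c + δ • d)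
    (hzue : z ∈ segment ℝ u e) (hze : z ≠ e)
    (hucard : ({u, b, c, d} : Finset E3).card = 4)
    (huind : AffineIndependent ℝ (fun x : ({u, b, c, d} : Finset E3) => (x : E3)))
    (hstar : ∀ t ∈ T, u ∈ t → e ∈ t → t ⊆ {u, e, b, c, d})
    (hbd : {u, e, b, d} ∈ T) (hcd : {u, e, c, d} ∈ T) (hbc : 0 < δ → {u, e, b, c} ∈ T) :
    IsTriangulation A (flip T u e b c d) := by
  have hdA : ({u, e, b, c, d} : Set E3) ⊆ A := by
    have h1 := hT.vertices_subset _ hbd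
    have h2 := hT.vertices_subset _ hcd
    rintro x (rfl | rfl | rfl | rfl | rfl)
    · exact h1 (by simp)
    · exact h1 (by simp)
    · exact h1 (by simp)
    · exact h2 (by simp)
    · exact h1 (by simp)
  obtain ⟨g, k, hb, hc, hd, hu, he⟩ :=
    exists_separating_functional h1 hz hzue hze hucard huind
  have hub : u ∉ ({b, c, d} : Finset E3) := by
    simp only [Finset.mem_insert, Finset.mem_singleton]
    rintro (rfl | rfl | rfl) <;> linarith
  have heb : e ∉ ({b, c, d} : Finset E3) := by
    simp only [Finset.mem_insert, Finset.mem_singleton]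
    rintro (rfl | rfl | rfl) <;> linarith
  have hecard : ({e, b, c, d} : Finset E3).card = 4 := by
    rw [Finset.card_insert_of_notMem hub] at hucard
    rw [Finset.card_insert_of_notMem heb, hucard]
  have heind : AffineIndependent ℝ (fun x : ({e, b, c, d} : Finset E3) => (x : E3)) :=
    affineIndependent_insert (AffineIndependent.subset_finset huind (Finset.subset_insert _ _)) g
      (c := k) (by simp [hb, hc, hd]) he.ne'
  have hzue' : z ∈ segment ℝ e u := segment_symm ℝ u e ▸ hzue
  have hsub : ∀ r : Finset E3, r = {u, e, b, c} ∨ r = {u, e, b, d} ∨ r = {u, e, c, d} →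
      (r : Set E3) ⊆ {u, e, b, c, d} := by
    rintro r (rfl | rfl | rfl) <;> simp [insert_subset_iff]
  have hcovU : ∀ x ∈ convexHull ℝ ({u, b, c, d} : Set E3),
      ∃ r ∈ T, (r : Set E3) ⊆ {u, e, b, c, d} ∧ x ∈ convexHull ℝ (r : Set E3) := by
    intro x hx
    rcases mem_or_mem_of_crossing hβ hγ hδ h1 hz hzue hx with ⟨h0, h⟩ | h | h
    · exact ⟨_, hbc h0, hsub _ (Or.inl rfl), by simpa using h⟩
    · exact ⟨_, hbd, hsub _ (Or.inr (Or.inl rfl)), by simpa using h⟩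
    · exact ⟨_, hcd, hsub _ (Or.inr (Or.inr rfl)), by simpa using h⟩
  have hcovE : ∀ x ∈ convexHull ℝ ({e, b, c, d} : Set E3),
      ∃ r ∈ T, (r : Set E3) ⊆ {u, e, b, c, d} ∧ x ∈ convexHull ℝ (r : Set E3) := by
    intro x hx
    rcases mem_or_mem_of_crossing hβ hγ hδ h1 hz hzue' hx with ⟨h0, h⟩ | h | h
    · exact ⟨_, hbc h0, hsub _ (Or.inl rfl), by rw [insert_comm] at h; simpa using h⟩
    · exact ⟨_, hbd, hsub _ (Or.inr (Or.inl rfl)), by rw [insert_comm] at h; simpa using h⟩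
    · exact ⟨_, hcd, hsub _ (Or.inr (Or.inr rfl)), by rw [insert_comm] at h; simpa using h⟩
  have hE : ∀ s ∈ T, ¬ (u ∈ s ∧ e ∈ s) →
      convexHull ℝ (s : Set E3) ∩ convexHull ℝ ({e, b, c, d} : Set E3) ⊆
        convexHull ℝ ((s : Set E3) ∩ {e, b, c, d}) := fun s hs hus =>
    inter_subset_of_separated hT.inter_eq g hu he hb hc hd hcovE hs hus
  have hU : ∀ s ∈ T, ¬ (u ∈ s ∧ e ∈ s) →
      convexHull ℝ (s : Set E3) ∩ convexHull ℝ ({u, b, c, d} : Set E3) ⊆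
        convexHull ℝ ((s : Set E3) ∩ {u, b, c, d}) := fun s hs hus =>
    inter_subset_of_separated hT.inter_eq (u := e) (e := u) (-g) (k := -k) (by simpa using he)
      (by simpa using hu) (by simp [hb]) (by simp [hc]) (by simp [hd])
      (fun x hx => by
        obtain ⟨r, hr, h2, h3⟩ := hcovU x hx
        exact ⟨r, hr, by rwa [insert_comm], h3⟩) hs fun h => hus h.symm
  have hUE' : convexHull ℝ (({u, b, c, d} : Finset E3) : Set E3) ∩
      convexHull ℝ (({e, b, c, d} : Finset E3) : Set E3) ⊆
      convexHull ℝ ((({u, b, c, d} : Finset E3) : Set E3) ∩ ({e, b, c, d} : Finset E3)) := by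
    simp only [Finset.coe_insert, Finset.coe_singleton]
    exact Subset.trans (inter_subset_of_opposite g hu he hb hc hd) (convexHull_mono (subset_inter (subset_insert _ _) (subset_insert _ _)))
  have hmem : ∀ t ∈ flip T u e b c d, (t ∈ T ∧ ¬ (u ∈ t ∧ e ∈ t)) ∨ t = {u, b, c, d} ∨
      t = {e, b, c, d} := by
    intro t ht
    have := ht
    simp only [flip, Finset.mem_union, Finset.mem_filter, Finset.mem_insert,
      Finset.mem_singleton] at this
    exact this
  have hUmem : {u, b, c, d} ∈ flip T u e b c d := by simp [flip]
  have hEmem : {e, b, c, d} ∈ flip T u e b c d := by simp [flip]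
  apply IsTriangulation.of_inter_eq
  · intro t ht
    rcases hmem t ht with ⟨h, -⟩ | rfl | rfl
    exacts [hT.card_eq t h, hucard, hecard]
  · intro t ht
    rcases hmem t ht with ⟨h, -⟩ | rfl | rfl
    exacts [hT.affineIndependent t h, huind, heind]
  · intro t ht
    rcases hmem t ht with ⟨h, -⟩ | rfl | rfl
    · exact hT.vertices_subset t h
    · refine Subset.trans ?_ hdA
      simp [insert_subset_iff]
    · refine Subset.trans ?_ hdA
      simp
  · intro x hx
    rw [← hT.iUnion_eq] at hx
    obtain ⟨t, ht, hxt⟩ := mem_iUnion₂.1 hx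
    by_cases hut : u ∈ t ∧ e ∈ t
    · have hx' : x ∈ convexHull ℝ (insert u (insert e {b, c, d}) : Set E3) := by
        refine convexHull_mono ?_ hxt
        have := hstar t ht hut.1 hut.2
        rw [← Finset.coe_subset] at this
        simpa using this
      have hzS : z ∈ convexHull ℝ ({b, c, d} : Set E3) := by
        have hm : ∀ y ∈ ({b, c, d} : Set E3), y ∈ convexHull ℝ ({b, c, d} : Set E3) :=
          fun y hy => subset_convexHull ℝ _ hy
        have := combination_mem (convex_convexHull ℝ ({b, c, d} : Set E3)) (hm b (by simp))
          (hm b (by simp)) (hm c (by simp)) (hm d (by simp)) le_rfl hβ.le hγ.le hδ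
          (by linarith)
        rwa [zero_smul, zero_add, ← hz] at this
      rcases mem_or_mem_of_mem_insert_insert (insert_nonempty _ _) hzue hzS hx' with h | h
      · exact ⟨_, hUmem, by simpa using h⟩
      · exact ⟨_, hEmem, by simpa using h⟩
    · exact ⟨t, Finset.mem_union_left _ (Finset.mem_filter.2 ⟨ht, hut⟩), hxt⟩
  · intro s hs t ht
    rcases hmem s hs with ⟨hs, hs'⟩ | rfl | rfl <;> rcases hmem t ht with ⟨ht, ht'⟩ | rfl | rfl
    · exact (hT.inter_eq s hs t ht).subset
    · simpa using hU s hs hs'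
    · simpa using hE s hs hs'
    · rw [inter_comm, inter_comm (({u, b, c, d} : Finset E3) : Set E3)]
      simpa using hU t ht ht'
    · simp
    · exact hUE'
    · rw [inter_comm, inter_comm (({e, b, c, d} : Finset E3) : Set E3)]
      simpa using hE t ht ht'
    · rw [inter_comm, inter_comm (({e, b, c, d} : Finset E3) : Set E3)]
      exact hUE'
    · simp

/-! ### Polytopes in terms of their vertices -/

theorem IsPolytope3.finite_extremePoints {P : Set E3} (h : IsPolytope3 P) :
    (P.extremePoints ℝ).Finite := by
  obtain ⟨⟨S, hS, rfl⟩, -⟩ := h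
  exact MinTri.finite_extremePoints hS

theorem IsPolytope3.convexHull_extremePoints {P : Set E3} (h : IsPolytope3 P) :
    convexHull ℝ (P.extremePoints ℝ) = P := by
  obtain ⟨⟨S, hS, rfl⟩, -⟩ := h
  exact MinTri.convexHull_extremePoints hS

theorem IsPolytope3.convex {P : Set E3} (h : IsPolytope3 P) : Convex ℝ P := by
  rw [← h.convexHull_extremePoints]
  exact convex_convexHull ℝ _

theorem IsPolytope3.mem_convexHull_iff {P : Set E3} (h : IsPolytope3 P) {X : Set E3}
    (hX : X ⊆ P.extremePoints ℝ) {x : E3} (hx : x ∈ P.extremePoints ℝ) :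
    x ∈ convexHull ℝ X ↔ x ∈ X :=
  ⟨mem_of_mem_extremePoints_of_mem_convexHull hx (hX.trans extremePoints_subset) h.convex,
    fun h => subset_convexHull ℝ _ h⟩

theorem IsPolytope3.convexHull_inter {P : Set E3} (h : IsPolytope3 P) {X Y : Set E3}
    (hX : X ⊆ P.extremePoints ℝ)
    (hYe : IsExposed ℝ P (convexHull ℝ Y)) :
    convexHull ℝ X ∩ convexHull ℝ Y = convexHull ℝ (X ∩ Y) :=
  (inter_subset_of_isExposed h.convex hX hYe).antisymm
    (subset_inter (convexHull_mono inter_subset_left) (convexHull_mono inter_subset_right))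

theorem IsPolytope3.exists_facet_segment {P : Set E3} (h : IsPolytope3 P) {F : Set E3}
    (hF : IsExposed ℝ P F) {p q : E3} (hp : p ∈ F) (hq : q ∈ F) (hpq : q ≠ p)
    {x : E3} (hx : x ∈ F) :
    ∃ F' ∈ facets P, p ∉ F' ∧ ∃ y ∈ F ∩ F', x ∈ segment ℝ p y := by
  have h1 := MinTri.exists_facet_segment (A := P.extremePoints ℝ) h.finite_extremePoints
    (by rw [h.convexHull_extremePoints]; exact h.2) (F := F)
    (by rw [h.convexHull_extremePoints]; exact hF) hp hq hpq hx
  rwa [h.convexHull_extremePoints] at h1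

theorem affineIndependent_of_isExposed [DecidableEq E3] {P F : Set E3} (hF : IsExposed ℝ P F)
    {p : E3} (hp : p ∈ P) (hpF : p ∉ F) {σ : Finset E3} (hσ : (σ : Set E3) ⊆ F)
    (hind : AffineIndependent ℝ (fun x : σ => (x : E3))) :
    AffineIndependent ℝ (fun x : (insert p σ : Finset E3) => (x : E3)) := by
  obtain ⟨f, c, hf, rfl⟩ := isExposed_iff.1 hF
  exact affineIndependent_insert hind f (fun x hx => (hσ hx).2) fun h => hpF ⟨hp, h⟩

theorem affineIndependent_of_mem_facets {P : Set E3} {σ : Finset E3} (hσ : σ.card = 3)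
    (h : convexHull ℝ (σ : Set E3) ∈ facets P) :
    AffineIndependent ℝ (fun x : σ => (x : E3)) := by
  have h2 := h.2
  rw [affineIndependent_iff_finrank_vectorSpan_eq ℝ _ (n := 2) (by simpa using hσ)]
  rw [← direction_affineSpan, affineSpan_convexHull, direction_affineSpan] at h2
  rw [show range (fun x : σ => (x : E3)) = (σ : Set E3) by simp]
  exact h2

/-- Triangles formed by a vertex and two edges that miss it meet face to face. -/
theorem IsPolytope3.star_inter_subset {P : Set E3} (h : IsPolytope3 P) {p : E3}
    (hp : p ∈ P.extremePoints ℝ) {σ τ : Set E3} (hσ : σ ⊆ P.extremePoints ℝ)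
    (hτ : τ ⊆ P.extremePoints ℝ) (hσe : IsExposed ℝ P (convexHull ℝ σ))
    (hτe : IsExposed ℝ P (convexHull ℝ τ)) (hpσ : p ∉ σ) (hpτ : p ∉ τ) :
    convexHull ℝ (insert p σ) ∩ convexHull ℝ (insert p τ) ⊆
      convexHull ℝ (insert p σ ∩ insert p τ) := by
  rw [← insert_inter_distrib]
  exact cone_inter_subset h.convex hp.1 hσe hτe (subset_convexHull ℝ _) (subset_convexHull ℝ _)
    (by rwa [h.mem_convexHull_iff hσ hp]) (by rwa [h.mem_convexHull_iff hτ hp])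
    (inter_subset_of_isExposed h.convex hσ hτe)

/-! ### Cyclic indices and the two bases -/

section ZMod
variable {m : ℕ}

theorem zmod_one_ne_zero (hm : 3 ≤ m) : (1 : ZMod m) ≠ 0 := by
  have : (((1 : ℕ) : ZMod m)) ≠ 0 := by
    rw [Ne, ZMod.natCast_eq_zero_iff]
    exact fun h => absurd (Nat.le_of_dvd one_pos h) (by omega)
  simpa using this

theorem zmod_two_ne_zero (hm : 3 ≤ m) : (2 : ZMod m) ≠ 0 := by
  have : (((2 : ℕ) : ZMod m)) ≠ 0 := by
    rw [Ne, ZMod.natCast_eq_zero_iff]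
    exact fun h => absurd (Nat.le_of_dvd two_pos h) (by omega)
  simpa using this

theorem zmod_add_one_ne (hm : 3 ≤ m) (i : ZMod m) : i + 1 ≠ i := fun h =>
  zmod_one_ne_zero hm (by simpa using h)

theorem zmod_exists_edge (hm : 3 ≤ m) {i : ZMod m} (hi : i ≠ 0) :
    ∃ j : ZMod m, j ≠ 0 ∧ j + 1 ≠ 0 ∧ (i = j ∨ i = j + 1) := by
  by_cases h : i + 1 = 0
  · refine ⟨i - 1, fun h' => zmod_two_ne_zero hm ?_, by simpa using hi, Or.inr (by ring)⟩
    linear_combination h - h'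
  · exact ⟨i, hi, h, Or.inl rfl⟩

end ZMod

theorem injective_left {α β γ : Type*} {u : α → γ} {v : β → γ}
    (h : Function.Injective (Sum.elim u v)) : Function.Injective u := fun a b hab =>
  Sum.inl_injective (h (a₁ := Sum.inl a) (a₂ := Sum.inl b) hab)

theorem injective_right {α β γ : Type*} {u : α → γ} {v : β → γ}
    (h : Function.Injective (Sum.elim u v)) : Function.Injective v := fun a b hab =>
  Sum.inr_injective (h (a₁ := Sum.inr a) (a₂ := Sum.inr b) hab)

theorem left_ne_right {α β γ : Type*} {u : α → γ} {v : β → γ}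
    (h : Function.Injective (Sum.elim u v)) (a : α) (b : β) : u a ≠ v b := fun hab =>
  Sum.inl_ne_inr (h (a₁ := Sum.inl a) (a₂ := Sum.inr b) hab)

/-- The data of a polytope whose vertices form two disjoint faces, both of them `m`-gons. -/
theorem IsPolytope3.isTwoLayer {P : Set E3} (h : IsPolytope3 P) {m : ℕ} [NeZero m] (hm : 3 ≤ m)
    [DecidableEq E3] {u v : ZMod m → E3} (huv : Function.Injective (Sum.elim u v))
    (hext : P.extremePoints ℝ = range u ∪ range v)
    (hU : IsExposed ℝ P (convexHull ℝ (range u))) (hV : IsExposed ℝ P (convexHull ℝ (range v))) :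
    IsTwoLayer P (Finset.univ.image u) (Finset.univ.image v) where
  eq_convexHull := by
    rw [← h.convexHull_extremePoints, hext]
    simp
  extremePoints_eq := by simpa using hext
  disjoint := by
    rw [Finset.disjoint_left]
    intro x hx hx'
    obtain ⟨i, -, rfl⟩ := Finset.mem_image.1 hx
    obtain ⟨j, -, hj⟩ := Finset.mem_image.1 hx'
    exact left_ne_right huv i j hj.symm
  isExposed_left := by simpa using hU
  isExposed_right := by simpa using hV
  two_le_card_left := by
    rw [Finset.card_image_of_injective _ (injective_left huv), Finset.card_univ, ZMod.card]
    omega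
  two_le_card_right := by
    rw [Finset.card_image_of_injective _ (injective_right huv), Finset.card_univ, ZMod.card]
    omega

/-! ### Antiprisms -/

section
variable {P : Set E3} {m : ℕ} {u v : ZMod m → E3}

/-- The triangle `u i, u (i + 1), v i` has an edge in the first base and only one vertex in the
second, so every `v i` is an apex. -/
theorem antiprism_lower [NeZero m] (hm : 3 ≤ m) (h : IsPolytope3 P)
    (huv : Function.Injective (Sum.elim u v)) (hext : P.extremePoints ℝ = range u ∪ range v)
    (hfac : facets P = {convexHull ℝ (range u), convexHull ℝ (range v)} ∪
          (range (fun i : ZMod m => convexHull ℝ {u i, u (i + 1), v i}) ∪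
            range (fun i : ZMod m => convexHull ℝ {v i, v (i + 1), u (i + 1)})))
    {T : Finset (Finset E3)} (hT : IsTriangulation (P.extremePoints ℝ) T) :
    3 * m - 5 ≤ T.card := by
  classical
  have hU : convexHull ℝ (range u) ∈ facets P := by rw [hfac]; simp
  have hV : convexHull ℝ (range v) ∈ facets P := by rw [hfac]; simp
  have hF : ∀ i, convexHull ℝ {u i, u (i + 1), v i} ∈ facets P := fun i => by rw [hfac]; simp
  have h2 := h.isTwoLayer hm huv hext hU.1 hV.1
  have hvA : ∀ i, v i ∈ P.extremePoints ℝ := fun i => hext ▸ Or.inr ⟨i, rfl⟩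
  have huA : ∀ i, u i ∈ P.extremePoints ℝ := fun i => hext ▸ Or.inl ⟨i, rfl⟩
  have hsub : Finset.univ.image v ⊆
      IsTwoLayer.apexes T (Finset.univ.image u) (Finset.univ.image v) := by
    intro w hw
    obtain ⟨i, -, rfl⟩ := Finset.mem_image.1 hw
    obtain ⟨w, hw, hwF⟩ := h2.exists_mem_apexes hT (hF i).1 (p := u i) (q := u (i + 1))
      (fun h => zmod_add_one_ne hm i (injective_left huv h.symm)) (by simp)
      (subset_convexHull ℝ _ (by simp)) (by simp) (subset_convexHull ℝ _ (by simp))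
      ⟨v i, by simp, subset_convexHull ℝ _ (by simp)⟩
    obtain ⟨t, -, ht⟩ := Finset.mem_biUnion.1 hw
    obtain ⟨j, -, rfl⟩ := Finset.mem_image.1 (Finset.mem_inter.1 ht).2
    rw [h.mem_convexHull_iff (by rintro x (rfl | rfl | rfl); exacts [huA _, huA _, hvA _])
      (hvA j)] at hwF
    rcases hwF with h | h | h
    · exact absurd h.symm (left_ne_right huv _ _)
    · exact absurd h.symm (left_ne_right huv _ _)
    · rwa [← h]
  have h3 := Finset.card_le_card hsub
  have h4 := h2.card_add_card_add_card_apexes_le hT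
  rw [Finset.card_image_of_injective _ (injective_left huv)] at h4
  rw [Finset.card_image_of_injective _ (injective_right huv)] at h3 h4
  rw [Finset.card_univ, ZMod.card] at h3 h4
  omega

theorem card_triple {α : Type*} [DecidableEq α] {a b c : α} (hab : a ≠ b) (hac : a ≠ c)
    (hbc : b ≠ c) : ({a, b, c} : Finset α).card = 3 :=
  Finset.card_eq_three.2 ⟨a, b, c, hab, hac, hbc, rfl⟩

theorem card_filter_ne [NeZero m] (hm : 3 ≤ m) :
    (Finset.univ.filter fun i : ZMod m => i ≠ 0 ∧ i + 1 ≠ 0).card + 2 ≤ m ∧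
      (Finset.univ.filter fun i : ZMod m => i + 1 ≠ 0).card + 1 ≤ m := by
  have h1 : (Finset.univ.filter fun i : ZMod m => i ≠ 0 ∧ i + 1 ≠ 0) ⊆
      Finset.univ \ {0, -1} := by
    intro i hi
    have := (Finset.mem_filter.1 hi).2
    rw [Ne, Ne, add_eq_zero_iff_eq_neg] at this
    simpa using this
  have h2 : (Finset.univ.filter fun i : ZMod m => i + 1 ≠ 0) ⊆ Finset.univ \ {-1} := by
    intro i hi
    have := (Finset.mem_filter.1 hi).2
    rw [Ne, add_eq_zero_iff_eq_neg] at this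
    simpa using this
  have h3 := Finset.card_le_card h1
  have h4 := Finset.card_le_card h2
  rw [Finset.card_sdiff_of_subset (Finset.subset_univ _), Finset.card_univ, ZMod.card] at h3 h4
  rw [Finset.card_singleton] at h4
  have h5 : ({0, -1} : Finset (ZMod m)).card = 2 := by
    rw [Finset.card_eq_two]
    exact ⟨0, -1, fun h => zmod_one_ne_zero hm (by simpa using h.symm), rfl⟩
  rw [h5] at h3
  omega

/-- Cone from `u 0`, fanning the second base from `v 0`: the facets missing `u 0` provide `m - 2`
and `m - 1` lateral triangles and `m - 2` triangles of the fan. -/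
theorem antiprism_upper [NeZero m] (hm : 3 ≤ m) (h : IsPolytope3 P)
    (huv : Function.Injective (Sum.elim u v)) (hext : P.extremePoints ℝ = range u ∪ range v)
    (hfac : facets P = {convexHull ℝ (range u), convexHull ℝ (range v)} ∪
          (range (fun i : ZMod m => convexHull ℝ {u i, u (i + 1), v i}) ∪
            range (fun i : ZMod m => convexHull ℝ {v i, v (i + 1), u (i + 1)}))) :
    ∃ T, IsTriangulation (P.extremePoints ℝ) T ∧ T.card ≤ 3 * m - 5 := by
  classical
  have hU : convexHull ℝ (range u) ∈ facets P := by rw [hfac]; simp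
  have hV : convexHull ℝ (range v) ∈ facets P := by rw [hfac]; simp
  have hF : ∀ i, convexHull ℝ {u i, u (i + 1), v i} ∈ facets P := fun i => by rw [hfac]; simp
  have hG : ∀ i, convexHull ℝ {v i, v (i + 1), u (i + 1)} ∈ facets P := fun i => by
    rw [hfac]; simp
  have hu := injective_left huv
  have hv := injective_right huv
  have huv' := left_ne_right huv
  have hvA : ∀ i, v i ∈ P.extremePoints ℝ := fun i => hext ▸ Or.inr ⟨i, rfl⟩
  have huA : ∀ i, u i ∈ P.extremePoints ℝ := fun i => hext ▸ Or.inl ⟨i, rfl⟩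
  have hVA : range v ⊆ P.extremePoints ℝ := hext ▸ subset_union_right
  have hUA : range u ⊆ P.extremePoints ℝ := hext ▸ subset_union_left
  have hFA : ∀ i, {u i, u (i + 1), v i} ⊆ P.extremePoints ℝ := fun i => by
    rintro x (rfl | rfl | rfl); exacts [huA _, huA _, hvA _]
  have hGA : ∀ i, {v i, v (i + 1), u (i + 1)} ⊆ P.extremePoints ℝ := fun i => by
    rintro x (rfl | rfl | rfl); exacts [hvA _, hvA _, huA _]
  have h01 := fun i => zmod_add_one_ne hm i
  have hGV : ∀ i, {v i, v (i + 1), u (i + 1)} ∩ range v = {v i, v (i + 1)} := by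
    intro i
    ext x
    constructor
    · rintro ⟨rfl | rfl | rfl, ⟨j, hj⟩⟩
      · simp
      · simp
      · exact absurd hj.symm (huv' _ _)
    · rintro (rfl | rfl) <;> simp
  have hGVc : ∀ i, convexHull ℝ (range v) ∩ convexHull ℝ {v i, v (i + 1), u (i + 1)} =
      convexHull ℝ {v i, v (i + 1)} := fun i => by
    rw [inter_comm, h.convexHull_inter (hGA i) hV.1, hGV]
  have hedge : ∀ i, IsExposed ℝ P (convexHull ℝ {v i, v (i + 1)}) := fun i => by
    rw [← hGVc]
    exact hV.1.inter (hG i).1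
  -- `u 0` lies on the triangles of the first kind with index `0` and `-1`, and of the second kind
  -- with index `-1` only. The indices in `S` also list the edges of the second base that miss `v
  -- 0`.
  let S : Finset (ZMod m) := Finset.univ.filter fun i => i ≠ 0 ∧ i + 1 ≠ 0
  let S' : Finset (ZMod m) := Finset.univ.filter fun i => i + 1 ≠ 0
  let B : Finset (Finset E3) := S.image (fun i => {u i, u (i + 1), v i}) ∪
    (S'.image (fun i => {v i, v (i + 1), u (i + 1)}) ∪
      S.image (fun i => {v 0, v i, v (i + 1)}))
  have hB : ∀ σ ∈ B, (∃ i, i ≠ 0 ∧ i + 1 ≠ 0 ∧ σ = {u i, u (i + 1), v i}) ∨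
      (∃ i, i + 1 ≠ 0 ∧ σ = {v i, v (i + 1), u (i + 1)}) ∨
      (∃ i, i ≠ 0 ∧ i + 1 ≠ 0 ∧ σ = {v 0, v i, v (i + 1)}) := by
    intro σ hσ
    rcases Finset.mem_union.1 hσ with hσ | hσ
    · obtain ⟨i, hi, rfl⟩ := Finset.mem_image.1 hσ
      have := (Finset.mem_filter.1 hi).2
      exact Or.inl ⟨i, this.1, this.2, rfl⟩
    · rcases Finset.mem_union.1 hσ with hσ | hσ
      · obtain ⟨i, hi, rfl⟩ := Finset.mem_image.1 hσ
        exact Or.inr (Or.inl ⟨i, (Finset.mem_filter.1 hi).2, rfl⟩)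
      · obtain ⟨i, hi, rfl⟩ := Finset.mem_image.1 hσ
        have := (Finset.mem_filter.1 hi).2
        exact Or.inr (Or.inr ⟨i, this.1, this.2, rfl⟩)
  have hB1 : ∀ i, i ≠ 0 → i + 1 ≠ 0 → {u i, u (i + 1), v i} ∈ B := fun i h1 h2 =>
    Finset.mem_union_left _ (Finset.mem_image_of_mem _ (Finset.mem_filter.2 ⟨Finset.mem_univ _,
      h1, h2⟩))
  have hB2 : ∀ i, i + 1 ≠ 0 → {v i, v (i + 1), u (i + 1)} ∈ B := fun i h1 =>
    Finset.mem_union_right _ (Finset.mem_union_left _ (Finset.mem_image_of_mem _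
      (Finset.mem_filter.2 ⟨Finset.mem_univ _, h1⟩)))
  have hB3 : ∀ i, i ≠ 0 → i + 1 ≠ 0 → {v 0, v i, v (i + 1)} ∈ B := fun i h1 h2 =>
    Finset.mem_union_right _ (Finset.mem_union_right _ (Finset.mem_image_of_mem _
      (Finset.mem_filter.2 ⟨Finset.mem_univ _, h1, h2⟩)))
  have h3 : ∀ σ ∈ B, σ.card = 3 := by
    intro σ hσ
    rcases hB σ hσ with ⟨i, h1, h2, rfl⟩ | ⟨i, h2, rfl⟩ | ⟨i, h1, h2, rfl⟩
    · exact card_triple (hu.ne (h01 i).symm) (huv' _ _) (huv' _ _)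
    · exact card_triple (hv.ne (h01 i).symm) (huv' _ _).symm (huv' _ _).symm
    · exact card_triple (hv.ne h1.symm) (hv.ne h2.symm) (hv.ne (h01 i).symm)
  have hBA : ∀ σ ∈ B, (σ : Set E3) ⊆ P.extremePoints ℝ := by
    intro σ hσ
    rcases hB σ hσ with ⟨i, h1, h2, rfl⟩ | ⟨i, h2, rfl⟩ | ⟨i, h1, h2, rfl⟩
    · simpa using hFA i
    · simpa using hGA i
    · intro x hx
      simp only [Finset.coe_insert, Finset.coe_singleton] at hx
      rcases hx with rfl | rfl | rfl <;> exact hvA _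
  have hPc : convexHull ℝ (P.extremePoints ℝ) = P := h.convexHull_extremePoints
  have huV : u 0 ∉ convexHull ℝ (range v) := by
    rw [h.mem_convexHull_iff hVA (huA 0)]
    rintro ⟨j, hj⟩
    exact huv' _ _ hj.symm
  have hv0 : ∀ i, i ≠ 0 → i + 1 ≠ 0 → v 0 ∉ ({v i, v (i + 1)} : Set E3) := by
    rintro i h1 h2 (h | h)
    · exact h1 (hv h).symm
    · exact h2 (hv h).symm
  have hpair : ∀ i, {v i, v (i + 1)} ⊆ P.extremePoints ℝ := fun i => by
    rintro x (rfl | rfl) <;> exact hvA _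
  have hexp : ∀ σ ∈ B, IsExposed ℝ P (convexHull ℝ (σ : Set E3)) ∨
      ∃ i, i ≠ 0 ∧ i + 1 ≠ 0 ∧ σ = {v 0, v i, v (i + 1)} := by
    intro σ hσ
    rcases hB σ hσ with ⟨i, h1, h2, rfl⟩ | ⟨i, h2, rfl⟩ | h
    · exact Or.inl (by simpa using (hF i).1)
    · exact Or.inl (by simpa using (hG i).1)
    · exact Or.inr h
  refine ⟨B.image (insert (u 0)), isTriangulation_cone (huA 0) B h3 ?_ hBA ?_ ?_ ?_, ?_⟩
  · intro σ hσ
    rcases hB σ hσ with ⟨i, h1, h2, rfl⟩ | ⟨i, h2, rfl⟩ | ⟨i, h1, h2, rfl⟩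
    · exact affineIndependent_of_mem_facets (h3 _ hσ) (by simpa using hF i)
    · exact affineIndependent_of_mem_facets (h3 _ hσ) (by simpa using hG i)
    · refine affineIndependent_of_isExposed (hedge i) (hvA 0).1 ?_ ?_ affineIndependent_pair
      · rw [h.mem_convexHull_iff (hpair i) (hvA 0)]
        exact hv0 i h1 h2
      · simpa using subset_convexHull ℝ {v i, v (i + 1)}
  · rw [hPc]
    intro σ hσ
    rcases hB σ hσ with ⟨i, h1, h2, rfl⟩ | ⟨i, h2, rfl⟩ | ⟨i, h1, h2, rfl⟩
    · refine ⟨_, (hF i).1, by simpa using subset_convexHull ℝ {u i, u (i + 1), v i}, ?_⟩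
      rw [h.mem_convexHull_iff (hFA i) (huA 0)]
      rintro (h | h | h)
      exacts [h1 (hu h).symm, h2 (hu h).symm, huv' _ _ h]
    · refine ⟨_, (hG i).1, by simpa using subset_convexHull ℝ {v i, v (i + 1), u (i + 1)}, ?_⟩
      rw [h.mem_convexHull_iff (hGA i) (huA 0)]
      rintro (h | h | h)
      exacts [huv' _ _ h, huv' _ _ h, h2 (hu h).symm]
    · refine ⟨_, hV.1, Subset.trans ?_ (subset_convexHull ℝ _), huV⟩
      intro x hx
      simp only [Finset.coe_insert, Finset.coe_singleton] at hx
      rcases hx with rfl | rfl | rfl <;> exact mem_range_self _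
  · intro σ hσ τ hτ
    rcases hexp τ hτ with hτe | ⟨j, hj1, hj2, rfl⟩
    · exact inter_subset_of_isExposed h.convex (hBA σ hσ) hτe
    rcases hexp σ hσ with hσe | ⟨i, hi1, hi2, rfl⟩
    · rw [inter_comm, inter_comm (σ : Set E3)]
      exact inter_subset_of_isExposed h.convex (hBA _ hτ) hσe
    simpa using h.star_inter_subset (hvA 0) (hpair i) (hpair j) (hedge i) (hedge j)
      (hv0 i hi1 hi2) (hv0 j hj1 hj2)
  · rw [hPc]
    intro x hx
    obtain ⟨F', hF', huF', y, ⟨-, hy⟩, hxy⟩ := h.exists_facet_segment (IsExposed.refl P)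
      (huA 0).1 (hvA 0).1 (huv' 0 0).symm hx
    rw [hfac] at hF'
    rcases hF' with (rfl | rfl) | ⟨i, rfl⟩ | ⟨i, rfl⟩
    · exact absurd (subset_convexHull ℝ _ (mem_range_self 0)) huF'
    -- A second ray, from `v 0` inside the base, ends on another facet missing `v 0`, hence on an
    -- edge of the base that misses `v 0`.
    · obtain ⟨F'', hF'', hvF'', z, ⟨hz, hz'⟩, hyz⟩ := h.exists_facet_segment hV.1
        (subset_convexHull ℝ _ (mem_range_self 0)) (subset_convexHull ℝ _ (mem_range_self 1))
        (hv.ne (zmod_one_ne_zero hm)) hy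
      have key : ∃ j, j ≠ 0 ∧ j + 1 ≠ 0 ∧ z ∈ convexHull ℝ {v j, v (j + 1)} := by
        rw [hfac] at hF''
        rcases hF'' with (rfl | rfl) | ⟨i, rfl⟩ | ⟨i, rfl⟩
        · have h5 : z ∈ convexHull ℝ (range v ∩ range u) :=
            h.convexHull_inter hVA hU.1 ▸ ⟨hz, hz'⟩
          have h6 : range v ∩ range u = ∅ := by
            ext x
            simp only [mem_inter_iff, mem_range, mem_empty_iff_false, iff_false, not_and]
            rintro ⟨a, rfl⟩ ⟨b, hb⟩
            exact huv' _ _ hb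
          rw [h6, convexHull_empty] at h5
          exact absurd h5 (notMem_empty z)
        · exact absurd (subset_convexHull ℝ _ (mem_range_self 0)) hvF''
        · have h5 : z ∈ convexHull ℝ ({u i, u (i + 1), v i} ∩ range v) :=
            h.convexHull_inter (hFA i) hV.1 ▸ ⟨hz', hz⟩
          have h6 : {u i, u (i + 1), v i} ∩ range v ⊆ {v i} := by
            rintro x ⟨rfl | rfl | rfl, ⟨j, hj⟩⟩
            · exact absurd hj.symm (huv' _ _)
            · exact absurd hj.symm (huv' _ _)
            · rfl
          have h7 := convexHull_mono (𝕜 := ℝ) h6 h5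
          rw [convexHull_singleton] at h7
          rw [mem_singleton_iff.1 h7]
          have hi : i ≠ 0 := by
            rintro rfl
            exact hvF'' (subset_convexHull ℝ _ (by simp))
          obtain ⟨j, hj, hj1, hij⟩ := zmod_exists_edge hm hi
          refine ⟨j, hj, hj1, subset_convexHull ℝ _ ?_⟩
          rcases hij with rfl | rfl <;> simp
        · refine ⟨i, ?_, ?_, hGVc i ▸ ⟨hz, hz'⟩⟩
          · rintro rfl
            exact hvF'' (subset_convexHull ℝ _ (by simp))
          · intro hi
            beta_reduce at hvF''; rw [hi] at hvF''
            exact hvF'' (subset_convexHull ℝ _ (by simp))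
      obtain ⟨j, hj, hj1, hzj⟩ := key
      refine ⟨_, hB3 j hj hj1, y, ?_, hxy⟩
      simp only [Finset.coe_insert, Finset.coe_singleton]
      exact (convex_convexHull ℝ _).segment_subset (subset_convexHull ℝ _ (mem_insert _ _))
        (convexHull_mono (subset_insert _ _) hzj) hyz
    · refine ⟨_, hB1 i ?_ ?_, y, by simpa using hy, hxy⟩
      · rintro rfl
        exact huF' (subset_convexHull ℝ _ (by simp))
      · intro hi
        beta_reduce at huF'; rw [hi] at huF'
        exact huF' (subset_convexHull ℝ _ (by simp))
    · refine ⟨_, hB2 i ?_, y, by simpa using hy, hxy⟩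
      intro hi
      beta_reduce at huF'; rw [hi] at huF'
      exact huF' (subset_convexHull ℝ _ (by simp))
  · have h4 := card_filter_ne hm
    have h5 : B.card ≤ S.card + (S'.card + S.card) := (Finset.card_union_le _ _).trans
      (add_le_add Finset.card_image_le ((Finset.card_union_le _ _).trans
        (add_le_add Finset.card_image_le Finset.card_image_le)))
    have h6 : (B.image (insert (u 0))).card ≤ B.card := Finset.card_image_le
    have h7 : S.card + 2 ≤ m := h4.1
    have h8 : S'.card + 1 ≤ m := h4.2
    omega

end

/-! ### Cutting off a simple vertex by two flips -/

/-- The segment from a simple vertex `a` with neighbours `b`, `c`, `d` to another vertex crosses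
the triangle spanned by the neighbours. -/
theorem exists_crossing [DecidableEq E3] {P F₁ F₂ F₃ : Set E3} (hP : Convex ℝ P)
    (h₁ : IsExposed ℝ P F₁) (h₂ : IsExposed ℝ P F₂) (h₃ : IsExposed ℝ P F₃) {a b c d x : E3}
    (hdP : d ∈ P)
    (ha₁ : a ∈ F₁) (hb₁ : b ∈ F₁) (hc₁ : c ∈ F₁) (hd₁ : d ∉ F₁)
    (ha₂ : a ∈ F₂) (hb₂ : b ∈ F₂) (hd₂ : d ∈ F₂) (hc₂ : c ∉ F₂)
    (ha₃ : a ∈ F₃) (hc₃ : c ∈ F₃) (hd₃ : d ∈ F₃) (hb₃ : b ∉ F₃)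
    (hcard : ({a, b, c, d} : Finset E3).card = 4)
    (hind : AffineIndependent ℝ (fun x : ({a, b, c, d} : Finset E3) => (x : E3)))
    (hx : x ∈ P.extremePoints ℝ) (hxabcd : x ∉ ({a, b, c, d} : Set E3)) (hx₂ : x ∉ F₂)
    (hx₃ : x ∉ F₃) :
    ∃ (β γ δ : ℝ) (z : E3), 0 < β ∧ 0 < γ ∧ 0 ≤ δ ∧ (x ∉ F₁ → 0 < δ) ∧ (x ∈ F₁ → δ = 0) ∧
      β + γ + δ = 1 ∧ z = β • b + γ • c + δ • d ∧ z ∈ segment ℝ a x ∧ z ≠ x := by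
  have hsub : ({a, b, c, d} : Set E3) ⊆ P := by
    rintro y (rfl | rfl | rfl | rfl)
    exacts [h₁.subset ha₁, h₁.subset hb₁, h₁.subset hc₁, hdP]
  -- Affine independence makes the three edge directions at `a` span the space.
  have hD : x - a ∈ Submodule.span ℝ {b - a, c - a, d - a} := by
    by_contra hD
    have hlt : Submodule.span ℝ {b - a, c - a, d - a} < ⊤ :=
      lt_top_iff_ne_top.2 fun h => hD (h ▸ Submodule.mem_top)
    have hlt' := Submodule.finrank_lt hlt.ne
    rw [finrank_euclideanSpace_fin] at hlt'
    obtain ⟨g, hg, hk⟩ := exists_functional_of_finrank_lt hlt'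
    have hb : g b = g a := by
      have := hk (b - a) (Submodule.subset_span (by simp))
      rwa [map_sub, sub_eq_zero] at this
    have hc : g c = g a := by
      have := hk (c - a) (Submodule.subset_span (by simp))
      rwa [map_sub, sub_eq_zero] at this
    have hd : g d = g a := by
      have := hk (d - a) (Submodule.subset_span (by simp))
      rwa [map_sub, sub_eq_zero] at this
    have := card_le_three_of_affineIndependent hg (c := g a) hind (by simp [hb, hc, hd])
    omega
  obtain ⟨p, q, r, hpqr⟩ := Submodule.mem_span_triple.1 hD
  have hxeq : x = a + (p • (b - a) + q • (c - a) + r • (d - a)) := by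
    rw [hpqr, add_sub_cancel]
  have hxP := hx.1
  -- A functional exposing a face through `a` and two of the neighbours sees only the coefficient of
  -- the third direction, so its sign records whether `x` is on that face.
  have coef : ∀ {F : Set E3} {s : ℝ} {y : E3}, IsExposed ℝ P F → a ∈ F → y ∈ P → y ∉ F →
      (∀ f : StrongDual ℝ E3, (∀ z ∈ F, f z = f a) → f x - f a = s * (f y - f a)) →
      0 ≤ s ∧ (x ∉ F → 0 < s) ∧ (x ∈ F → s = 0) := by
    intro F s y hF haF hy hyF hs
    obtain ⟨f, k, hf, rfl⟩ := isExposed_iff.1 hF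
    have hfa : f a = k := haF.2
    have hs := hs f fun z hz => hz.2.trans hfa.symm
    have hy' : f y < f a := (hfa ▸ hf y hy).lt_of_ne fun h => hyF ⟨hy, h.trans hfa⟩
    have hx' : f x ≤ f a := hfa ▸ hf x hxP
    refine ⟨?_, fun h => ?_, fun h => ?_⟩
    · by_contra hc; push Not at hc; nlinarith
    · have hx'' : f x < f a := hx'.lt_of_ne fun h' => h ⟨hxP, h'.trans hfa⟩
      by_contra hc; push Not at hc; nlinarith
    · have : f x = f a := h.2.trans hfa.symm
      rw [this, sub_self, eq_comm, mul_eq_zero] at hs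
      exact hs.resolve_right (by linarith)
  have hp := (coef (s := p) h₃ ha₃ (h₁.subset hb₁) hb₃ fun f hf => by
    rw [hxeq]; simp [hf c hc₃, hf d hd₃]).2.1 hx₃
  have hq := (coef (s := q) h₂ ha₂ (h₁.subset hc₁) hc₂ fun f hf => by
    rw [hxeq]; simp [hf b hb₂, hf d hd₂]).2.1 hx₂
  have hr := coef (s := r) h₁ ha₁ hdP hd₁ fun f hf => by
    rw [hxeq]; simp [hf b hb₁, hf c hc₁]
  -- Otherwise `x` would lie in the tetrahedron `a b c d` without being one of its vertices. The
  -- crossing point is then `x` scaled towards `a` by `(p + q + r)⁻¹`.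
  have hσ : 1 < p + q + r := by
    by_contra! hσ
    have h1 : ∀ y ∈ ({a, b, c, d} : Set E3), y ∈ convexHull ℝ ({a, b, c, d} : Set E3) :=
      fun y hy => subset_convexHull ℝ _ hy
    have h2 := combination_mem (convex_convexHull ℝ ({a, b, c, d} : Set E3)) (h1 a (by simp))
      (h1 b (by simp)) (h1 c (by simp)) (h1 d (by simp)) (sub_nonneg.2 hσ) hp.le hq.le hr.1
      (by ring)
    have h3 : x = (1 - (p + q + r)) • a + p • b + q • c + r • d := by
      rw [hxeq]; module
    exact hxabcd (mem_of_mem_extremePoints_of_mem_convexHull hx hsub hP (h3 ▸ h2))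
  have hσ0 : p + q + r ≠ 0 := by linarith
  have hr0 := hr.1
  refine ⟨p / (p + q + r), q / (p + q + r), r / (p + q + r), a + (p + q + r)⁻¹ • (x - a),
    by positivity, by positivity, by positivity, fun h => ?_, fun h => ?_, ?_, ?_, ?_, ?_⟩
  · have := hr.2.1 h
    positivity
  · rw [hr.2.2 h, zero_div]
  · field_simp
  · rw [← hpqr]
    have : a = ((p + q + r)⁻¹ * (p + q + r)) • a := by rw [inv_mul_cancel₀ hσ0, one_smul]
    nth_rewrite 1 [this]
    simp only [div_eq_inv_mul]
    module
  · exact mem_segment_iff_exists.2 ⟨_, ⟨by positivity, inv_le_one_of_one_le₀ hσ.le⟩, rfl⟩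
  · intro h
    have h1 : ((p + q + r)⁻¹ - 1) • (x - a) = 0 := by
      rw [sub_smul, one_smul, sub_eq_zero]
      rw [← sub_eq_iff_eq_add'.2 h.symm]
    rcases smul_eq_zero.1 h1 with h2 | h2
    · rw [sub_eq_zero, inv_eq_one] at h2
      linarith
    · exact hxabcd (by simp [sub_eq_zero.1 h2])

/-- Two flips that make the edges from a simple vertex `a` to `e` and `w` disappear. -/
theorem exists_double_flip [DecidableEq E3] {A : Set E3} {T : Finset (Finset E3)}
    (hT : IsTriangulation A T) {a b c d e w z₁ z₂ : E3} {β₁ γ₁ β₂ γ₂ δ₂ : ℝ}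
    (hnd : [a, b, c, d, e, w].Nodup)
    (hstar : ∀ t, (t ∈ T ∧ a ∈ t) ↔ t = {a, e, b, w} ∨ t = {a, e, c, w} ∨ t = {a, w, b, d} ∨
      t = {a, w, c, d})
    (hβ₁ : 0 < β₁) (hγ₁ : 0 < γ₁) (h₁ : β₁ + γ₁ = 1) (hz₁ : z₁ = β₁ • b + γ₁ • c)
    (hz₁s : z₁ ∈ segment ℝ a e) (hz₁e : z₁ ≠ e)
    (hβ₂ : 0 < β₂) (hγ₂ : 0 < γ₂) (hδ₂ : 0 < δ₂) (h₂ : β₂ + γ₂ + δ₂ = 1)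
    (hz₂ : z₂ = β₂ • b + γ₂ • c + δ₂ • d) (hz₂s : z₂ ∈ segment ℝ a w) (hz₂w : z₂ ≠ w)
    (hindw : AffineIndependent ℝ (fun x : ({a, b, c, w} : Finset E3) => (x : E3)))
    (hindd : AffineIndependent ℝ (fun x : ({a, b, c, d} : Finset E3) => (x : E3))) :
    ∃ T', IsTriangulation A T' ∧ T'.card + 1 ≤ T.card ∧
      ∀ x, x ∉ ({a, b, c, d, e, w} : Finset E3) → ∀ t, x ∈ t → (t ∈ T' ↔ t ∈ T) := by
  simp only [List.nodup_cons, List.mem_cons, List.not_mem_nil, or_false, not_or,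
    List.nodup_nil, and_true, not_false_eq_true] at hnd
  obtain ⟨⟨hab, hac, had, hae, haw⟩, ⟨hbc, hbd, hbe, hbw⟩, ⟨hcd, hce, hcw⟩, ⟨hde, hdw⟩, hew⟩ := hnd
  have hw1 : ({a, b, c, w} : Finset E3).card = 4 :=
    Finset.card_eq_four.2 ⟨a, b, c, w, hab, hac, haw, hbc, hbw, hcw, rfl⟩
  have hd1 : ({a, b, c, d} : Finset E3).card = 4 :=
    Finset.card_eq_four.2 ⟨a, b, c, d, hab, hac, had, hbc, hbd, hcd, rfl⟩
  have hmem : ∀ t ∈ T, a ∈ t → t = {a, e, b, w} ∨ t = {a, e, c, w} ∨ t = {a, w, b, d} ∨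
      t = {a, w, c, d} := fun t ht hat => (hstar t).1 ⟨ht, hat⟩
  have hs1 : {a, e, b, w} ∈ T := ((hstar _).2 (Or.inl rfl)).1
  have hs2 : {a, e, c, w} ∈ T := ((hstar _).2 (Or.inr (Or.inl rfl))).1
  have hs3 : {a, w, b, d} ∈ T := ((hstar _).2 (Or.inr (Or.inr (Or.inl rfl)))).1
  have hs4 : {a, w, c, d} ∈ T := ((hstar _).2 (Or.inr (Or.inr (Or.inr rfl)))).1
  have e5 : ({a, w, b, c} : Finset E3) = {a, b, c, w} := by
    rw [Finset.insert_comm w b, Finset.pair_comm w c]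
  -- The degenerate flip, with `δ = 0`: the edge `a e` crosses the segment `b c`. It creates `{a, b,
  -- c, w}`, the third tetrahedron around `a w` needed for the next flip.
  have hT1 : IsTriangulation A (flip T a e b c w) := by
    refine isTriangulation_flip hT hβ₁ hγ₁ le_rfl (by rw [add_zero, h₁])
      (by rw [zero_smul, add_zero, hz₁]) hz₁s hz₁e hw1 hindw ?_ hs1 hs2
      (fun h => absurd h (lt_irrefl _))
    intro t ht hat het
    rcases hmem t ht hat with rfl | rfl | rfl | rfl
    · simp [Finset.insert_subset_iff]
    · simp [Finset.insert_subset_iff]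
    · simp [hew, Ne.symm hde, Ne.symm hbe, Ne.symm hae] at het
    · simp [hew, Ne.symm hde, Ne.symm hce, Ne.symm hae] at het
  have hT1mem : ∀ t, t ∈ flip T a e b c w ↔ (t ∈ T ∧ ¬ (a ∈ t ∧ e ∈ t)) ∨ t = {a, b, c, w} ∨
      t = {e, b, c, w} := by
    intro t
    simp only [flip, Finset.mem_union, Finset.mem_filter, Finset.mem_insert,
      Finset.mem_singleton]
  have he3 : e ∉ ({a, w, b, d} : Finset E3) := by
    simp [hew, Ne.symm hde, Ne.symm hbe, Ne.symm hae]
  have he4 : e ∉ ({a, w, c, d} : Finset E3) := by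
    simp [hew, Ne.symm hde, Ne.symm hce, Ne.symm hae]
  have hs3' : {a, w, b, d} ∈ flip T a e b c w := (hT1mem _).2 (Or.inl ⟨hs3, fun h => he3 h.2⟩)
  have hs4' : {a, w, c, d} ∈ flip T a e b c w := (hT1mem _).2 (Or.inl ⟨hs4, fun h => he4 h.2⟩)
  have hs5' : {a, b, c, w} ∈ flip T a e b c w := (hT1mem _).2 (Or.inr (Or.inl rfl))
  have hT2 : IsTriangulation A (flip (flip T a e b c w) a w b c d) := by
    refine isTriangulation_flip hT1 hβ₂ hγ₂ hδ₂.le h₂ hz₂ hz₂s hz₂w hd1 hindd ?_ hs3'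
      hs4' (fun _ => by rwa [e5])
    intro t ht hat hwt
    rcases (hT1mem t).1 ht with ⟨ht, het⟩ | rfl | rfl
    · rcases hmem t ht hat with rfl | rfl | rfl | rfl
      · exact absurd ⟨by simp, by simp⟩ het
      · exact absurd ⟨by simp, by simp⟩ het
      · simp [Finset.insert_subset_iff]
      · simp [Finset.insert_subset_iff]
    · simp [Finset.insert_subset_iff]
    · simp [hae, hab, hac, haw] at hat
  refine ⟨_, hT2, ?_, ?_⟩
  -- The first flip removes at least two tetrahedra and the second at least three, while each adds
  -- at most two.
  · have hc1 := card_flip_le T a e b c w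
    have hc2 := card_flip_le (flip T a e b c w) a w b c d
    have hd2 : 2 ≤ (T.filter fun t => a ∈ t ∧ e ∈ t).card := by
      have hsub : ({{a, e, b, w}, {a, e, c, w}} : Finset (Finset E3)) ⊆
          T.filter fun t => a ∈ t ∧ e ∈ t := by
        intro t ht
        rcases Finset.mem_insert.1 ht with rfl | ht
        · exact Finset.mem_filter.2 ⟨hs1, by simp, by simp⟩
        · rw [Finset.mem_singleton] at ht
          subst ht
          exact Finset.mem_filter.2 ⟨hs2, by simp, by simp⟩
      refine le_trans (Finset.card_pair ?_).ge (Finset.card_le_card hsub)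
      intro h
      have : b ∈ ({a, e, c, w} : Finset E3) := h ▸ (by simp)
      simp [hbw, hbe, hbc, Ne.symm hab] at this
    have hd3 : 3 ≤ ((flip T a e b c w).filter fun t => a ∈ t ∧ w ∈ t).card := by
      have hsub : ({{a, w, b, d}, {a, w, c, d}, {a, b, c, w}} : Finset (Finset E3)) ⊆
          (flip T a e b c w).filter fun t => a ∈ t ∧ w ∈ t := by
        intro t ht
        simp only [Finset.mem_insert, Finset.mem_singleton] at ht
        rcases ht with rfl | rfl | rfl
        · exact Finset.mem_filter.2 ⟨hs3', by simp, by simp⟩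
        · exact Finset.mem_filter.2 ⟨hs4', by simp, by simp⟩
        · exact Finset.mem_filter.2 ⟨hs5', by simp, by simp⟩
      refine le_trans (card_triple ?_ ?_ ?_).ge (Finset.card_le_card hsub)
      · intro h
        have : b ∈ ({a, w, c, d} : Finset E3) := h ▸ (by simp)
        simp [hbw, hbd, hbc, Ne.symm hab] at this
      · intro h
        have : c ∈ ({a, w, b, d} : Finset E3) := h ▸ (by simp)
        simp [hcw, hcd, Ne.symm hbc, Ne.symm hac] at this
      · intro h
        have : b ∈ ({a, w, c, d} : Finset E3) := h ▸ (by simp)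
        simp [hbw, hbd, hbc, Ne.symm hab] at this
    omega
  · intro x hx t hxt
    have hne : ∀ y ∈ ({a, b, c, d, e, w} : Finset E3), y ≠ x := fun y hy h => hx (h ▸ hy)
    have hnot : ∀ s : Finset E3, s ⊆ {a, b, c, d, e, w} → t ≠ s := fun s hs h =>
      hx (hs (h ▸ hxt))
    have hn : ∀ {p q r s : E3}, p ∈ ({a, b, c, d, e, w} : Finset E3) →
        q ∈ ({a, b, c, d, e, w} : Finset E3) → r ∈ ({a, b, c, d, e, w} : Finset E3) →
        s ∈ ({a, b, c, d, e, w} : Finset E3) → t ≠ {p, q, r, s} := by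
      intro p q r s hp hq hr hs
      refine hnot _ ?_
      intro y hy
      simp only [Finset.mem_insert, Finset.mem_singleton] at hy
      rcases hy with rfl | rfl | rfl | rfl <;> assumption
    have hat : t ∈ T → a ∉ t := by
      intro ht hat
      rcases hmem t ht hat with h | h | h | h
      all_goals exact hn (by simp) (by simp) (by simp) (by simp) h
    have m1 : t ≠ {a, b, c, w} := hn (by simp) (by simp) (by simp) (by simp)
    have m2 : t ≠ {e, b, c, w} := hn (by simp) (by simp) (by simp) (by simp)
    have m3 : t ≠ {a, b, c, d} := hn (by simp) (by simp) (by simp) (by simp)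
    have m4 : t ≠ {w, b, c, d} := hn (by simp) (by simp) (by simp) (by simp)
    have h5 : t ∈ flip (flip T a e b c w) a w b c d ↔
        (t ∈ flip T a e b c w ∧ ¬ (a ∈ t ∧ w ∈ t)) ∨ t = {a, b, c, d} ∨ t = {w, b, c, d} := by
      simp only [flip, Finset.mem_union, Finset.mem_filter, Finset.mem_insert,
        Finset.mem_singleton]
    rw [h5, hT1mem]
    constructor
    · rintro (⟨⟨h, -⟩ | h | h, -⟩ | h | h)
      exacts [h, absurd h m1, absurd h m2, absurd h m3, absurd h m4]
    · exact fun ht => Or.inl ⟨Or.inl ⟨ht, fun h => hat ht h.1⟩, fun h => hat ht h.1⟩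

/-! ### Coning starred facets -/

/-- Coning starred facets. -/
theorem isTriangulation_stars [DecidableEq E3] {P : Set E3} (h : IsPolytope3 P) {w : E3}
    (hw : w ∈ P.extremePoints ℝ) (K : Finset ℕ) (X : ℕ → Finset E3) (p : ℕ → E3)
    (C : ℕ → Finset (Finset E3))
    (hX : ∀ k ∈ K, (X k : Set E3) ⊆ P.extremePoints ℝ)
    (hXe : ∀ k ∈ K, IsExposed ℝ P (convexHull ℝ (X k : Set E3)))
    (hwX : ∀ k ∈ K, w ∉ X k) (hp : ∀ k ∈ K, p k ∈ X k)
    (hC2 : ∀ k ∈ K, ∀ σ ∈ C k, σ.card = 2) (hCX : ∀ k ∈ K, ∀ σ ∈ C k, σ ⊆ X k)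
    (hpC : ∀ k ∈ K, ∀ σ ∈ C k, p k ∉ σ)
    (hCe : ∀ k ∈ K, ∀ σ ∈ C k, IsExposed ℝ P (convexHull ℝ (σ : Set E3)))
    (hXX : ∀ k ∈ K, ∀ l ∈ K, k ≠ l → ∃ a b, X k ∩ X l ⊆ {a, b})
    (hcov : ∀ F ∈ facets P, w ∉ F → ∃ k ∈ K, F = convexHull ℝ (X k : Set E3))
    (hcov' : ∀ k ∈ K, ∀ F ∈ facets P, p k ∉ F → ∃ σ ∈ C k, ∀ x ∈ X k, x ∈ F → x ∈ σ) :
    IsTriangulation (P.extremePoints ℝ)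
      ((K.biUnion fun k => (C k).image (insert (p k))).image (insert w)) := by
  have hmem : ∀ τ ∈ K.biUnion (fun k => (C k).image (insert (p k))),
      ∃ k ∈ K, ∃ σ ∈ C k, τ = insert (p k) σ := by
    intro τ hτ
    obtain ⟨k, hk, hτ⟩ := Finset.mem_biUnion.1 hτ
    obtain ⟨σ, hσ, rfl⟩ := Finset.mem_image.1 hτ
    exact ⟨k, hk, σ, hσ, rfl⟩
  have hsubX : ∀ k ∈ K, ∀ σ ∈ C k, ((insert (p k) σ : Finset E3) : Set E3) ⊆ X k :=
    fun k hk σ hσ => Finset.coe_subset.2 (Finset.insert_subset (hp k hk) (hCX k hk σ hσ))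
  have hσA : ∀ k ∈ K, ∀ σ ∈ C k, (σ : Set E3) ⊆ P.extremePoints ℝ := fun k hk σ hσ =>
    (Finset.coe_subset.2 (hCX k hk σ hσ)).trans (hX k hk)
  have hpe : ∀ k ∈ K, ∀ σ ∈ C k, p k ∉ convexHull ℝ (σ : Set E3) := fun k hk σ hσ hpσ =>
    hpC k hk σ hσ ((h.mem_convexHull_iff (hσA k hk σ hσ) (hX k hk (hp k hk))).1 hpσ)
  have hwe : ∀ k ∈ K, w ∉ convexHull ℝ (X k : Set E3) := fun k hk hw' =>
    hwX k hk ((h.mem_convexHull_iff (hX k hk) hw).1 hw')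
  have hPc := h.convexHull_extremePoints
  refine isTriangulation_cone hw _ ?_ ?_ ?_ ?_ ?_ ?_
  · intro τ hτ
    obtain ⟨k, hk, σ, hσ, rfl⟩ := hmem τ hτ
    rw [Finset.card_insert_of_notMem (hpC k hk σ hσ), hC2 k hk σ hσ]
  · intro τ hτ
    obtain ⟨k, hk, σ, hσ, rfl⟩ := hmem τ hτ
    refine affineIndependent_of_isExposed (hCe k hk σ hσ) (hX k hk (hp k hk)).1 (hpe k hk σ hσ)
      (subset_convexHull ℝ _) ?_
    obtain ⟨a, b, -, rfl⟩ := Finset.card_eq_two.1 (hC2 k hk σ hσ)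
    exact affineIndependent_pair
  · intro τ hτ
    obtain ⟨k, hk, σ, hσ, rfl⟩ := hmem τ hτ
    exact (hsubX k hk σ hσ).trans (hX k hk)
  · rw [hPc]
    intro τ hτ
    obtain ⟨k, hk, σ, hσ, rfl⟩ := hmem τ hτ
    exact ⟨_, hXe k hk, (hsubX k hk σ hσ).trans (subset_convexHull ℝ _), hwe k hk⟩
  · intro τ hτ τ' hτ'
    obtain ⟨k, hk, σ, hσ, rfl⟩ := hmem τ hτ
    obtain ⟨l, hl, σ', hσ', rfl⟩ := hmem τ' hτ'
    by_cases hkl : k = l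
    · subst hkl
      simpa using h.star_inter_subset (hX k hk (hp k hk)) (hσA k hk σ hσ) (hσA k hk σ' hσ')
        (hCe k hk σ hσ) (hCe k hk σ' hσ') (hpC k hk σ hσ) (hpC k hk σ' hσ')
    -- Distinct facets share at most two of the listed vertices, and two points are always in
    -- general position.
    · obtain ⟨a, b, hab⟩ := hXX k hk l hl hkl
      refine inter_subset_of_affineIndependent h.convex (hXe k hk) (hXe l hl)
        ((hsubX k hk σ hσ).trans (subset_convexHull ℝ _))
        ((hsubX l hl σ' hσ').trans (subset_convexHull ℝ _)) (affineIndependent_pair (a := a)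
        (b := b)) ?_ ?_
      · rintro x ⟨hx, hx'⟩
        have hxk := hsubX k hk σ hσ hx
        exact hab (Finset.mem_inter.2 ⟨hxk, (h.mem_convexHull_iff (hX l hl) (hX k hk hxk)).1 hx'⟩)
      · rintro x ⟨hx, hx'⟩
        have hxl := hsubX l hl σ' hσ' hx
        exact hab (Finset.mem_inter.2 ⟨(h.mem_convexHull_iff (hX k hk) (hX l hl hxl)).1 hx', hxl⟩)
  · rw [hPc]
    intro x hx
    have hK : ∃ q ∈ P, q ≠ w := by
      by_contra! hc
      have h1 := h.2.mono (interior_mono (show P ⊆ {w} from hc))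
      simp at h1
    obtain ⟨q, hq, hqw⟩ := hK
    obtain ⟨F, hF, hwF, y, ⟨-, hy⟩, hxy⟩ := h.exists_facet_segment (IsExposed.refl P) hw.1 hq hqw
      hx
    obtain ⟨k, hk, rfl⟩ := hcov F hF hwF
    -- At the centre of the star there is no ray to follow; any one of its triangles contains it.
    by_cases hyp : y = p k
    · obtain ⟨q, hq, hqp⟩ : ∃ q ∈ convexHull ℝ (X k : Set E3), q ≠ p k := by
        by_contra! hc
        have h2 := hF.2
        have : convexHull ℝ (X k : Set E3) = {p k} := Subset.antisymm hc
          (singleton_subset_iff.2 (subset_convexHull ℝ _ (hp k hk)))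
        rw [this, vectorSpan_singleton, finrank_bot] at h2
        omega
      obtain ⟨F', hF', hpF', z, ⟨hz, hz'⟩, hyz⟩ := h.exists_facet_segment (hXe k hk)
        (subset_convexHull ℝ _ (hp k hk)) hq hqp hy
      obtain ⟨σ, hσ, -⟩ := hcov' k hk F' hF' hpF'
      refine ⟨insert (p k) σ, Finset.mem_biUnion.2 ⟨k, hk, Finset.mem_image_of_mem _ hσ⟩, y, ?_,
        hxy⟩
      rw [hyp]
      exact subset_convexHull ℝ _ (Finset.mem_insert_self _ _)
    · obtain ⟨F', hF', hpF', z, ⟨hz, hz'⟩, hyz⟩ := h.exists_facet_segment (hXe k hk)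
        (subset_convexHull ℝ _ (hp k hk)) hy hyp hy
      obtain ⟨σ, hσ, hσF⟩ := hcov' k hk F' hF' hpF'
      refine ⟨insert (p k) σ, Finset.mem_biUnion.2 ⟨k, hk, Finset.mem_image_of_mem _ hσ⟩, y, ?_,
        hxy⟩
      have hzσ : z ∈ convexHull ℝ ((X k : Set E3) ∩ F') :=
        hF'.1.inter_convexHull ((hX k hk).trans extremePoints_subset) h.convex ▸ ⟨hz, hz'⟩
      have hzσ' : z ∈ convexHull ℝ (σ : Set E3) :=
        convexHull_mono (fun x hx => hσF x hx.1 hx.2) hzσ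
      rw [Finset.coe_insert]
      exact (convex_convexHull ℝ _).segment_subset (subset_convexHull ℝ _ (mem_insert _ _))
        (convexHull_mono (subset_insert _ _) hzσ') hyz

/-! ### Prisms: vertices, facets and the lower bound -/

/-- A prism, described by its vertices and facets. -/
structure PrismData (m : ℕ) (P : Set E3) (u v : ℕ → E3) : Prop where
  polytope : IsPolytope3 P
  inj_left : ∀ i < m, ∀ j < m, u i = u j → i = j
  inj_right : ∀ i < m, ∀ j < m, v i = v j → i = j
  left_ne_right : ∀ i j, u i ≠ v j
  left_period : u m = u 0
  right_period : v m = v 0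
  extremePoints_eq : P.extremePoints ℝ = u '' Iio m ∪ v '' Iio m
  facets_eq : facets P = {convexHull ℝ (u '' Iio m), convexHull ℝ (v '' Iio m)} ∪
    (fun i => convexHull ℝ {u i, u (i + 1), v i, v (i + 1)}) '' Iio m

namespace PrismData
variable {m : ℕ} {P : Set E3} {u v : ℕ → E3}

theorem left_mem (h : PrismData m P u v) (hm : 3 ≤ m) {i : ℕ} (hi : i ≤ m) :
    u i ∈ P.extremePoints ℝ := by
  rw [h.extremePoints_eq]
  rcases hi.lt_or_eq with hi | rfl
  · exact Or.inl ⟨i, hi, rfl⟩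
  · exact Or.inl ⟨0, by simp only [mem_Iio]; omega, h.left_period.symm⟩

theorem right_mem (h : PrismData m P u v) (hm : 3 ≤ m) {i : ℕ} (hi : i ≤ m) :
    v i ∈ P.extremePoints ℝ := by
  rw [h.extremePoints_eq]
  rcases hi.lt_or_eq with hi | rfl
  · exact Or.inr ⟨i, hi, rfl⟩
  · exact Or.inr ⟨0, by simp only [mem_Iio]; omega, h.right_period.symm⟩

theorem top_mem_facets (h : PrismData m P u v) : convexHull ℝ (u '' Iio m) ∈ facets P := by
  rw [h.facets_eq]; simp

theorem bot_mem_facets (h : PrismData m P u v) : convexHull ℝ (v '' Iio m) ∈ facets P := by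
  rw [h.facets_eq]; simp

theorem side_mem_facets (h : PrismData m P u v) {i : ℕ} (hi : i < m) :
    convexHull ℝ {u i, u (i + 1), v i, v (i + 1)} ∈ facets P := by
  rw [h.facets_eq]
  exact Or.inr ⟨i, hi, rfl⟩

theorem side_subset (h : PrismData m P u v) (hm : 3 ≤ m) {i : ℕ} (hi : i < m) :
    {u i, u (i + 1), v i, v (i + 1)} ⊆ P.extremePoints ℝ := by
  rintro x (rfl | rfl | rfl | rfl)
  exacts [h.left_mem hm hi.le, h.left_mem hm hi, h.right_mem hm hi.le, h.right_mem hm hi]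

theorem top_subset (h : PrismData m P u v) : u '' Iio m ⊆ P.extremePoints ℝ := by
  rw [h.extremePoints_eq]; exact subset_union_left

theorem bot_subset (h : PrismData m P u v) : v '' Iio m ⊆ P.extremePoints ℝ := by
  rw [h.extremePoints_eq]; exact subset_union_right

theorem left_notMem_bot (h : PrismData m P u v) (hm : 3 ≤ m) {i : ℕ} (hi : i ≤ m) :
    u i ∉ convexHull ℝ (v '' Iio m) := by
  rw [h.polytope.mem_convexHull_iff h.bot_subset (h.left_mem hm hi)]
  rintro ⟨j, -, hj⟩
  exact h.left_ne_right _ _ hj.symm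

theorem right_notMem_top (h : PrismData m P u v) (hm : 3 ≤ m) {i : ℕ} (hi : i ≤ m) :
    v i ∉ convexHull ℝ (u '' Iio m) := by
  rw [h.polytope.mem_convexHull_iff h.top_subset (h.right_mem hm hi)]
  rintro ⟨j, -, hj⟩
  exact h.left_ne_right _ _ hj

theorem left_mem_side_iff (h : PrismData m P u v) (hm : 3 ≤ m) {i j : ℕ} (hi : i < m)
    (hj : j < m) : u i ∈ convexHull ℝ {u j, u (j + 1), v j, v (j + 1)} ↔
      i = j ∨ i = j + 1 ∨ (j + 1 = m ∧ i = 0) := by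
  rw [h.polytope.mem_convexHull_iff (h.side_subset hm hj) (h.left_mem hm hi.le)]
  constructor
  · rintro (h1 | h1 | h1 | h1)
    · exact Or.inl (h.inj_left i hi j hj h1)
    · rcases (Nat.succ_le_of_lt hj).lt_or_eq with h2 | h2
      · exact Or.inr (Or.inl (h.inj_left i hi _ h2 h1))
      · change j + 1 = m at h2
        rw [h2, h.left_period] at h1
        exact Or.inr (Or.inr ⟨h2, h.inj_left i hi 0 (by omega) h1⟩)
    · exact absurd h1 (h.left_ne_right _ _)
    · exact absurd h1 (h.left_ne_right _ _)
  · rintro (rfl | rfl | ⟨h1, rfl⟩)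
    · simp
    · simp
    · simp [h1, h.left_period]

theorem right_mem_side_iff (h : PrismData m P u v) (hm : 3 ≤ m) {i j : ℕ} (hi : i < m)
    (hj : j < m) : v i ∈ convexHull ℝ {u j, u (j + 1), v j, v (j + 1)} ↔
      i = j ∨ i = j + 1 ∨ (j + 1 = m ∧ i = 0) := by
  rw [h.polytope.mem_convexHull_iff (h.side_subset hm hj) (h.right_mem hm hi.le)]
  constructor
  · rintro (h1 | h1 | h1 | h1)
    · exact absurd h1.symm (h.left_ne_right _ _)
    · exact absurd h1.symm (h.left_ne_right _ _)
    · exact Or.inl (h.inj_right i hi j hj h1)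
    · rcases (Nat.succ_le_of_lt hj).lt_or_eq with h2 | h2
      · exact Or.inr (Or.inl (h.inj_right i hi _ h2 h1))
      · change j + 1 = m at h2
        rw [h2, h.right_period] at h1
        exact Or.inr (Or.inr ⟨h2, h.inj_right i hi 0 (by omega) h1⟩)
  · rintro (rfl | rfl | ⟨h1, rfl⟩)
    · simp
    · simp
    · simp [h1, h.right_period]

variable [DecidableEq E3]

theorem isTwoLayer (h : PrismData m P u v) (hm : 3 ≤ m) :
    IsTwoLayer P ((Finset.range m).image u) ((Finset.range m).image v) where
  eq_convexHull := by
    rw [← h.polytope.convexHull_extremePoints, h.extremePoints_eq]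
    simp
  extremePoints_eq := by simpa using h.extremePoints_eq
  disjoint := by
    rw [Finset.disjoint_left]
    intro x hx hx'
    obtain ⟨i, -, rfl⟩ := Finset.mem_image.1 hx
    obtain ⟨j, -, hj⟩ := Finset.mem_image.1 hx'
    exact h.left_ne_right i j hj.symm
  isExposed_left := by simpa using h.top_mem_facets.1
  isExposed_right := by simpa using h.bot_mem_facets.1
  two_le_card_left := by
    rw [Finset.card_image_of_injOn (fun i hi j hj => h.inj_left i (by simpa using hi) j
      (by simpa using hj)), Finset.card_range]
    omega
  two_le_card_right := by
    rw [Finset.card_image_of_injOn (fun i hi j hj => h.inj_right i (by simpa using hi) j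
      (by simpa using hj)), Finset.card_range]
    omega

theorem lower (h : PrismData m P u v) (hm : 3 ≤ m) {T : Finset (Finset E3)}
    (hT : IsTriangulation (P.extremePoints ℝ) T) : 2 * m - 5 + (m + 1) / 2 ≤ T.card := by
  have h2 := h.isTwoLayer hm
  have h4 := h2.card_add_card_add_card_apexes_le hT
  set W := IsTwoLayer.apexes T ((Finset.range m).image u) ((Finset.range m).image v) with hW
  rw [Finset.card_image_of_injOn (fun i hi j hj => h.inj_left i (by simpa using hi) j
      (by simpa using hj)), Finset.card_image_of_injOn (fun i hi j hj => h.inj_right i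
      (by simpa using hi) j (by simpa using hj)), Finset.card_range] at h4
  let W' := (Finset.range m).filter fun i => v i ∈ W
  have hW' : W'.card ≤ W.card := by
    refine Finset.card_le_card_of_injOn v (fun i hi => (Finset.mem_filter.1 hi).2) ?_
    intro i hi j hj
    exact h.inj_right i (Finset.mem_range.1 (Finset.mem_filter.1 hi).1) j
      (Finset.mem_range.1 (Finset.mem_filter.1 hj).1)
  -- Each side face contains an apex, so one of `i`, `i + 1` (cyclically) indexes an apex. The image
  -- is the set of cyclic predecessors, whence `m ≤ 2 * W'.card`.
  have hsub : Finset.range m ⊆ W' ∪ W'.image (fun j => if j = 0 then m - 1 else j - 1) := by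
    intro i hi
    rw [Finset.mem_range] at hi
    have hu : ∀ j ≤ m, u j ∈ (Finset.range m).image u := by
      intro j hj
      rcases hj.lt_or_eq with hj | rfl
      · exact Finset.mem_image_of_mem _ (Finset.mem_range.2 hj)
      · exact Finset.mem_image.2 ⟨0, Finset.mem_range.2 (by omega), h.left_period.symm⟩
    have hne : u i ≠ u (i + 1) := by
      intro h1
      rcases (Nat.succ_le_of_lt hi).lt_or_eq with h3 | h3
      · have := h.inj_left i hi _ h3 h1
        omega
      · change i + 1 = m at h3
        rw [h3, h.left_period] at h1
        have := h.inj_left i hi 0 (by omega) h1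
        omega
    obtain ⟨x, hxW, hxF⟩ := h2.exists_mem_apexes hT (h.side_mem_facets hi).1 hne
      (hu i hi.le) (subset_convexHull ℝ _ (by simp)) (hu (i + 1) hi)
      (subset_convexHull ℝ _ (by simp))
      ⟨v i, Finset.mem_image_of_mem _ (Finset.mem_range.2 hi), subset_convexHull ℝ _ (by simp)⟩
    obtain ⟨t, -, ht⟩ := Finset.mem_biUnion.1 hxW
    obtain ⟨j, hj, rfl⟩ := Finset.mem_image.1 (Finset.mem_inter.1 ht).2
    rw [Finset.mem_range] at hj
    have hjW : j ∈ W' := Finset.mem_filter.2 ⟨Finset.mem_range.2 hj, hxW⟩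
    rw [h.right_mem_side_iff hm hj hi] at hxF
    rw [Finset.mem_union]
    rcases hxF with rfl | rfl | ⟨h5, rfl⟩
    · exact Or.inl hjW
    · exact Or.inr (Finset.mem_image.2 ⟨_, hjW, by simp⟩)
    · exact Or.inr (Finset.mem_image.2 ⟨_, hjW, by simp only [if_true]; omega⟩)
  have h5 := (Finset.card_le_card hsub).trans (Finset.card_union_le _ _)
  have h6 : (W'.image (fun j => if j = 0 then m - 1 else j - 1)).card ≤ W'.card :=
    Finset.card_image_le
  rw [Finset.card_range] at h5
  omega

end PrismData

/-! ### The cone triangulation of a prism -/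

namespace PrismData
variable {m : ℕ} {P : Set E3} {u v : ℕ → E3}

theorem exposed_top_edge (h : PrismData m P u v) (hm : 3 ≤ m) {i : ℕ} (hi : i < m) :
    IsExposed ℝ P (convexHull ℝ {u i, u (i + 1)}) := by
  have h1 : ({u i, u (i + 1), v i, v (i + 1)} : Set E3) ∩ u '' Iio m = {u i, u (i + 1)} := by
    ext x
    constructor
    · rintro ⟨rfl | rfl | rfl | rfl, ⟨j, -, hj⟩⟩
      · simp
      · simp
      · exact absurd hj (h.left_ne_right _ _)
      · exact absurd hj (h.left_ne_right _ _)
    · rintro (rfl | rfl)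
      · exact ⟨by simp, mem_image_of_mem _ hi⟩
      · refine ⟨by simp, ?_⟩
        rcases (Nat.succ_le_of_lt hi).lt_or_eq with h3 | h3
        · exact mem_image_of_mem _ h3
        · exact ⟨0, by simp only [mem_Iio]; omega, by rw [← h.left_period, ← h3]⟩
  rw [← h1, ← h.polytope.convexHull_inter (h.side_subset hm hi) h.top_mem_facets.1]
  exact (h.side_mem_facets hi).1.inter h.top_mem_facets.1

theorem exposed_vertical_edge (h : PrismData m P u v) (hm : 3 ≤ m) {i : ℕ} (hi : i + 1 < m) :
    IsExposed ℝ P (convexHull ℝ {u (i + 1), v (i + 1)}) := by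
  have h1 : ({u i, u (i + 1), v i, v (i + 1)} : Set E3) ∩
      {u (i + 1), u (i + 1 + 1), v (i + 1), v (i + 1 + 1)} = {u (i + 1), v (i + 1)} := by
    ext x
    constructor
    · rintro ⟨hx, hx'⟩
      have hx' := subset_convexHull ℝ _ hx'
      rcases hx with rfl | rfl | rfl | rfl
      · rw [h.left_mem_side_iff hm (by omega) hi] at hx'
        omega
      · simp
      · rw [h.right_mem_side_iff hm (by omega) hi] at hx'
        omega
      · simp
    · rintro (rfl | rfl) <;> simp
  rw [← h1, ← h.polytope.convexHull_inter (h.side_subset hm (by omega))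
    (h.side_mem_facets hi).1]
  exact (h.side_mem_facets (by omega)).1.inter (h.side_mem_facets hi).1

/-- The index of the vertex at which the triangulation of the `k`-th side face is centered. -/
def hub (k : ℕ) : ℕ := if Even k then k else k + 1

/-- The other index of the `k`-th side face. -/
def rim (k : ℕ) : ℕ := if Even k then k + 1 else k

theorem hub_rim (k : ℕ) : (hub k = k ∧ rim k = k + 1) ∨ (hub k = k + 1 ∧ rim k = k) := by
  unfold hub rim
  split_ifs <;> simp

/-- The diagonal of a side face joins `v (hub k)` to `u (rim k)`, so no `u i` with `i` even lies on
a diagonal. -/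
theorem odd_rim (k : ℕ) : ¬ Even (rim k) := by
  unfold rim
  split_ifs with h
  · rwa [Nat.even_add_one, not_not]
  · exact h

variable [DecidableEq E3]

/-- The vertices of the facets that miss `v 0`. -/
def facetVertices (m : ℕ) (u v : ℕ → E3) (k : ℕ) : Finset E3 :=
  if k = 0 then (Finset.range m).image u else {u k, u (k + 1), v k, v (k + 1)}

/-- The vertices at which the facets that miss `v 0` are starred. -/
def center (u v : ℕ → E3) (k : ℕ) : E3 := if k = 0 then u 0 else v (hub k)

/-- The edges used for starring the facets that miss `v 0`. -/
def rimEdges (m : ℕ) (u v : ℕ → E3) (k : ℕ) : Finset (Finset E3) :=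
  if k = 0 then (Finset.Ico 1 (m - 1)).image fun j => {u j, u (j + 1)}
  else {{u k, u (k + 1)}, {u (rim k), v (rim k)}}

/-- The triangulation obtained by coning the starred facets from `v 0`. -/
def coneTriangulation (m : ℕ) (u v : ℕ → E3) : Finset (Finset E3) :=
  ((Finset.range (m - 1)).biUnion fun k =>
    (rimEdges m u v k).image (insert (center u v k))).image (insert (v 0))

theorem mem_rimEdges {m : ℕ} {u v : ℕ → E3} {k : ℕ} {σ : Finset E3} (hσ : σ ∈ rimEdges m u v k) :
    (k = 0 ∧ ∃ j, 1 ≤ j ∧ j + 1 < m ∧ σ = {u j, u (j + 1)}) ∨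
      (k ≠ 0 ∧ (σ = {u k, u (k + 1)} ∨ σ = {u (rim k), v (rim k)})) := by
  unfold rimEdges at hσ
  split_ifs at hσ with hk
  · obtain ⟨j, hj, rfl⟩ := Finset.mem_image.1 hσ
    rw [Finset.mem_Ico] at hj
    exact Or.inl ⟨hk, j, hj.1, by omega, rfl⟩
  · exact Or.inr ⟨hk, by simpa using hσ⟩

/-- The facets missing `v 0` are the base of the `u i`, numbered `0`, and the side faces `1, …, m -
2`; the side faces `0` and `m - 1` contain `v 0`. -/
theorem isTriangulation_coneTriangulation (h : PrismData m P u v) (hm : 3 ≤ m) :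
    IsTriangulation (P.extremePoints ℝ) (coneTriangulation m u v) := by
  have huinj : ∀ {i j}, i < m → j < m → i ≠ j → u i ≠ u j := fun hi hj hij hu =>
    hij (h.inj_left _ hi _ hj hu)
  have hvinj : ∀ {i j}, i < m → j < m → i ≠ j → v i ≠ v j := fun hi hj hij hv =>
    hij (h.inj_right _ hi _ hj hv)
  have huv := h.left_ne_right
  have hX0 : ((facetVertices m u v 0 : Finset E3) : Set E3) = u '' Iio m := by
    simp [facetVertices]
  have hXk : ∀ k, k ≠ 0 → ((facetVertices m u v k : Finset E3) : Set E3) =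
      {u k, u (k + 1), v k, v (k + 1)} := fun k hk => by simp [facetVertices, hk]
  have hX0' : ∀ x, x ∈ facetVertices m u v 0 ↔ ∃ i < m, u i = x := fun x => by
    simp [facetVertices]
  have hXk' : ∀ k, k ≠ 0 → ∀ x, x ∈ facetVertices m u v k ↔
      x = u k ∨ x = u (k + 1) ∨ x = v k ∨ x = v (k + 1) := fun k hk x => by
    simp [facetVertices, hk]
  have hlt : ∀ k ∈ Finset.range (m - 1), k + 1 < m := fun k hk => by
    rw [Finset.mem_range] at hk; omega
  refine isTriangulation_stars h.polytope (h.right_mem hm (Nat.zero_le m)) (Finset.range (m - 1))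
    (facetVertices m u v) (center u v) (rimEdges m u v) ?_ ?_ ?_ ?_ ?_ ?_ ?_ ?_ ?_ ?_ ?_
  · intro k hk
    by_cases hk0 : k = 0
    · rw [hk0, hX0]; exact h.top_subset
    · rw [hXk k hk0]; exact h.side_subset hm (by linarith [hlt k hk])
  · intro k hk
    by_cases hk0 : k = 0
    · rw [hk0, hX0]; exact h.top_mem_facets.1
    · rw [hXk k hk0]; exact (h.side_mem_facets (by linarith [hlt k hk])).1
  · intro k hk
    have hk' := hlt k hk
    by_cases hk0 : k = 0
    · rw [hk0, hX0']
      rintro ⟨i, -, hi⟩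
      exact huv _ _ hi
    · rw [hXk' k hk0]
      rintro (h1 | h1 | h1 | h1)
      · exact huv _ _ h1.symm
      · exact huv _ _ h1.symm
      · exact hvinj (by omega) (by omega) (Ne.symm hk0) h1
      · exact hvinj (by omega) hk' (by omega) h1
  · intro k hk
    by_cases hk0 : k = 0
    · rw [hk0, hX0']
      exact ⟨0, by omega, by simp [center]⟩
    · rw [hXk' k hk0, center, if_neg hk0]
      rcases hub_rim k with ⟨h1, -⟩ | ⟨h1, -⟩ <;> simp [h1]
  · intro k hk σ hσ
    have hk' := hlt k hk
    rcases mem_rimEdges hσ with ⟨-, j, hj1, hj2, rfl⟩ | ⟨hk0, rfl | rfl⟩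
    · exact Finset.card_pair (huinj (by omega) hj2 (by omega))
    · exact Finset.card_pair (huinj (by omega) hk' (by omega))
    · exact Finset.card_pair (huv _ _)
  · intro k hk σ hσ x hx
    have hk' := hlt k hk
    rcases mem_rimEdges hσ with ⟨rfl, j, hj1, hj2, rfl⟩ | ⟨hk0, rfl | rfl⟩
    · rw [hX0']
      rcases Finset.mem_insert.1 hx with rfl | hx
      · exact ⟨j, by omega, rfl⟩
      · exact ⟨j + 1, hj2, (Finset.mem_singleton.1 hx).symm⟩
    · rw [hXk' k hk0]
      rcases Finset.mem_insert.1 hx with rfl | hx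
      · exact Or.inl rfl
      · exact Or.inr (Or.inl (Finset.mem_singleton.1 hx))
    · rw [hXk' k hk0]
      rw [Finset.mem_insert, Finset.mem_singleton] at hx
      rcases hub_rim k with ⟨-, h1⟩ | ⟨-, h1⟩ <;> rw [h1] at hx <;> rcases hx with rfl | rfl <;>
        simp
  · intro k hk σ hσ hp
    have hk' := hlt k hk
    rcases mem_rimEdges hσ with ⟨rfl, j, hj1, hj2, rfl⟩ | ⟨hk0, rfl | rfl⟩
    · rw [center, if_pos rfl, Finset.mem_insert, Finset.mem_singleton] at hp
      rcases hp with hp | hp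
      · exact huinj (by omega) (by omega) (by omega) hp
      · exact huinj (by omega) hj2 (by omega) hp
    · rw [center, if_neg hk0, Finset.mem_insert, Finset.mem_singleton] at hp
      rcases hp with hp | hp <;> exact huv _ _ hp.symm
    · rw [center, if_neg hk0, Finset.mem_insert, Finset.mem_singleton] at hp
      rcases hp with hp | hp
      · exact huv _ _ hp.symm
      · rcases hub_rim k with ⟨h1, h2⟩ | ⟨h1, h2⟩
        · exact hvinj (by omega) (by omega) (by omega) hp
        · exact hvinj (by omega) (by omega) (by omega) hp
  · intro k hk σ hσ
    have hk' := hlt k hk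
    rcases mem_rimEdges hσ with ⟨rfl, j, hj1, hj2, rfl⟩ | ⟨hk0, rfl | rfl⟩
    · simpa using h.exposed_top_edge hm (by omega : j < m)
    · simpa using h.exposed_top_edge hm (by omega : k < m)
    · have h1 : ∃ i, i + 1 < m ∧ rim k = i + 1 := by
        rcases hub_rim k with ⟨-, h1⟩ | ⟨-, h1⟩
        · exact ⟨k, hk', h1⟩
        · exact ⟨k - 1, by omega, by omega⟩
      obtain ⟨i, hi, hr⟩ := h1
      rw [hr]
      simpa using h.exposed_vertical_edge hm hi
  · have key : ∀ k ∈ Finset.range (m - 1), ∀ l ∈ Finset.range (m - 1), k < l →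
        ∃ a b, facetVertices m u v k ∩ facetVertices m u v l ⊆ {a, b} := by
      intro k hk l hl hkl
      have hl' := hlt l hl
      have hl0 : l ≠ 0 := by omega
      by_cases hk0 : k = 0
      · refine ⟨u l, u (l + 1), fun x hx => ?_⟩
        rw [Finset.mem_inter, hk0, hX0', hXk' l hl0] at hx
        rw [Finset.mem_insert, Finset.mem_singleton]
        obtain ⟨⟨i, -, rfl⟩, h1 | h1 | h1 | h1⟩ := hx
        · exact Or.inl h1
        · exact Or.inr h1
        · exact absurd h1 (huv _ _)
        · exact absurd h1 (huv _ _)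
      · refine ⟨u l, v l, fun x hx => ?_⟩
        rw [Finset.mem_inter, hXk' k hk0, hXk' l hl0] at hx
        rw [Finset.mem_insert, Finset.mem_singleton]
        obtain ⟨h1, h2 | h2 | h2 | h2⟩ := hx
        · exact Or.inl h2
        · exfalso
          rw [h2] at h1
          rcases h1 with h1 | h1 | h1 | h1
          · exact huinj hl' (by omega) (by omega) h1
          · exact huinj hl' (by omega) (by omega) h1
          · exact huv _ _ h1
          · exact huv _ _ h1
        · exact Or.inr h2
        · exfalso
          rw [h2] at h1
          rcases h1 with h1 | h1 | h1 | h1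
          · exact huv _ _ h1.symm
          · exact huv _ _ h1.symm
          · exact hvinj hl' (by omega) (by omega) h1
          · exact hvinj hl' (by omega) (by omega) h1
    intro k hk l hl hkl
    rcases hkl.lt_or_gt with hlt | hgt
    · exact key k hk l hl hlt
    · rw [Finset.inter_comm]
      exact key l hl k hk hgt
  · intro F hF hvF
    rw [h.facets_eq] at hF
    rcases hF with (rfl | rfl) | ⟨j, hj, rfl⟩
    · exact ⟨0, Finset.mem_range.2 (by omega), by rw [hX0]⟩
    · exact absurd (subset_convexHull ℝ _ (mem_image_of_mem _ (by simp; omega))) hvF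
    · rw [mem_Iio] at hj
      rw [h.right_mem_side_iff hm (by omega) hj] at hvF
      exact ⟨j, Finset.mem_range.2 (by omega), by rw [hXk j (by omega)]⟩
  · intro k hk F hF hpF
    have hk' := hlt k hk
    rw [h.facets_eq] at hF
    by_cases hk0 : k = 0
    · subst hk0
      rw [center, if_pos rfl] at hpF
      have hR : ∀ j, 1 ≤ j → j + 1 < m → {u j, u (j + 1)} ∈ rimEdges m u v 0 := fun j h1 h2 =>
        by
          rw [rimEdges, if_pos rfl]
          exact Finset.mem_image_of_mem _ (Finset.mem_Ico.2 ⟨h1, by omega⟩)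
      rcases hF with (rfl | rfl) | ⟨j, hj, rfl⟩
      · exact absurd (subset_convexHull ℝ _ (mem_image_of_mem _ (by simp; omega))) hpF
      · refine ⟨_, hR 1 le_rfl (by omega), fun x hx hxF => ?_⟩
        obtain ⟨i, hi, rfl⟩ := (hX0' x).1 hx
        exact absurd hxF (h.left_notMem_bot hm hi.le)
      · rw [mem_Iio] at hj
        rw [h.left_mem_side_iff hm (by omega) hj] at hpF
        refine ⟨_, hR j (by omega) (by omega), fun x hx hxF => ?_⟩
        obtain ⟨i, hi, rfl⟩ := (hX0' x).1 hx
        rw [h.left_mem_side_iff hm hi hj] at hxF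
        rw [Finset.mem_insert, Finset.mem_singleton]
        rcases hxF with rfl | rfl | ⟨h1, -⟩
        · exact Or.inl rfl
        · exact Or.inr rfl
        · omega
    · rw [center, if_neg hk0] at hpF
      have hR1 : {u k, u (k + 1)} ∈ rimEdges m u v k := by rw [rimEdges, if_neg hk0]; simp
      have hR2 : {u (rim k), v (rim k)} ∈ rimEdges m u v k := by
        rw [rimEdges, if_neg hk0]; simp
      have hhub : hub k < m := by rcases hub_rim k with ⟨h1, -⟩ | ⟨h1, -⟩ <;> omega
      rcases hF with (rfl | rfl) | ⟨j, hj, rfl⟩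
      · refine ⟨_, hR1, fun x hx hxF => ?_⟩
        rw [Finset.mem_insert, Finset.mem_singleton]
        rcases (hXk' k hk0 x).1 hx with rfl | rfl | rfl | rfl
        · exact Or.inl rfl
        · exact Or.inr rfl
        · exact absurd hxF (h.right_notMem_top hm (by omega))
        · exact absurd hxF (h.right_notMem_top hm (by omega))
      · exact absurd (subset_convexHull ℝ _ (mem_image_of_mem v (mem_Iio.2 hhub))) hpF
      · rw [mem_Iio] at hj
        rw [h.right_mem_side_iff hm hhub hj] at hpF
        -- A side face that misses the hub can meet the `k`-th one only along the vertical edge at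
        -- the rim.
        have hrim : ∀ i, (i = k ∨ i = k + 1) → (i = j ∨ i = j + 1 ∨ (j + 1 = m ∧ i = 0)) →
            i = rim k := by
          intro i hi hi'
          rcases hub_rim k with ⟨h1, h2⟩ | ⟨h1, h2⟩
          · rw [h1] at hpF; rw [h2]
            rcases hi with rfl | rfl
            · exact absurd hi' hpF
            · rfl
          · rw [h1] at hpF; rw [h2]
            rcases hi with rfl | rfl
            · rfl
            · exact absurd hi' hpF
        refine ⟨_, hR2, fun x hx hxF => ?_⟩
        rw [Finset.mem_insert, Finset.mem_singleton]
        rcases (hXk' k hk0 x).1 hx with rfl | rfl | rfl | rfl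
        · rw [h.left_mem_side_iff hm (by omega) hj] at hxF
          rw [← hrim k (Or.inl rfl) hxF]; exact Or.inl rfl
        · rw [h.left_mem_side_iff hm (by omega) hj] at hxF
          rw [← hrim (k + 1) (Or.inr rfl) hxF]; exact Or.inl rfl
        · rw [h.right_mem_side_iff hm (by omega) hj] at hxF
          rw [← hrim k (Or.inl rfl) hxF]; exact Or.inr rfl
        · rw [h.right_mem_side_iff hm (by omega) hj] at hxF
          rw [← hrim (k + 1) (Or.inr rfl) hxF]; exact Or.inr rfl

/-- There are `m - 2` triangles in the fan of the base and two on each of `m - 2` side faces. -/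
theorem card_coneTriangulation_le (hm : 3 ≤ m) (u v : ℕ → E3) :
    (coneTriangulation m u v).card + 6 ≤ 3 * m := by
  have h1 : (coneTriangulation m u v).card ≤
      ∑ k ∈ Finset.range (m - 1), (rimEdges m u v k).card :=
    Finset.card_image_le.trans (Finset.card_biUnion_le.trans
      (Finset.sum_le_sum fun k _ => Finset.card_image_le))
  obtain ⟨n, rfl⟩ : ∃ n, m = n + 2 := ⟨m - 2, by omega⟩
  rw [show n + 2 - 1 = n + 1 from rfl, Finset.sum_range_succ'] at h1
  have h2 : (rimEdges (n + 2) u v 0).card ≤ n := by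
    rw [rimEdges, if_pos rfl]
    exact Finset.card_image_le.trans (by simp)
  have h3 : ∑ k ∈ Finset.range n, (rimEdges (n + 2) u v (k + 1)).card ≤
      ∑ k ∈ Finset.range n, 2 := by
    refine Finset.sum_le_sum fun k _ => ?_
    rw [rimEdges, if_neg (by omega)]
    exact Finset.card_le_two
  simp at h3
  omega

end PrismData

/-! ### Improving the cone triangulation by flips -/

namespace PrismData
variable {m : ℕ} {P : Set E3} {u v : ℕ → E3}

theorem insert_rotate₁ [DecidableEq E3] (a b e w : E3) :
    ({w, e, b, a} : Finset E3) = {a, e, b, w} := by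
  ext; simp only [Finset.mem_insert, Finset.mem_singleton]; tauto

theorem insert_rotate₂ [DecidableEq E3] (a c e w : E3) :
    ({w, e, a, c} : Finset E3) = {a, e, c, w} := by
  ext; simp only [Finset.mem_insert, Finset.mem_singleton]; tauto

theorem insert_rotate₃ [DecidableEq E3] (a b d w : E3) :
    ({w, d, b, a} : Finset E3) = {a, w, b, d} := by
  ext; simp only [Finset.mem_insert, Finset.mem_singleton]; tauto

theorem insert_rotate₄ [DecidableEq E3] (a c d w : E3) :
    ({w, d, a, c} : Finset E3) = {a, w, c, d} := by
  ext; simp only [Finset.mem_insert, Finset.mem_singleton]; tauto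

theorem mem_coneTriangulation [DecidableEq E3] {t : Finset E3} :
    t ∈ coneTriangulation m u v ↔ ∃ k < m - 1, ∃ σ ∈ rimEdges m u v k,
      t = insert (v 0) (insert (center u v k) σ) := by
  simp only [coneTriangulation, Finset.mem_image, Finset.mem_biUnion, Finset.mem_range]
  constructor
  · rintro ⟨_, ⟨k, hk, σ, hσ, rfl⟩, rfl⟩
    exact ⟨k, hk, σ, hσ, rfl⟩
  · rintro ⟨k, hk, σ, hσ, rfl⟩
    exact ⟨_, ⟨k, hk, σ, hσ, rfl⟩, rfl⟩

/-- Such a vertex is on no diagonal of a side face, so it meets two triangles of the base fan and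
just one in each of its two side faces. -/
theorem star_coneTriangulation [DecidableEq E3] (h : PrismData m P u v) {i : ℕ}
    (hi : Even (i + 1)) (him : i + 2 < m) (t : Finset E3) :
    (t ∈ coneTriangulation m u v ∧ u (i + 1) ∈ t) ↔
      t = {u (i + 1), u 0, u i, v 0} ∨ t = {u (i + 1), u 0, u (i + 2), v 0} ∨
      t = {u (i + 1), v 0, u i, v (i + 1)} ∨ t = {u (i + 1), v 0, u (i + 2), v (i + 1)} := by
  have hi' : ¬ Even i := by rwa [Nat.even_add_one] at hi
  have hi0 : i ≠ 0 := by rintro rfl; simp at hi'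
  have hhub1 : hub i = i + 1 := if_neg hi'
  have hhub2 : hub (i + 1) = i + 1 := if_pos hi
  have hinj : ∀ j < m, u (i + 1) = u j → i + 1 = j := fun j hj => h.inj_left _ (by omega) j hj
  have huv := h.left_ne_right
  rw [mem_coneTriangulation]
  constructor
  · rintro ⟨⟨k, hk, σ, hσ, rfl⟩, hmem⟩
    rcases mem_rimEdges hσ with ⟨rfl, j, hj1, hj2, rfl⟩ | ⟨hk0, rfl | rfl⟩
    · rw [center, if_pos rfl] at hmem ⊢
      simp only [Finset.mem_insert, Finset.mem_singleton] at hmem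
      rcases hmem with h1 | h1 | h1 | h1
      · exact absurd h1 (huv _ _)
      · have := hinj 0 (by omega) h1; omega
      · obtain rfl := hinj j (by omega) h1
        exact Or.inr (Or.inl (insert_rotate₂ _ _ _ _))
      · obtain rfl : i = j := by have := hinj _ hj2 h1; omega
        exact Or.inl (insert_rotate₁ _ _ _ _)
    · rw [center, if_neg hk0] at hmem ⊢
      simp only [Finset.mem_insert, Finset.mem_singleton] at hmem
      rcases hmem with h1 | h1 | h1 | h1
      · exact absurd h1 (huv _ _)
      · exact absurd h1 (huv _ _)
      · obtain rfl := hinj k (by omega) h1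
        rw [hhub2]
        exact Or.inr (Or.inr (Or.inr (insert_rotate₄ _ _ _ _)))
      · obtain rfl : i = k := by have := hinj _ (by omega) h1; omega
        rw [hhub1]
        exact Or.inr (Or.inr (Or.inl (insert_rotate₃ _ _ _ _)))
    · rw [center, if_neg hk0] at hmem
      simp only [Finset.mem_insert, Finset.mem_singleton] at hmem
      rcases hmem with h1 | h1 | h1 | h1
      · exact absurd h1 (huv _ _)
      · exact absurd h1 (huv _ _)
      · have h2 : rim k < m := by rcases hub_rim k with ⟨-, h1⟩ | ⟨-, h1⟩ <;> omega
        have h3 := hinj _ h2 h1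
        rw [h3] at hi
        exact absurd hi (odd_rim k)
      · exact absurd h1 (huv _ _)
  · have hR0 : ∀ j, 1 ≤ j → j + 1 < m → {u j, u (j + 1)} ∈ rimEdges m u v 0 := fun j h1 h2 => by
      rw [rimEdges, if_pos rfl]
      exact Finset.mem_image_of_mem _ (Finset.mem_Ico.2 ⟨h1, by omega⟩)
    have hR : ∀ k, k ≠ 0 → {u k, u (k + 1)} ∈ rimEdges m u v k := fun k hk => by
      rw [rimEdges, if_neg hk]; simp
    rintro (rfl | rfl | rfl | rfl)
    · exact ⟨⟨0, by omega, _, hR0 i (by omega) (by omega), (insert_rotate₁ _ _ _ _).symm⟩,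
        Finset.mem_insert_self _ _⟩
    · exact ⟨⟨0, by omega, _, hR0 (i + 1) (by omega) (by omega), (insert_rotate₂ _ _ _ _).symm⟩,
        Finset.mem_insert_self _ _⟩
    · refine ⟨⟨i, by omega, _, hR i hi0, ?_⟩, Finset.mem_insert_self _ _⟩
      rw [center, if_neg hi0, hhub1]
      exact (insert_rotate₃ _ _ _ _).symm
    · refine ⟨⟨i + 1, by omega, _, hR (i + 1) (by omega), ?_⟩, Finset.mem_insert_self _ _⟩
      rw [center, if_neg (by omega), hhub2]
      exact (insert_rotate₄ _ _ _ _).symm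

/-- The tetrahedron spanned by three consecutive vertices of one base and a vertex of the other. -/
theorem affineIndependent_corner [DecidableEq E3] (h : PrismData m P u v) (hm : 3 ≤ m) {i j : ℕ}
    (him : i + 2 < m) (hj : j ≤ m) :
    AffineIndependent ℝ
      (fun x : ({u (i + 1), u i, u (i + 2), v j} : Finset E3) => (x : E3)) := by
  have e : ({u (i + 1), u i, u (i + 2), v j} : Finset E3) =
      insert (v j) (insert (u (i + 2)) {u (i + 1), u i}) := by
    ext; simp only [Finset.mem_insert, Finset.mem_singleton]; tauto
  rw [e]
  refine affineIndependent_of_isExposed h.top_mem_facets.1 (h.right_mem hm hj).1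
    (h.right_notMem_top hm hj) ?_ ?_
  · intro x hx
    simp only [Finset.coe_insert, Finset.coe_singleton, mem_insert_iff, mem_singleton_iff] at hx
    refine subset_convexHull ℝ _ ?_
    rcases hx with rfl | rfl | rfl
    exacts [⟨_, him, rfl⟩, ⟨_, (by simp only [mem_Iio]; omega), rfl⟩,
      ⟨_, (by simp only [mem_Iio]; omega), rfl⟩]
  · refine affineIndependent_of_isExposed (h.side_mem_facets (by omega : i < m)).1
      (h.left_mem hm (by omega)).1 ?_ ?_ affineIndependent_pair
    · rw [h.left_mem_side_iff hm him (by omega)]; omega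
    · intro x hx
      simp only [Finset.coe_insert, Finset.coe_singleton, mem_insert_iff, mem_singleton_iff] at hx
      refine subset_convexHull ℝ _ ?_
      rcases hx with rfl | rfl <;> simp

/-- Induction on the number of corners cut, at `u 2, u 4, …, u (2 * n)`. The flips at one corner
only change tetrahedra spanned by six points, among which no later even `u i` occurs, so the later
stars are still those of the cone triangulation. -/
theorem exists_isTriangulation_card_add_le [DecidableEq E3] (h : PrismData m P u v) (hm : 3 ≤ m)
    (n : ℕ) (hn : 2 * n + 2 ≤ m) :
    ∃ T, IsTriangulation (P.extremePoints ℝ) T ∧ T.card + 6 + n ≤ 3 * m ∧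
      ∀ i, 2 * n < i → i < m → Even i → ∀ t, u i ∈ t → (t ∈ T ↔ t ∈ coneTriangulation m u v) := by
  induction n with
  | zero =>
    exact ⟨_, h.isTriangulation_coneTriangulation hm, card_coneTriangulation_le hm u v,
      fun i _ _ _ t _ => Iff.rfl⟩
  | succ n ih =>
    obtain ⟨T, hT, hcard, hst⟩ := ih (by omega)
    obtain ⟨i, hi⟩ : ∃ i, i = 2 * n + 1 := ⟨_, rfl⟩
    have him : i + 2 < m := by omega
    have hev : Even (i + 1) := ⟨n + 1, by omega⟩
    have hu : ∀ {j k}, j < m → k < m → j ≠ k → u j ≠ u k := fun hj hk hjk he =>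
      hjk (h.inj_left _ hj _ hk he)
    have hv : ∀ {j k}, j < m → k < m → j ≠ k → v j ≠ v k := fun hj hk hjk he =>
      hjk (h.inj_right _ hj _ hk he)
    have huv := h.left_ne_right
    have hnd : [u (i + 1), u i, u (i + 2), v (i + 1), u 0, v 0].Nodup := by
      simp only [List.nodup_cons, List.mem_cons, List.not_mem_nil, or_false, not_or,
        List.nodup_nil, and_true, not_false_eq_true]
      exact ⟨⟨hu (by omega) (by omega) (by omega), hu (by omega) (by omega) (by omega), huv _ _,
        hu (by omega) (by omega) (by omega), huv _ _⟩,
        ⟨hu (by omega) (by omega) (by omega), huv _ _, hu (by omega) (by omega) (by omega),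
        huv _ _⟩, ⟨huv _ _, hu (by omega) (by omega) (by omega), huv _ _⟩,
        ⟨(huv _ _).symm, hv (by omega) (by omega) (by omega)⟩, huv _ _⟩
    have hstar : ∀ t, (t ∈ T ∧ u (i + 1) ∈ t) ↔
        t = {u (i + 1), u 0, u i, v 0} ∨ t = {u (i + 1), u 0, u (i + 2), v 0} ∨
        t = {u (i + 1), v 0, u i, v (i + 1)} ∨ t = {u (i + 1), v 0, u (i + 2), v (i + 1)} := by
      intro t
      rw [← h.star_coneTriangulation hev him]
      exact and_congr_left fun ht => hst (i + 1) (by omega) (by omega) hev t ht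
    have hindd := h.affineIndependent_corner hm (j := i + 1) him (by omega)
    have hcr : ∀ x ∈ P.extremePoints ℝ,
        x ∉ ({u (i + 1), u i, u (i + 2), v (i + 1)} : Set E3) →
        x ∉ convexHull ℝ {u i, u (i + 1), v i, v (i + 1)} →
        x ∉ convexHull ℝ {u (i + 1), u (i + 2), v (i + 1), v (i + 2)} →
        ∃ (β γ δ : ℝ) (z : E3), 0 < β ∧ 0 < γ ∧ 0 ≤ δ ∧
          (x ∉ convexHull ℝ (u '' Iio m) → 0 < δ) ∧ (x ∈ convexHull ℝ (u '' Iio m) → δ = 0) ∧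
          β + γ + δ = 1 ∧ z = β • u i + γ • u (i + 2) + δ • v (i + 1) ∧
          z ∈ segment ℝ (u (i + 1)) x ∧ z ≠ x := by
      intro x hx hx1 hx2 hx3
      have htop : ∀ j < m, u j ∈ convexHull ℝ (u '' Iio m) := fun j hj =>
        subset_convexHull ℝ _ ⟨j, hj, rfl⟩
      refine exists_crossing h.polytope.convex h.top_mem_facets.1
        (h.side_mem_facets (by omega : i < m)).1 (h.side_mem_facets (by omega : i + 1 < m)).1
        (h.right_mem hm (by omega : i + 1 ≤ m)).1 (htop _ (by omega)) (htop _ (by omega))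
        (htop _ him) (h.right_notMem_top hm (by omega)) (subset_convexHull ℝ _ (by simp))
        (subset_convexHull ℝ _ (by simp)) (subset_convexHull ℝ _ (by simp)) ?_
        (subset_convexHull ℝ _ (by simp)) (subset_convexHull ℝ _ (by simp))
        (subset_convexHull ℝ _ (by simp)) ?_ ?_ hindd hx hx1 hx2 hx3
      · rw [h.left_mem_side_iff hm him (by omega)]; omega
      · rw [h.left_mem_side_iff hm (by omega) (by omega)]; omega
      · exact Finset.card_eq_four.2 ⟨_, _, _, _, hu (by omega) (by omega) (by omega),
          hu (by omega) (by omega) (by omega), huv _ _, hu (by omega) (by omega) (by omega),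
          huv _ _, huv _ _, rfl⟩
    obtain ⟨β₁, γ₁, δ₁, z₁, hβ₁, hγ₁, -, -, hδ₁, h₁, hz₁, hz₁s, hz₁e⟩ := hcr (u 0)
      (h.left_mem hm (by omega)) (by
        rintro (h1 | h1 | h1 | h1)
        · exact hu (by omega) (by omega) (by omega) h1
        · exact hu (by omega) (by omega) (by omega) h1
        · exact hu (by omega) (by omega) (by omega) h1
        · exact huv _ _ h1)
      (by rw [h.left_mem_side_iff hm (by omega) (by omega)]; omega)
      (by rw [h.left_mem_side_iff hm (by omega) (by omega)]; omega)
    obtain ⟨β₂, γ₂, δ₂, z₂, hβ₂, hγ₂, -, hδ₂, -, h₂, hz₂, hz₂s, hz₂e⟩ := hcr (v 0)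
      (h.right_mem hm (by omega)) (by
        rintro (h1 | h1 | h1 | h1)
        · exact huv _ _ h1.symm
        · exact huv _ _ h1.symm
        · exact huv _ _ h1.symm
        · exact hv (by omega) (by omega) (by omega) h1)
      (by rw [h.right_mem_side_iff hm (by omega) (by omega)]; omega)
      (by rw [h.right_mem_side_iff hm (by omega) (by omega)]; omega)
    -- `u 0` lies in the same base as the corner, so the first crossing is with a segment (`δ = 0`);
    -- `v 0` does not, so the second has `δ > 0`.
    rw [hδ₁ (subset_convexHull ℝ _ ⟨0, (by simp only [mem_Iio]; omega), rfl⟩)] at h₁ hz₁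
    obtain ⟨T', hT', hcard', hst'⟩ := exists_double_flip hT hnd hstar hβ₁ hγ₁
      (by rwa [add_zero] at h₁) (by rwa [zero_smul, add_zero] at hz₁) hz₁s hz₁e hβ₂ hγ₂
      (hδ₂ (h.right_notMem_top hm (by omega))) h₂ hz₂ hz₂s hz₂e
      (h.affineIndependent_corner hm (j := 0) him (by omega)) hindd
    refine ⟨T', hT', by omega, fun j hj hjm hje t ht => ?_⟩
    rw [← hst j (by omega) hjm hje t ht]
    refine hst' (u j) ?_ t ht
    simp only [Finset.mem_insert, Finset.mem_singleton, not_or]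
    have hji : j ≠ i + 2 := by
      rintro rfl
      exact absurd hje (by rw [Nat.even_add_one]; simpa using hev)
    exact ⟨hu (by omega) (by omega) (by omega), hu (by omega) (by omega) (by omega),
      hu (by omega) (by omega) hji, huv _ _, hu (by omega) (by omega) (by omega), huv _ _⟩

/-- There are `m / 2 - 1` even indices from `2` to `m - 2`, each saving one tetrahedron from `3 * m
- 6`. -/
theorem upper (h : PrismData m P u v) (hm : 3 ≤ m) :
    ∃ T, IsTriangulation (P.extremePoints ℝ) T ∧ T.card ≤ 2 * m - 5 + (m + 1) / 2 := by
  classical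
  obtain ⟨T, hT, hcard, -⟩ := h.exists_isTriangulation_card_add_le hm (m / 2 - 1) (by omega)
  exact ⟨T, hT, by omega⟩

end PrismData

/-! ### Vertices and facets from the face lattice -/

section FaceLattice

variable {E E' : Type*} [NormedAddCommGroup E] [NormedSpace ℝ E] [NormedAddCommGroup E']
  [NormedSpace ℝ E']

theorem eq_convexHull_extremePoints_inter {A F : Set E} (hA : A.Finite)
    (hF : IsExposed ℝ (convexHull ℝ A) F) :
    F = convexHull ℝ ((convexHull ℝ A).extremePoints ℝ ∩ F) := by
  rw [← convexHull_extremePoints hA] at hF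
  exact hF.eq_convexHull

theorem minimal_nonempty_iff {A : Set E} (hA : A.Finite) (F : FaceLattice (convexHull ℝ A)) :
    Minimal (fun F : FaceLattice (convexHull ℝ A) => F.1.Nonempty) F ↔
      ∃ x ∈ (convexHull ℝ A).extremePoints ℝ, F.1 = {x} := by
  constructor
  · intro hF
    obtain ⟨x, hxF, hx⟩ := F.2.exists_extremePoint hA hF.1
    have h1 : F.1 ⊆ {x} := hF.2 (y := ⟨{x}, isExposed_singleton_of_mem_extremePoints hA hx⟩)
      (singleton_nonempty x) (singleton_subset_iff.2 hxF)
    exact ⟨x, hx, h1.antisymm (singleton_subset_iff.2 hxF)⟩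
  · rintro ⟨x, -, hF⟩
    refine ⟨show F.1.Nonempty by rw [hF]; exact singleton_nonempty x, fun G hG hGF => ?_⟩
    change F.1 ⊆ G.1
    have hGF : G.1 ⊆ F.1 := hGF
    rw [hF] at hGF ⊢
    exact ((subset_singleton_iff_eq.1 hGF).resolve_left hG.ne_empty).ge

/-- The empty face is the least element of the lattice, so an order isomorphism preserves it. -/
theorem nonempty_apply_iff {P : Set E} {P' : Set E'} (Φ : FaceLattice P ≃o FaceLattice P')
    (F : FaceLattice P) : (Φ F).1.Nonempty ↔ F.1.Nonempty := by
  have h1 : F.1 = ∅ ↔ F ≤ ⟨∅, isExposed_empty⟩ := subset_empty_iff.symm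
  have h2 : (Φ F).1 = ∅ ↔ Φ F ≤ ⟨∅, isExposed_empty⟩ := subset_empty_iff.symm
  rw [nonempty_iff_ne_empty, nonempty_iff_ne_empty, Ne, Ne, h1, h2, not_iff_not]
  constructor
  · intro h
    rw [← Φ.le_iff_le]
    exact h.trans (empty_subset _)
  · intro h
    rw [← Φ.le_symm_apply]
    exact h.trans (empty_subset _)

theorem apply_ne_iff {P : Set E} {P' : Set E'} (Φ : FaceLattice P ≃o FaceLattice P')
    (F : FaceLattice P) : (Φ F).1 ≠ P' ↔ F.1 ≠ P := by
  have h1 : F.1 = P ↔ (⟨P, IsExposed.refl P⟩ : FaceLattice P) ≤ F :=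
    ⟨fun h => h.ge, fun h => F.2.subset.antisymm h⟩
  have h2 : (Φ F).1 = P' ↔ (⟨P', IsExposed.refl P'⟩ : FaceLattice P') ≤ Φ F :=
    ⟨fun h => h.ge, fun h => (Φ F).2.subset.antisymm h⟩
  rw [Ne, Ne, h1, h2, not_iff_not]
  constructor
  · intro h
    rw [← Φ.le_iff_le]
    exact le_trans (Φ _).2.subset h
  · intro h
    rw [← Φ.symm_apply_le]
    exact le_trans (Φ.symm _).2.subset h

theorem maximal_ne_apply_iff {P : Set E} {P' : Set E'} (Φ : FaceLattice P ≃o FaceLattice P')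
    (F : FaceLattice P) : Maximal (fun G : FaceLattice P' => G.1 ≠ P') (Φ F) ↔
      Maximal (fun G : FaceLattice P => G.1 ≠ P) F := by
  constructor
  · intro h
    refine ⟨(apply_ne_iff Φ F).1 h.1, fun G hG hFG => ?_⟩
    rw [← Φ.le_iff_le]
    exact h.2 ((apply_ne_iff Φ G).2 hG) (Φ.le_iff_le.2 hFG)
  · intro h
    refine ⟨(apply_ne_iff Φ F).2 h.1, fun G hG hFG => ?_⟩
    rw [← Φ.symm_apply_le]
    refine h.2 ((apply_ne_iff Φ _).1 (by rwa [Φ.apply_symm_apply])) ?_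
    rwa [Φ.le_symm_apply]

theorem minimal_nonempty_apply_iff {P : Set E} {P' : Set E'}
    (Φ : FaceLattice P ≃o FaceLattice P') (F : FaceLattice P) :
    Minimal (fun G : FaceLattice P' => G.1.Nonempty) (Φ F) ↔
      Minimal (fun G : FaceLattice P => G.1.Nonempty) F := by
  constructor
  · intro h
    refine ⟨(nonempty_apply_iff Φ F).1 h.1, fun G hG hFG => ?_⟩
    rw [← Φ.le_iff_le]
    exact h.2 ((nonempty_apply_iff Φ G).2 hG) (Φ.le_iff_le.2 hFG)
  · intro h
    refine ⟨(nonempty_apply_iff Φ F).2 h.1, fun G hG hFG => ?_⟩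
    rw [← Φ.le_symm_apply]
    refine h.2 ((nonempty_apply_iff Φ _).1 (by rwa [Φ.apply_symm_apply])) ?_
    rwa [Φ.symm_apply_le]

/-- An isomorphism of face lattices of polytopes is induced by a bijection of the vertices. -/
theorem exists_vertex_map {A : Set E} {A' : Set E'} (hA : A.Finite) (hA' : A'.Finite)
    (Φ : FaceLattice (convexHull ℝ A) ≃o FaceLattice (convexHull ℝ A')) :
    ∃ φ : E' → E, InjOn φ ((convexHull ℝ A').extremePoints ℝ) ∧
      φ '' (convexHull ℝ A').extremePoints ℝ = (convexHull ℝ A).extremePoints ℝ ∧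
      ∀ y ∈ (convexHull ℝ A').extremePoints ℝ, ∀ F, φ y ∈ F.1 ↔ y ∈ (Φ F).1 := by
  have h1 : ∀ y ∈ (convexHull ℝ A').extremePoints ℝ, ∃ x ∈ (convexHull ℝ A).extremePoints ℝ,
      ∃ G : FaceLattice (convexHull ℝ A), G.1 = {x} ∧ (Φ G).1 = {y} := by
    intro y hy
    have h2 := (minimal_nonempty_iff hA'
      ⟨{y}, isExposed_singleton_of_mem_extremePoints hA' hy⟩).2 ⟨y, hy, rfl⟩
    rw [← Φ.apply_symm_apply ⟨{y}, _⟩, minimal_nonempty_apply_iff, minimal_nonempty_iff hA] at h2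
    obtain ⟨x, hx, h3⟩ := h2
    exact ⟨x, hx, _, h3, by rw [Φ.apply_symm_apply]⟩
  choose! φ hφ G hG hΦG using h1
  refine ⟨φ, ?_, ?_, ?_⟩
  · intro y hy y' hy' h
    have h2 : G y hy = G y' hy' := Subtype.ext (by rw [hG y hy, hG y' hy', h])
    have h3 := hΦG y hy
    rw [h2, hΦG y' hy'] at h3
    exact (singleton_injective h3).symm
  · refine Subset.antisymm (by rintro _ ⟨y, hy, rfl⟩; exact hφ y hy) fun x hx => ?_
    have h2 := (minimal_nonempty_iff hA
      ⟨{x}, isExposed_singleton_of_mem_extremePoints hA hx⟩).2 ⟨x, hx, rfl⟩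
    rw [← minimal_nonempty_apply_iff Φ, minimal_nonempty_iff hA'] at h2
    obtain ⟨y, hy, h3⟩ := h2
    have h4 : G y hy = ⟨{x}, isExposed_singleton_of_mem_extremePoints hA hx⟩ :=
      Φ.injective (Subtype.ext (by rw [hΦG y hy, h3]))
    refine ⟨y, hy, ?_⟩
    have h5 := hG y hy
    rw [h4] at h5
    exact (singleton_injective h5).symm
  · intro y hy F
    rw [← singleton_subset_iff, ← singleton_subset_iff, ← hG y hy, ← hΦG y hy]
    exact (Φ.le_iff_le (x := G y hy) (y := F)).symm

end FaceLattice

/-- Facets were defined by dimension, which an abstract isomorphism does not see; maximality among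
proper faces is purely order-theoretic. -/
theorem IsPolytope3.mem_facets_iff {P : Set E3} (h : IsPolytope3 P) (F : FaceLattice P) :
    F.1 ∈ facets P ↔ Maximal (fun F : FaceLattice P => F.1 ≠ P) F := by
  obtain ⟨⟨A, hA, rfl⟩, hint⟩ := h
  constructor
  · intro hF
    exact ⟨isExposed_ne_of_mem_facets hint hF, fun G hG hFG =>
      (eq_of_facet_subset hint hF G.2 hG hFG).le⟩
  · intro hF
    have hne : F.1.Nonempty := by
      rw [nonempty_iff_ne_empty]
      intro h0
      obtain ⟨x, -, hx⟩ := (IsExposed.refl (𝕜 := ℝ) (convexHull ℝ A)).exists_extremePoint hA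
        (hint.mono interior_subset)
      have h1 : ({x} : Set E3) ⊆ F.1 :=
        hF.2 (y := ⟨{x}, isExposed_singleton_of_mem_extremePoints hA hx⟩)
        (fun h1 => by rw [← h1] at hint; simp at hint)
        (by rw [← Subtype.coe_le_coe, h0]; exact empty_subset _)
      rw [h0] at h1
      exact h1 rfl
    obtain ⟨w, hw, hwF⟩ := exists_of_ssubset (F.2.subset.ssubset_of_ne hF.1)
    obtain ⟨G, hG, hFG, hwG⟩ := exists_facet_of_isExposed hA hint F.2 hne hw hwF
    have h1 : G ⊆ F.1 := hF.2 (y := ⟨G, hG.1⟩) (fun h => hwG (h.ge hw)) hFG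
    rwa [hFG.antisymm h1]

/-- The facets of a `3`-polytope combinatorially equivalent to a given polytope. -/
theorem IsPolytope3.exists_vertex_map {E' : Type*} [NormedAddCommGroup E'] [NormedSpace ℝ E']
    {P : Set E3} (h : IsPolytope3 P) {P' : Set E'} {A' : Set E'} (hA' : A'.Finite)
    (hP' : P' = convexHull ℝ A') (hPP' : SameCombinatorialType P P') :
    ∃ φ : E' → E3, InjOn φ (P'.extremePoints ℝ) ∧
      φ '' P'.extremePoints ℝ = P.extremePoints ℝ ∧
      facets P = (fun F : FaceLattice P' => convexHull ℝ (φ '' (P'.extremePoints ℝ ∩ F.1))) ''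
        {F | Maximal (fun F : FaceLattice P' => F.1 ≠ P') F} := by
  have hfac := h.mem_facets_iff
  subst hP'
  obtain ⟨⟨A, hA, rfl⟩, hint⟩ := h
  obtain ⟨Φ⟩ := hPP'
  obtain ⟨φ, hinj, himg, hφ⟩ := MinTri.exists_vertex_map hA hA' Φ
  refine ⟨φ, hinj, himg, ?_⟩
  have hface : ∀ F : FaceLattice (convexHull ℝ A),
      F.1 = convexHull ℝ (φ '' ((convexHull ℝ A').extremePoints ℝ ∩ (Φ F).1)) := by
    intro F
    have h1 : φ '' ((convexHull ℝ A').extremePoints ℝ ∩ (Φ F).1) =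
        (convexHull ℝ A).extremePoints ℝ ∩ F.1 := by
      rw [← himg]
      ext x
      constructor
      · rintro ⟨y, ⟨hy, hyF⟩, rfl⟩
        exact ⟨mem_image_of_mem _ hy, (hφ y hy F).2 hyF⟩
      · rintro ⟨⟨y, hy, rfl⟩, hyF⟩
        exact ⟨y, ⟨hy, (hφ y hy F).1 hyF⟩, rfl⟩
    rw [h1]
    exact eq_convexHull_extremePoints_inter hA F.2
  ext F
  constructor
  · intro hF
    refine ⟨Φ ⟨F, hF.1⟩, (maximal_ne_apply_iff Φ _).2 ((hfac ⟨F, hF.1⟩).1 hF), ?_⟩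
    exact (hface ⟨F, hF.1⟩).symm
  · rintro ⟨G, hG, rfl⟩
    have h1 := hface (Φ.symm G)
    rw [Φ.apply_symm_apply] at h1
    change convexHull ℝ _ ∈ _
    rw [← h1, hfac, ← maximal_ne_apply_iff Φ, Φ.apply_symm_apply]
    exact hG

/-! ### Facets of the product of a polygon with an interval -/

/-- A convex polygon, with its vertices in cyclic order. -/
structure PolygonData (m : ℕ) (Q : Set E2) (p : ZMod m → E2) : Prop where
  injective : Function.Injective p
  eq_convexHull : Q = convexHull ℝ (range p)
  extremePoints_eq : Q.extremePoints ℝ = range p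
  exposed_edge : ∀ i, IsExposed ℝ Q (segment ℝ (p i) (p (i + 1)))

namespace PolygonData
variable {m : ℕ} {Q : Set E2} {p : ZMod m → E2}

theorem convex (h : PolygonData m Q p) : Convex ℝ Q := by
  rw [h.eq_convexHull]; exact convex_convexHull ℝ _

theorem mem (h : PolygonData m Q p) (i : ZMod m) : p i ∈ Q := by
  rw [h.eq_convexHull]; exact subset_convexHull ℝ _ (mem_range_self i)

theorem mem_edge_iff (h : PolygonData m Q p) {i k : ZMod m} :
    p k ∈ segment ℝ (p i) (p (i + 1)) ↔ k = i ∨ k = i + 1 := by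
  constructor
  · intro hk
    have h1 : p k ∈ Q.extremePoints ℝ := by rw [h.extremePoints_eq]; exact mem_range_self k
    rw [← convexHull_pair] at hk
    have h2 := mem_of_mem_extremePoints_of_mem_convexHull h1
      (t := {p i, p (i + 1)}) (by rintro x (rfl | rfl) <;> exact h.mem _) h.convex hk
    rcases h2 with h2 | h2
    · exact Or.inl (h.injective h2)
    · exact Or.inr (h.injective h2)
  · rintro (rfl | rfl)
    · exact left_mem_segment ℝ _ _
    · exact right_mem_segment ℝ _ _

theorem exists_functional (h : PolygonData m Q p) (i : ZMod m) :
    ∃ g : StrongDual ℝ E2, g (p i) = g (p (i + 1)) ∧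
      ∀ k, k ≠ i → k ≠ i + 1 → g (p k) < g (p i) := by
  obtain ⟨g, c, hg, hs⟩ := isExposed_iff.1 (h.exposed_edge i)
  have hmem : ∀ k, p k ∈ segment ℝ (p i) (p (i + 1)) ↔ g (p k) = c := fun k => by
    rw [hs]; exact and_iff_right (h.mem k)
  have h1 : g (p i) = c := (hmem i).1 (left_mem_segment ℝ _ _)
  have h2 : g (p (i + 1)) = c := (hmem (i + 1)).1 (right_mem_segment ℝ _ _)
  refine ⟨g, h1.trans h2.symm, fun k hk hk' => ?_⟩
  rw [h1]
  refine lt_of_le_of_ne (hg _ (h.mem k)) fun hc => ?_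
  rcases h.mem_edge_iff.1 ((hmem k).2 hc) with h3 | h3
  exacts [hk h3, hk' h3]

/-- Every proper face of a convex polygon is contained in an edge. -/
theorem exists_subset_edge (h : PolygonData m Q p) (hm : 3 ≤ m) {F : Set E2}
    (hF : IsExposed ℝ Q F) (hne : F ≠ Q) : ∃ i, F ⊆ segment ℝ (p i) (p (i + 1)) := by
  have : NeZero m := ⟨by omega⟩
  rcases F.eq_empty_or_nonempty with rfl | hFne
  · exact ⟨0, empty_subset _⟩
  have hfin : (range p).Finite := finite_range p
  have hext := h.extremePoints_eq
  obtain ⟨f, c, hf, hFs⟩ := isExposed_iff.1 hF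
  have hsub : ∀ j, (∀ k, k ≠ j → k ≠ j + 1 → f (p k) < c) →
      F ⊆ segment ℝ (p j) (p (j + 1)) := by
    intro j hj
    have hE := h.exposed_edge j
    rw [h.eq_convexHull] at hF hE
    refine hF.subset_of_inter_subset hE ?_
    rintro _ ⟨⟨k, rfl⟩, hk⟩
    rw [h.mem_edge_iff]
    rw [hFs] at hk
    by_contra! hc
    exact (hj k hc.1 hc.2).ne hk.2
  obtain ⟨x, hxF, hx⟩ : ∃ x ∈ F, x ∈ Q.extremePoints ℝ := by
    rw [h.eq_convexHull] at hF ⊢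
    exact hF.exists_extremePoint hfin hFne
  rw [hext] at hx
  obtain ⟨i, rfl⟩ := hx
  have hfi : f (p i) = c := by rw [hFs] at hxF; exact hxF.2
  have h1 := zmod_one_ne_zero hm
  have h2 := zmod_two_ne_zero hm
  have hi1 : i - 1 ≠ i := fun hc => h1 (by simpa using hc)
  have hi2 : i - 1 ≠ i + 1 := fun hc => h2 (by
    have : (2 : ZMod m) = (i + 1) - (i - 1) := by ring
    rw [this, hc, sub_self])
  have hi3 : i + 1 ≠ i := fun hc => h1 (by simpa using hc)
  obtain ⟨g, hg, hg'⟩ := h.exists_functional i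
  obtain ⟨l, hl, hl'⟩ := h.exists_functional (i - 1)
  rw [sub_add_cancel] at hl hl'
  rw [hl] at hl'
  -- The two edge directions at the vertex `p i` form a basis, with dual functionals proportional to
  -- `l` and `g`. All vertices have nonnegative coordinates in it, positive off the corresponding
  -- edge.
  set a := p (i + 1) - p i with ha
  set b := p (i - 1) - p i with hb
  have hga : g a = 0 := by rw [ha, map_sub, hg, sub_self]
  have hlb : l b = 0 := by rw [hb, map_sub, hl, sub_self]
  have hgb : g b < 0 := by rw [hb, map_sub, sub_neg]; exact hg' _ hi1 hi2
  have hla : l a < 0 := by rw [ha, map_sub, sub_neg]; exact hl' _ hi2.symm hi3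
  have hli : LinearIndependent ℝ ![a, b] := by
    rw [LinearIndependent.pair_iff]
    intro s t hst
    have h3 := congrArg g hst
    have h4 := congrArg l hst
    simp only [map_add, map_smul, smul_eq_mul, hga, hlb, mul_zero, zero_add, add_zero,
      map_zero, mul_eq_zero] at h3 h4
    exact ⟨h4.resolve_right hla.ne, h3.resolve_right hgb.ne⟩
  have hspan := hli.span_eq_top_of_card_eq_finrank (by simp)
  have hcoord : ∀ k, ∃ α β : ℝ, p k - p i = α • a + β • b := by
    intro k
    have h3 : p k - p i ∈ Submodule.span ℝ (range ![a, b]) := hspan ▸ Submodule.mem_top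
    rw [Matrix.range_cons, Matrix.range_cons, Matrix.range_empty, union_empty,
      singleton_union, Submodule.mem_span_pair] at h3
    obtain ⟨α, β, h3⟩ := h3
    exact ⟨α, β, h3.symm⟩
  have hfa : f a ≤ 0 := by rw [ha, map_sub, sub_nonpos, hfi]; exact hf _ (h.mem _)
  have hfb : f b ≤ 0 := by rw [hb, map_sub, sub_nonpos, hfi]; exact hf _ (h.mem _)
  have hval : ∀ k, ∃ α β : ℝ, f (p k) = c + (α * f a + β * f b) ∧
      (k ≠ i → 0 ≤ α ∧ 0 ≤ β) ∧ (k ≠ i → k ≠ i + 1 → 0 < β) ∧ (k ≠ i → k ≠ i - 1 → 0 < α) := by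
    intro k
    obtain ⟨α, β, hk⟩ := hcoord k
    have h3 := congrArg g hk
    have h4 := congrArg l hk
    have h5 := congrArg f hk
    simp only [map_add, map_sub, map_smul, smul_eq_mul, hga, hlb, mul_zero, zero_add,
      add_zero] at h3 h4 h5
    have hβ : k ≠ i → k ≠ i + 1 → 0 < β := fun hk1 hk2 => by
      have := hg' k hk1 hk2
      by_contra! hc
      nlinarith
    have hα : k ≠ i → k ≠ i - 1 → 0 < α := fun hk1 hk2 => by
      have := hl' k hk2 hk1
      by_contra! hc
      nlinarith
    refine ⟨α, β, by linarith, fun hk1 => ⟨?_, ?_⟩, hβ, hα⟩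
    · by_cases hk2 : k = i - 1
      · have : l (p k) = l (p i) := by rw [hk2, hl]
        rw [this, sub_self] at h4
        exact ((mul_eq_zero.1 h4.symm).resolve_right hla.ne).ge
      · exact (hα hk1 hk2).le
    · by_cases hk2 : k = i + 1
      · have : g (p k) = g (p i) := by rw [hk2, hg]
        rw [this, sub_self] at h3
        exact ((mul_eq_zero.1 h3.symm).resolve_right hgb.ne).ge
      · exact (hβ hk1 hk2).le
  -- `f` does not increase along either edge. If it decreases along one of them, the face lies in
  -- the other edge; if along neither, `f` is constant and the face is everything.
  rcases hfb.lt_or_eq with hfb' | hfb'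
  · refine ⟨i, hsub i fun k hk1 hk2 => ?_⟩
    obtain ⟨α, β, hk, h3, h4, -⟩ := hval k
    have := mul_neg_of_pos_of_neg (h4 hk1 hk2) hfb'
    have := mul_nonpos_of_nonneg_of_nonpos (h3 hk1).1 hfa
    linarith
  rcases hfa.lt_or_eq with hfa' | hfa'
  · refine ⟨i - 1, hsub (i - 1) fun k hk1 hk2 => ?_⟩
    rw [sub_add_cancel] at hk2
    obtain ⟨α, β, hk, -, -, h5⟩ := hval k
    have := mul_neg_of_pos_of_neg (h5 hk2 hk1) hfa'
    rw [hk, hfb']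
    linarith
  · refine absurd (hF.subset.antisymm ?_) hne
    have hFc := hF.convex h.convex
    rw [h.eq_convexHull]
    refine convexHull_min ?_ hFc
    rintro _ ⟨k, rfl⟩
    obtain ⟨α, β, hk, -⟩ := hval k
    rw [hFs]
    exact ⟨h.mem k, by rw [hk, hfa', hfb']; ring⟩

end PolygonData

theorem extremePoints_Icc_zero_one : (Icc (0 : ℝ) 1).extremePoints ℝ = {0, 1} := by
  apply Subset.antisymm
  · rw [← segment_eq_Icc zero_le_one, ← convexHull_pair]
    exact extremePoints_convexHull_subset
  · rintro x (rfl | rfl)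
    · refine ⟨by simp, ?_⟩
      rintro y ⟨hy, -⟩ z ⟨hz, -⟩ ⟨a, b, ha, hb, -, h⟩
      simp only [smul_eq_mul] at h
      have := mul_nonneg hb.le hz
      have := mul_nonneg ha.le hy
      have : a * y = 0 := by linarith
      exact (mul_eq_zero.1 this).resolve_left ha.ne'
    · refine ⟨by simp, ?_⟩
      rintro y ⟨-, hy⟩ z ⟨-, hz⟩ ⟨a, b, ha, hb, hab, h⟩
      simp only [smul_eq_mul] at h
      have := mul_nonneg hb.le (sub_nonneg.2 hz)
      have := mul_nonneg ha.le (sub_nonneg.2 hy)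
      have : a * (1 - y) = 0 := by nlinarith
      have := (mul_eq_zero.1 this).resolve_left ha.ne'
      linarith

namespace PolygonData
variable {m : ℕ} {Q : Set E2} {p : ZMod m → E2}

theorem prod_eq_convexHull (h : PolygonData m Q p) :
    Q ×ˢ Icc (0 : ℝ) 1 = convexHull ℝ (range p ×ˢ {0, 1}) := by
  rw [convexHull_prod, ← h.eq_convexHull, convexHull_pair, segment_eq_Icc zero_le_one]

theorem extremePoints_prod (h : PolygonData m Q p) :
    (Q ×ˢ Icc (0 : ℝ) 1).extremePoints ℝ = range p ×ˢ {0, 1} := by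
  rw [_root_.extremePoints_prod, h.extremePoints_eq, extremePoints_Icc_zero_one]

/-- The list of the facets of the product of a polygon with an interval. -/
def prodFacets (m : ℕ) (Q : Set E2) (p : ZMod m → E2) : Set (Set (E2 × ℝ)) :=
  {Q ×ˢ {0}, Q ×ˢ {1}} ∪ range fun i => segment ℝ (p i) (p (i + 1)) ×ˢ Icc (0 : ℝ) 1

theorem exposed_of_mem_prodFacets (h : PolygonData m Q p) {F : Set (E2 × ℝ)}
    (hF : F ∈ prodFacets m Q p) : IsExposed ℝ (Q ×ˢ Icc (0 : ℝ) 1) F := by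
  rcases hF with (rfl | rfl) | ⟨i, rfl⟩
  · have h1 : Q ×ˢ {(0 : ℝ)} =
        {y ∈ Q ×ˢ Icc (0 : ℝ) 1 | (-ContinuousLinearMap.snd ℝ E2 ℝ) y = 0} := by
      ext y
      constructor
      · rintro ⟨hx, hy⟩
        have hy : y.2 = 0 := hy
        exact ⟨⟨hx, by simp [hy]⟩, by simp [hy]⟩
      · rintro ⟨⟨hx, -⟩, hy⟩
        exact ⟨hx, by simpa using hy⟩
    rw [h1]
    exact isExposed_setOf _ fun y hy => by simpa using hy.2.1
  · have h1 : Q ×ˢ {(1 : ℝ)} =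
        {y ∈ Q ×ˢ Icc (0 : ℝ) 1 | ContinuousLinearMap.snd ℝ E2 ℝ y = 1} := by
      ext y
      constructor
      · rintro ⟨hx, hy⟩
        have hy : y.2 = 1 := hy
        exact ⟨⟨hx, by simp [hy]⟩, by simp [hy]⟩
      · rintro ⟨⟨hx, -⟩, hy⟩
        exact ⟨hx, by simpa using hy⟩
    rw [h1]
    exact isExposed_setOf _ fun y hy => by simpa using hy.2.2
  · obtain ⟨f, c, hf, hs⟩ := isExposed_iff.1 (h.exposed_edge i)
    have h1 : segment ℝ (p i) (p (i + 1)) ×ˢ Icc (0 : ℝ) 1 =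
        {y ∈ Q ×ˢ Icc (0 : ℝ) 1 | f.comp (ContinuousLinearMap.fst ℝ E2 ℝ) y = c} := by
      rw [hs]
      ext y
      exact ⟨fun hx => ⟨⟨hx.1.1, hx.2⟩, hx.1.2⟩, fun hx => ⟨⟨hx.1.1, hx.2⟩, hx.1.2⟩⟩
    change IsExposed ℝ _ (segment ℝ (p i) (p (i + 1)) ×ˢ Icc (0 : ℝ) 1)
    rw [h1]
    exact isExposed_setOf _ fun y hy => hf y.1 hy.1

theorem exists_subset_mem_prodFacets (h : PolygonData m Q p) (hm : 3 ≤ m) {F : Set (E2 × ℝ)}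
    (hF : IsExposed ℝ (Q ×ˢ Icc (0 : ℝ) 1) F) (hne : F ≠ Q ×ˢ Icc (0 : ℝ) 1) :
    ∃ G ∈ prodFacets m Q p, F ⊆ G := by
  obtain ⟨f, c, hf, rfl⟩ := isExposed_iff.1 hF
  have hsplit : ∀ x t, f (x, t) = f (x, 0) + t * f (0, 1) := fun x t => by
    rw [← smul_eq_mul, ← map_smul, ← map_add]; simp
  -- The slope of `f` in the height direction decides: negative gives the bottom, positive the top,
  -- and zero makes the face a cylinder over a proper face of `Q`.
  rcases lt_trichotomy (f (0, 1)) 0 with hg | hg | hg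
  · refine ⟨Q ×ˢ {0}, Or.inl (Or.inl rfl), ?_⟩
    rintro ⟨x, t⟩ ⟨⟨hx, ht⟩, hc⟩
    refine ⟨hx, ?_⟩
    have h1 := hf (x, 0) ⟨hx, by simp⟩
    rw [hsplit] at hc
    have : (0 : ℝ) ≤ t := ht.1
    change t = 0
    by_contra h0
    nlinarith [this.lt_of_ne' h0]
  · have hFs : IsExposed ℝ Q {x ∈ Q | f (x, 0) = c} :=
      isExposed_setOf (f.comp (ContinuousLinearMap.inl ℝ E2 ℝ)) fun x hx =>
        hf (x, 0) ⟨hx, by simp⟩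
    obtain ⟨i, hi⟩ := h.exists_subset_edge hm hFs (by
      intro hc
      refine hne ((sep_subset _ _).antisymm ?_)
      rintro ⟨x, t⟩ ⟨hx, ht⟩
      refine ⟨⟨hx, ht⟩, ?_⟩
      have hx' : x ∈ Q := hx
      rw [← hc] at hx'
      rw [hsplit, hg, mul_zero, add_zero]
      exact hx'.2)
    refine ⟨_, Or.inr ⟨i, rfl⟩, ?_⟩
    rintro ⟨x, t⟩ ⟨⟨hx, ht⟩, hc⟩
    rw [hsplit, hg, mul_zero, add_zero] at hc
    exact ⟨hi ⟨hx, hc⟩, ht⟩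
  · refine ⟨Q ×ˢ {1}, Or.inl (Or.inr rfl), ?_⟩
    rintro ⟨x, t⟩ ⟨⟨hx, ht⟩, hc⟩
    refine ⟨hx, ?_⟩
    have h1 := hf (x, 1) ⟨hx, by simp⟩
    rw [hsplit] at hc h1
    have : t ≤ 1 := ht.2
    change t = 1
    by_contra h0
    nlinarith [this.lt_of_ne h0]

theorem pred_notMem_edge (h : PolygonData m Q p) (hm : 3 ≤ m) (j : ZMod m) :
    p (j - 1) ∉ segment ℝ (p j) (p (j + 1)) := by
  intro hj
  rcases h.mem_edge_iff.1 hj with h3 | h3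
  · exact zmod_one_ne_zero hm (by simpa using h3)
  · exact zmod_two_ne_zero hm (by linear_combination -h3)

/-- The listed faces form an antichain; since every proper face lies in one of them, they are
exactly the maximal ones. -/
theorem eq_of_subset_of_mem_prodFacets (h : PolygonData m Q p) (hm : 3 ≤ m) {F G : Set (E2 × ℝ)}
    (hF : F ∈ prodFacets m Q p) (hG : G ∈ prodFacets m Q p) (hFG : F ⊆ G) : F = G := by
  have hI0 : (0 : ℝ) ∈ Icc (0 : ℝ) 1 := by simp
  have hI1 : (1 : ℝ) ∈ Icc (0 : ℝ) 1 := by simp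
  rcases hF with (rfl | rfl) | ⟨i, rfl⟩
  · rcases hG with (rfl | rfl) | ⟨j, rfl⟩
    · rfl
    · exact absurd (hFG (mk_mem_prod (h.mem 0) rfl)).2 (by simp)
    · exact absurd (hFG (mk_mem_prod (h.mem (j - 1)) rfl)).1 (h.pred_notMem_edge hm j)
  · rcases hG with (rfl | rfl) | ⟨j, rfl⟩
    · exact absurd (hFG (mk_mem_prod (h.mem 0) rfl)).2 (by simp)
    · rfl
    · exact absurd (hFG (mk_mem_prod (h.mem (j - 1)) rfl)).1 (h.pred_notMem_edge hm j)
  · have hl := left_mem_segment ℝ (p i) (p (i + 1))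
    have hr := right_mem_segment ℝ (p i) (p (i + 1))
    rcases hG with (rfl | rfl) | ⟨j, rfl⟩
    · exact absurd (hFG (mk_mem_prod hl hI1)).2 (by simp)
    · exact absurd (hFG (mk_mem_prod hl hI0)).2 (by simp)
    · have h3 := h.mem_edge_iff.1 (hFG (mk_mem_prod hl hI0)).1
      have h4 := h.mem_edge_iff.1 (hFG (mk_mem_prod hr hI0)).1
      obtain rfl : i = j := by
        rcases h3 with h3 | h3
        · exact h3
        · rcases h4 with h4 | h4
          · exact absurd (by linear_combination h4 - h3) (zmod_two_ne_zero hm)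
          · exact add_right_cancel h4
      rfl

theorem ne_of_mem_prodFacets (h : PolygonData m Q p) (hm : 3 ≤ m) {F : Set (E2 × ℝ)}
    (hF : F ∈ prodFacets m Q p) : F ≠ Q ×ˢ Icc (0 : ℝ) 1 := by
  intro hc
  have h0 : ∀ i, (p i, (0 : ℝ)) ∈ F := fun i => hc ▸ mk_mem_prod (h.mem i) (by simp)
  have h1 : ∀ i, (p i, (1 : ℝ)) ∈ F := fun i => hc ▸ mk_mem_prod (h.mem i) (by simp)
  rcases hF with (rfl | rfl) | ⟨i, rfl⟩
  · exact absurd (h1 0).2 (by simp)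
  · exact absurd (h0 0).2 (by simp)
  · exact h.pred_notMem_edge hm i (h0 (i - 1)).1

theorem maximal_prod_iff (h : PolygonData m Q p) (hm : 3 ≤ m)
    (F : FaceLattice (Q ×ˢ Icc (0 : ℝ) 1)) :
    Maximal (fun F : FaceLattice (Q ×ˢ Icc (0 : ℝ) 1) => F.1 ≠ Q ×ˢ Icc (0 : ℝ) 1) F ↔
      F.1 ∈ prodFacets m Q p := by
  constructor
  · intro hF
    obtain ⟨G, hG, hFG⟩ := h.exists_subset_mem_prodFacets hm F.2 hF.1
    have h1 : G ⊆ F.1 := hF.2 (y := ⟨G, h.exposed_of_mem_prodFacets hG⟩)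
      (h.ne_of_mem_prodFacets hm hG) hFG
    rwa [hFG.antisymm h1]
  · intro hF
    refine ⟨h.ne_of_mem_prodFacets hm hF, fun G hG hFG => ?_⟩
    obtain ⟨G', hG', hGG'⟩ := h.exists_subset_mem_prodFacets hm G.2 hG
    have h1 := h.eq_of_subset_of_mem_prodFacets hm hF hG' (Subset.trans hFG hGG')
    change G.1 ⊆ F.1
    rwa [h1]

end PolygonData

/-! ### Labelling the vertices of a prism -/

/-- The vertices of a prism can be labelled so that its facets are the expected ones. -/
theorem IsPrism.exists_prismData {m : ℕ} (hm : 3 ≤ m) {P : Set E3} (h : IsPrism m P) :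
    ∃ u v, PrismData m P u v := by
  have : NeZero m := ⟨by omega⟩
  obtain ⟨hP, Q, ⟨p, hp1, hp2, hp3, hp4⟩, hPQ⟩ := h
  have hQ : PolygonData m Q p := ⟨hp1, hp2, hp3, hp4⟩
  obtain ⟨φ, hinj, himg, hfac⟩ := hP.exists_vertex_map
    ((finite_range p).prod (by simp : ({0, 1} : Set ℝ).Finite)) hQ.prod_eq_convexHull hPQ
  rw [hQ.extremePoints_prod] at hinj himg hfac
  have hV : ∀ i, ∀ t ∈ ({0, 1} : Set ℝ), (p i, t) ∈ range p ×ˢ ({0, 1} : Set ℝ) :=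
    fun i t ht => ⟨mem_range_self i, ht⟩
  have hφ : ∀ i j, ∀ s ∈ ({0, 1} : Set ℝ), ∀ t ∈ ({0, 1} : Set ℝ), φ (p i, s) = φ (p j, t) →
      i = j ∧ s = t := fun i j s hs t ht hst => by
    have h1 := hinj (hV i s hs) (hV j t ht) hst
    rw [Prod.mk.injEq] at h1
    exact ⟨hp1 h1.1, h1.2⟩
  have hcast : ∀ i < m, ∀ j < m, (i : ZMod m) = j → i = j := fun i hi j hj hij => by
    rwa [ZMod.natCast_eq_natCast_iff', Nat.mod_eq_of_lt hi, Nat.mod_eq_of_lt hj] at hij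
  have hrange : ∀ t : ℝ, (fun i : ℕ => φ (p i, t)) '' Iio m = φ '' (range p ×ˢ {t}) := by
    intro t
    ext x
    constructor
    · rintro ⟨i, -, rfl⟩
      exact ⟨_, mk_mem_prod (mem_range_self (i : ZMod m)) (mem_singleton t), rfl⟩
    · rintro ⟨⟨-, -⟩, ⟨⟨k, rfl⟩, rfl⟩, rfl⟩
      exact ⟨k.val, ZMod.val_lt k, by simp⟩
  have hbase : ∀ t ∈ ({0, 1} : Set ℝ),
      range p ×ˢ ({0, 1} : Set ℝ) ∩ Q ×ˢ {t} = range p ×ˢ {t} := by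
    rintro t ht
    ext ⟨x, s⟩
    constructor
    · rintro ⟨⟨hx, -⟩, -, hs⟩
      exact ⟨hx, hs⟩
    · rintro ⟨⟨i, rfl⟩, rfl⟩
      exact ⟨⟨mem_range_self i, ht⟩, hQ.mem i, rfl⟩
  have hside : ∀ i, φ '' (range p ×ˢ ({0, 1} : Set ℝ) ∩
      segment ℝ (p i) (p (i + 1)) ×ˢ Icc (0 : ℝ) 1) =
      {φ (p i, 0), φ (p (i + 1), 0), φ (p i, 1), φ (p (i + 1), 1)} := by
    intro i
    have h1 : range p ×ˢ ({0, 1} : Set ℝ) ∩ segment ℝ (p i) (p (i + 1)) ×ˢ Icc (0 : ℝ) 1 =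
        {(p i, 0), (p (i + 1), 0), (p i, 1), (p (i + 1), 1)} := by
      ext ⟨x, s⟩
      constructor
      · rintro ⟨⟨⟨k, rfl⟩, hs⟩, hk, -⟩
        have hs : s = 0 ∨ s = 1 := hs
        rcases hQ.mem_edge_iff.1 hk with rfl | rfl <;> rcases hs with rfl | rfl <;> simp
      · have hl := left_mem_segment ℝ (p i) (p (i + 1))
        have hr := right_mem_segment ℝ (p i) (p (i + 1))
        rintro (h1 | h1 | h1 | h1) <;> obtain ⟨rfl, rfl⟩ := Prod.mk.inj h1
        · exact ⟨⟨mem_range_self _, by simp⟩, hl, by simp⟩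
        · exact ⟨⟨mem_range_self _, by simp⟩, hr, by simp⟩
        · exact ⟨⟨mem_range_self _, by simp⟩, hl, by simp⟩
        · exact ⟨⟨mem_range_self _, by simp⟩, hr, by simp⟩
    rw [h1]
    simp only [image_insert_eq, image_singleton]
  -- Vertices at height `0` become `u` and those at height `1` become `v`; casting natural numbers
  -- to `ZMod m` makes the labels agree at `0` and `m`.
  refine ⟨fun i => φ (p i, 0), fun i => φ (p i, 1), hP, ?_, ?_, ?_, ?_, ?_, ?_, ?_⟩
  · exact fun i hi j hj hij => hcast i hi j hj (hφ _ _ _ (by simp) _ (by simp) hij).1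
  · exact fun i hi j hj hij => hcast i hi j hj (hφ _ _ _ (by simp) _ (by simp) hij).1
  · exact fun i j hij => zero_ne_one (hφ _ _ _ (by simp) _ (by simp) hij).2
  · simp
  · simp
  · rw [hrange, hrange, ← image_union, ← prod_union, singleton_union, himg]
  · rw [hrange, hrange, hfac]
    ext F
    constructor
    · rintro ⟨G, hG, rfl⟩
      rcases (hQ.maximal_prod_iff hm G).1 hG with (hG | hG) | ⟨k, hG⟩
      · left; left
        change convexHull ℝ _ = _
        rw [hG, hbase 0 (by simp)]
      · left; right
        change convexHull ℝ _ = _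
        rw [hG, hbase 1 (by simp)]
      · right
        refine ⟨k.val, ZMod.val_lt k, ?_⟩
        change _ = convexHull ℝ _
        rw [← hG, hside]
        simp
    · intro hF
      have hmax : ∀ G (hG : G ∈ PolygonData.prodFacets m Q p), convexHull ℝ (φ ''
          (range p ×ˢ ({0, 1} : Set ℝ) ∩ G)) ∈
          (fun F : FaceLattice (Q ×ˢ Icc (0 : ℝ) 1) =>
            convexHull ℝ (φ '' (range p ×ˢ ({0, 1} : Set ℝ) ∩ F.1))) ''
          {F | Maximal (fun F : FaceLattice (Q ×ˢ Icc (0 : ℝ) 1) =>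
            F.1 ≠ Q ×ˢ Icc (0 : ℝ) 1) F} := fun G hG =>
        ⟨⟨G, hQ.exposed_of_mem_prodFacets hG⟩, (hQ.maximal_prod_iff hm _).2 hG, rfl⟩
      rcases hF with (rfl | rfl) | ⟨i, -, rfl⟩
      · rw [← hbase 0 (by simp)]
        exact hmax _ (Or.inl (Or.inl rfl))
      · rw [← hbase 1 (by simp)]
        exact hmax _ (Or.inl (Or.inr rfl))
      · have h1 := hmax _ (Or.inr ⟨(i : ZMod m), rfl⟩)
        rw [hside] at h1
        simpa using h1

/-! ### Conclusion -/

theorem natCeil_half (m : ℕ) : ⌈(m : ℝ) / 2⌉₊ = (m + 1) / 2 := by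
  apply le_antisymm
  · rw [Nat.ceil_le]
    have : m ≤ 2 * ((m + 1) / 2) := by omega
    have : (m : ℝ) ≤ 2 * (((m + 1) / 2 : ℕ) : ℝ) := by exact_mod_cast this
    linarith
  · have h1 := Nat.le_ceil ((m : ℝ) / 2)
    have : (m : ℝ) ≤ 2 * (⌈(m : ℝ) / 2⌉₊ : ℝ) := by linarith
    have : m ≤ 2 * ⌈(m : ℝ) / 2⌉₊ := by exact_mod_cast this
    omega

theorem isLeast_triangulationSizes {P : Set E3} {n : ℕ}
    (hlow : ∀ T, IsTriangulation (P.extremePoints ℝ) T → n ≤ T.card)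
    (hupp : ∃ T, IsTriangulation (P.extremePoints ℝ) T ∧ T.card ≤ n) :
    IsLeast (triangulationSizes P) n := by
  obtain ⟨T, hT, hn⟩ := hupp
  refine ⟨⟨T, hT, hn.antisymm (hlow T hT)⟩, ?_⟩
  rintro _ ⟨T', hT', rfl⟩
  exact hlow T' hT'

end MinTri

theorem mainTheorem4 (m : ℕ) (hm : 3 ≤ m) :
    (∀ P : Set MinTri.E3, MinTri.IsPrism m P →
      IsLeast (MinTri.triangulationSizes P) (2 * m - 5 + ⌈(m : ℝ) / 2⌉₊)) ∧
    (∀ P : Set MinTri.E3, MinTri.IsAntiprism m P →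
      IsLeast (MinTri.triangulationSizes P) (3 * m - 5)) := by
  have : NeZero m := ⟨by omega⟩
  constructor
  · intro P hP
    obtain ⟨u, v, h⟩ := hP.exists_prismData hm
    rw [MinTri.natCeil_half]
    exact MinTri.isLeast_triangulationSizes (fun T hT => h.lower hm hT) (h.upper hm)
  · rintro P ⟨hP, u, v, huv, hext, hfac⟩
    exact MinTri.isLeast_triangulationSizes
      (fun T hT => MinTri.antiprism_lower hm hP huv hext hfac hT)
      (MinTri.antiprism_upper hm hP huv hext hfac)
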